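/- Let $\Sigma$ be a smooth $3$-manifold, let $\alpha\ge 0$, and let $h(\lambda)$, $\lambda\in J$, be a smooth family of Riemannian metrics on $\Sigma$ ($J\subset\mathbb R$ an interval with more than one point) solving the RG-2 flow $$\frac{\partial h_{ab}}{\partial\lambda}=-2R_{ab}-\frac{\alpha}{2}R_{apqs}R_b{}^{pqs}.$$ Let $S\subset\Sigma$ be a fixed closed (compact, without boundary) smoothly embedded surface. For each $\lambda$ let $\gamma_{ij}$ be the metric induced on $S$ by $h(\lambda)$, $\mathcal R$ its scalar curvature, $K=\gamma^{ij}K_{ij}$ the trace of the extrinsic curvature of $S$ in $(\Sigma,h(\lambda))$ (with respect to either unit normal), $A(\lambda)=\int_S\sqrt{\gamma}\,d^2x$ the area of $S$, and $$C(S)=\int_S(2\mathcal R-K^2)\sqrt{\gamma}\,d^2x$$ its compactness. Then at every $\lambda\in J$ for which the scalar curvature $R$ of $h(\lambda)$ is nonnegative at the points of $S$, the area is differentiable in $\lambda$ (one-sidedly at an endpoint of $J$) and $$\frac{dA}{d\lambda}\le-\frac14\,C(S).$$ -/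

import Mathlib

open Set
open scoped Manifold ContDiff

noncomputable section

/-! ### Curvature in local coordinates

`G y` is the matrix of components of a metric at the coordinate point `y` of `ℝⁿ`. -/

/-- The partial derivative `∂_i f` at `y`. -/
def partialDeriv {n : ℕ} (i : Fin n) (f : EuclideanSpace ℝ (Fin n) → ℝ)
    (y : EuclideanSpace ℝ (Fin n)) : ℝ :=
  fderiv ℝ f y (EuclideanSpace.single i 1)

/-- Christoffel symbols of the Levi-Civita connection,
`Γ^k_{ij} = ½ G^{kl} (∂_i G_{jl} + ∂_j G_{il} - ∂_l G_{ij})`. -/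
def christoffel {n : ℕ} (G : EuclideanSpace ℝ (Fin n) → Matrix (Fin n) (Fin n) ℝ)
    (k i j : Fin n) (y : EuclideanSpace ℝ (Fin n)) : ℝ :=
  (1 / 2) * ∑ l, (G y)⁻¹ k l *
    (partialDeriv i (fun z => G z j l) y + partialDeriv j (fun z => G z i l) y
      - partialDeriv l (fun z => G z i j) y)

/-- Components `R^l_{kij}` of the Riemann tensor, `R(∂_i, ∂_j) ∂_k = R^l_{kij} ∂_l`. -/
def riemannUp {n : ℕ} (G : EuclideanSpace ℝ (Fin n) → Matrix (Fin n) (Fin n) ℝ)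
    (l k i j : Fin n) (y : EuclideanSpace ℝ (Fin n)) : ℝ :=
  partialDeriv i (christoffel G l j k) y - partialDeriv j (christoffel G l i k) y
    + ∑ m, (christoffel G l i m y * christoffel G m j k y
      - christoffel G l j m y * christoffel G m i k y)

/-- Components `R_{lkij} = G_{lm} R^m_{kij}` of the Riemann tensor with all indices lowered. -/
def riemannDown {n : ℕ} (G : EuclideanSpace ℝ (Fin n) → Matrix (Fin n) (Fin n) ℝ)
    (l k i j : Fin n) (y : EuclideanSpace ℝ (Fin n)) : ℝ :=
  ∑ m, G y l m * riemannUp G m k i j y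

/-- Components `R_{jk} = R^i_{kij}` of the Ricci tensor. -/
def ricci {n : ℕ} (G : EuclideanSpace ℝ (Fin n) → Matrix (Fin n) (Fin n) ℝ)
    (j k : Fin n) (y : EuclideanSpace ℝ (Fin n)) : ℝ :=
  ∑ i, riemannUp G i k i j y

/-- The scalar curvature `G^{jk} R_{jk}`. -/
def coordScalarCurvature {n : ℕ} (G : EuclideanSpace ℝ (Fin n) → Matrix (Fin n) (Fin n) ℝ)
    (y : EuclideanSpace ℝ (Fin n)) : ℝ :=
  ∑ j, ∑ k, (G y)⁻¹ j k * ricci G j k y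

/-- Components of the quadratic curvature tensor `R_{apqs} R_b^{pqs}`. -/
def riemannSq {n : ℕ} (G : EuclideanSpace ℝ (Fin n) → Matrix (Fin n) (Fin n) ℝ)
    (a b : Fin n) (y : EuclideanSpace ℝ (Fin n)) : ℝ :=
  ∑ p, ∑ q, ∑ s, ∑ p', ∑ q', ∑ s',
    (G y)⁻¹ p p' * (G y)⁻¹ q q' * (G y)⁻¹ s s' *
      riemannDown G a p q s y * riemannDown G b p' q' s' y

/-! ### Metrics on manifolds -/

/-- A smooth Riemannian metric on the `n`-dimensional manifold `N`. -/
abbrev SmoothMetric (n : ℕ) (N : Type*) [TopologicalSpace N]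
    [ChartedSpace (EuclideanSpace ℝ (Fin n)) N] [IsManifold (𝓡 n) ∞ N] :=
  Bundle.ContMDiffRiemannianMetric (𝓡 n) ∞ (EuclideanSpace ℝ (Fin n))
    (TangentSpace (𝓡 n) : N → Type _)

section

variable {n : ℕ} {N : Type*} [TopologicalSpace N] [ChartedSpace (EuclideanSpace ℝ (Fin n)) N]

/-- Components `β(∂_i, ∂_j)` in the chart `e` of a field `β` of bilinear forms on `N`,
at the point with coordinates `y`. -/
def coordMatrix (β : ∀ x : N, TangentSpace (𝓡 n) x → TangentSpace (𝓡 n) x → ℝ)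
    (e : OpenPartialHomeomorph N (EuclideanSpace ℝ (Fin n)))
    (y : EuclideanSpace ℝ (Fin n)) : Matrix (Fin n) (Fin n) ℝ :=
  Matrix.of fun i j => β (e.symm y)
    (mfderiv (𝓡 n) (𝓡 n) e.symm y (EuclideanSpace.single i (1 : ℝ)))
    (mfderiv (𝓡 n) (𝓡 n) e.symm y (EuclideanSpace.single j (1 : ℝ)))

/-- The scalar curvature of `β` (meant for metrics) at the point `x`. It does not depend on the
chart; the preferred chart at `x` is used. -/
def scalarCurvature (β : ∀ x : N, TangentSpace (𝓡 n) x → TangentSpace (𝓡 n) x → ℝ) (x : N) : ℝ :=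
  coordScalarCurvature (coordMatrix β (chartAt _ x)) (chartAt (EuclideanSpace ℝ (Fin n)) x x)

end

/-- `g` as a field of bilinear forms. -/
def SmoothMetric.form {n : ℕ} {N : Type*} [TopologicalSpace N]
    [ChartedSpace (EuclideanSpace ℝ (Fin n)) N] [IsManifold (𝓡 n) ∞ N] (g : SmoothMetric n N)
    (x : N) (v w : TangentSpace (𝓡 n) x) : ℝ :=
  g.inner x v w

/-- `h` is a smooth solution on the time interval `J` of the RG-2 flow
`∂h_{ab}/∂λ = -2 R_{ab} - (α/2) R_{apqs} R_b^{pqs}` (in all smooth charts). -/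
structure IsRG2Flow {n : ℕ} {N : Type*} [TopologicalSpace N]
    [ChartedSpace (EuclideanSpace ℝ (Fin n)) N] [IsManifold (𝓡 n) ∞ N]
    (α : ℝ) (J : Set ℝ) (h : ℝ → SmoothMetric n N) : Prop where
  smooth : ∀ e ∈ IsManifold.maximalAtlas (𝓡 n) ∞ N, ∀ a b : Fin n,
    ContDiffOn ℝ ∞ (fun z : ℝ × EuclideanSpace ℝ (Fin n) => coordMatrix (h z.1).form e z.2 a b)
      (J ×ˢ e.target)
  flow : ∀ e ∈ IsManifold.maximalAtlas (𝓡 n) ∞ N, ∀ t ∈ J, ∀ y ∈ e.target, ∀ a b : Fin n,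
    HasDerivWithinAt (fun s => coordMatrix (h s).form e y a b)
      (-2 * ricci (coordMatrix (h t).form e) a b y
        - α / 2 * riemannSq (coordMatrix (h t).form e) a b y) J t

/-! ### Integration over a closed surface -/

section

variable {S : Type*} [TopologicalSpace S] [ChartedSpace (EuclideanSpace ℝ (Fin 2)) S]
  [IsManifold (𝓡 2) ∞ S] [CompactSpace S] [T2Space S]

variable (S) in
/-- A smooth partition of unity on `S` subordinate to the domains of the preferred charts. -/
def chartPartition : SmoothPartitionOfUnity S (𝓡 2) S univ :=
  (SmoothPartitionOfUnity.exists_isSubordinate_chartAt_source (𝓡 2) S).choose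

variable (S) in
theorem chartPartition_isSubordinate :
    (chartPartition S).IsSubordinate
      (fun p => (chartAt (EuclideanSpace ℝ (Fin 2)) p).source) :=
  (SmoothPartitionOfUnity.exists_isSubordinate_chartAt_source (𝓡 2) S).choose_spec

/-- The integral `∫_S f √γ d²x` of `f` against the area element of the metric `γ` on the closed
surface `S`: cut `f` up with a partition of unity and integrate in charts. -/
def surfaceIntegral (γ : ∀ p : S, TangentSpace (𝓡 2) p → TangentSpace (𝓡 2) p → ℝ)
    (f : S → ℝ) : ℝ :=
  ∑ᶠ p : S, ∫ y in (chartAt (EuclideanSpace ℝ (Fin 2)) p).target,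
    chartPartition S p ((chartAt (EuclideanSpace ℝ (Fin 2)) p).symm y)
      * f ((chartAt (EuclideanSpace ℝ (Fin 2)) p).symm y)
      * Real.sqrt (coordMatrix γ (chartAt (EuclideanSpace ℝ (Fin 2)) p) y).det

end

/-! ### Geometry of a closed surface in a Riemannian 3-manifold -/

section

variable {M : Type*} [TopologicalSpace M] [ChartedSpace (EuclideanSpace ℝ (Fin 3)) M]
  [IsManifold (𝓡 3) ∞ M]
  {S : Type*} [TopologicalSpace S] [ChartedSpace (EuclideanSpace ℝ (Fin 2)) S]

/-- The metric `γ` induced on `S` by `F : S → M` from the metric `g` of `M`. -/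
def inducedMetric (g : SmoothMetric 3 M) (F : S → M) (p : S) (v w : TangentSpace (𝓡 2) p) : ℝ :=
  g.form (F p) (mfderiv (𝓡 2) (𝓡 3) F p v) (mfderiv (𝓡 2) (𝓡 3) F p w)

/-- `ν` is one of the two unit normal vectors at `F p` to the surface `F : S → M`. -/
def IsUnitNormal (g : SmoothMetric 3 M) (F : S → M) (p : S) (ν : TangentSpace (𝓡 3) (F p)) : Prop :=
  g.form (F p) ν ν = 1 ∧
    ∀ v : TangentSpace (𝓡 2) p, g.form (F p) ν (mfderiv (𝓡 2) (𝓡 3) F p v) = 0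

/-- The coordinate expression of `F : S → M` in the preferred charts at `p` and `F p`. -/
def localMap (F : S → M) (p : S) (u : EuclideanSpace ℝ (Fin 2)) : EuclideanSpace ℝ (Fin 3) :=
  chartAt (EuclideanSpace ℝ (Fin 3)) (F p) (F ((chartAt (EuclideanSpace ℝ (Fin 2)) p).symm u))

/-- The extrinsic curvature `K_{ij} = ⟨∇_i ν, ∂_j F⟩ = -⟨ν, ∇_i ∂_j F⟩` at `p` with respect to the
unit normal `ν`, in the preferred chart at `p`; here
`(∇_i ∂_j F)^b = ∂_i ∂_j F^b + Γ^b_{cd} ∂_i F^c ∂_j F^d` in the preferred chart at `F p`. -/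
def extrinsicCurvature (g : SmoothMetric 3 M) (F : S → M) (p : S) (ν : TangentSpace (𝓡 3) (F p))
    (i j : Fin 2) : ℝ :=
  let u : EuclideanSpace ℝ (Fin 2) := chartAt (EuclideanSpace ℝ (Fin 2)) p p
  let c := chartAt (EuclideanSpace ℝ (Fin 3)) (F p)
  let G := coordMatrix g.form c
  let νc : EuclideanSpace ℝ (Fin 3) := mfderiv (𝓡 3) (𝓡 3) c (F p) ν
  let f : Fin 3 → EuclideanSpace ℝ (Fin 2) → ℝ := fun b z => localMap F p z b
  ∑ a, ∑ b, -(G (c (F p)) a b * νc a) *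
    (partialDeriv i (partialDeriv j (f b)) u
      + ∑ k, ∑ l, christoffel G b k l (c (F p)) * partialDeriv i (f k) u * partialDeriv j (f l) u)

/-- The trace `K = γ^{ij} K_{ij}` of the extrinsic curvature. -/
def meanCurvature (g : SmoothMetric 3 M) (F : S → M) (p : S) (ν : TangentSpace (𝓡 3) (F p)) : ℝ :=
  ∑ i, ∑ j,
    (coordMatrix (inducedMetric g F) (chartAt _ p) (chartAt (EuclideanSpace ℝ (Fin 2)) p p))⁻¹ i j
      * extrinsicCurvature g F p ν i j

variable [IsManifold (𝓡 2) ∞ S] [CompactSpace S] [T2Space S]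

/-- The area `A(S) = ∫_S √γ d²x`. -/
def area (g : SmoothMetric 3 M) (F : S → M) : ℝ :=
  surfaceIntegral (inducedMetric g F) (fun _ => 1)

/-- The compactness `C(S) = ∫_S (2ℛ - K²) √γ d²x`, where `ℛ` is the scalar curvature of the induced
metric and `K` is the trace of the extrinsic curvature with respect to the unit normals `ν`
(the sign of `ν` does not matter). -/
def compactness (g : SmoothMetric 3 M) (F : S → M) (ν : ∀ p : S, TangentSpace (𝓡 3) (F p)) : ℝ :=
  surfaceIntegral (inducedMetric g F)
    (fun p => 2 * scalarCurvature (inducedMetric g F) p - meanCurvature g F p (ν p) ^ 2)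

end

end

/-! Since `S` is fixed, its area density changes only through the ambient metric. Jacobi's formula
gives ∂_λ √γ = ½ √γ γ^{ij} ∂_λ γ_{ij} = √γ (-γ^{ij} R_{ij} - (α/4) γ^{ij} R_{ipqs} R_j^{pqs}), where
i, j are tangential. The quadratic curvature tensor is positive semidefinite
(`posSemidef_riemannSq`), so for α ≥ 0 its term may be dropped. The contracted Gauss equation
(`IsMetricAt.gauss_contracted`) reads 2 γ^{ij} R_{ij} = R + ℛ - K² + K_{ij} K^{ij}. With R ≥ 0 and
K_{ij} K^{ij} ≥ ½ K², valid on a surface (`coTrace_sq_le`), it yields γ^{ij} R_{ij} ≥ ¼ (2ℛ - K²).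
This pointwise estimate is `exists_deriv_area_density`; integrating it over `S` gives the theorem.

Curvature is given by partial derivatives of metric components, so the geometry is done for fields
of bilinear forms on coordinate spaces, with all indices lowered. The main tool is the behaviour of
lowered Christoffel symbols and of the Riemann tensor under pullback by a map `F`
(`lowChristoffel_pullbackForm`, `IsMetricAt.riemannForm_pullbackForm`). Taking `F` to be the
embedding gives the Gauss equation; taking `F` to be a change of charts gives the independence of
scalar curvature from the chart.

Two analytic points remain. The unit normals are an arbitrary pointwise choice, so the continuity of
K² is obtained from an expression without ν (`meanSq`). The derivative of the area is taken under
the integral sign, chart by chart with a partition of unity, and within `J`, so that endpoints are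
allowed (`exists_hasDerivWithinAt_setIntegral_le`). -/

open Set
open scoped Manifold ContDiff

set_option maxSynthPendingDepth 4
set_option linter.unusedSectionVars false

/-! ### Calculus of fields of bilinear forms -/

section BilinearCalculus

open Filter Topology

variable {E E' : Type*} [NormedAddCommGroup E] [NormedSpace ℝ E]
  [NormedAddCommGroup E'] [NormedSpace ℝ E']

/-- The Christoffel symbol with lowered index of a field of bilinear forms. -/
noncomputable def lowChristoffel (b : E → E →L[ℝ] E →L[ℝ] ℝ) (y w u v : E) : ℝ :=
  (1 / 2) * (fderiv ℝ b y u v w + fderiv ℝ b y v u w - fderiv ℝ b y w u v)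

/-- The derivative in the direction `x` of the lowered Christoffel symbol. -/
noncomputable def lowChristoffelDeriv (b : E → E →L[ℝ] E →L[ℝ] ℝ) (y x w u v : E) : ℝ :=
  (1 / 2) * (fderiv ℝ (fderiv ℝ b) y x u v w + fderiv ℝ (fderiv ℝ b) y x v u w
    - fderiv ℝ (fderiv ℝ b) y x w u v)

/-- The pullback of a field of bilinear forms. -/
noncomputable def pullbackForm (b : E' → E' →L[ℝ] E' →L[ℝ] ℝ) (F : E → E') (z : E) :
    E →L[ℝ] E →L[ℝ] ℝ :=
  (b (F z)).bilinearComp (fderiv ℝ F z) (fderiv ℝ F z)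

@[simp] theorem pullbackForm_apply (b : E' → E' →L[ℝ] E' →L[ℝ] ℝ) (F : E → E') (z u v : E) :
    pullbackForm b F z u v = b (F z) (fderiv ℝ F z u) (fderiv ℝ F z v) := rfl

theorem hasFDerivAt_fderiv_apply₃ {b : E → E →L[ℝ] E →L[ℝ] ℝ} {y : E} (hb : ContDiffAt ℝ 2 b y)
    (u v w : E) :
    HasFDerivAt (fun z => fderiv ℝ b z u v w)
      ((((fderiv ℝ (fderiv ℝ b) y).flip u).flip v).flip w) y := by
  have h1 : HasFDerivAt (fderiv ℝ b) (fderiv ℝ (fderiv ℝ b) y) y :=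
    ((hb.fderiv_right (m := 1) (by norm_num)).differentiableAt (by norm_num)).hasFDerivAt
  have h2 := ((h1.clm_apply (hasFDerivAt_const u y)).clm_apply (hasFDerivAt_const v y)).clm_apply
    (hasFDerivAt_const w y)
  refine h2.congr_fderiv ?_
  ext x
  simp

theorem fderiv_lowChristoffel {b : E → E →L[ℝ] E →L[ℝ] ℝ} {y : E} (hb : ContDiffAt ℝ 2 b y)
    (x w u v : E) :
    fderiv ℝ (fun z => lowChristoffel b z w u v) y x = lowChristoffelDeriv b y x w u v := by
  have h := (((hasFDerivAt_fderiv_apply₃ hb u v w).add (hasFDerivAt_fderiv_apply₃ hb v u w)).sub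
    (hasFDerivAt_fderiv_apply₃ hb w u v)).const_mul (1 / 2 : ℝ)
  have h' : fderiv ℝ (fun z => lowChristoffel b z w u v) y = _ := h.fderiv
  rw [h']
  simp [lowChristoffelDeriv]

theorem ContDiffAt.fderiv_fderiv_comm {f : E → E'} {y : E} (hf : ContDiffAt ℝ 2 f y) (u v : E) :
    fderiv ℝ (fderiv ℝ f) y u v = fderiv ℝ (fderiv ℝ f) y v u :=
  (hf.isSymmSndFDerivAt (by simp)) u v

/-- Product rule for a form applied to two vector fields. -/
theorem hasFDerivAt_form_apply {b : E' → E' →L[ℝ] E' →L[ℝ] ℝ} {F A B : E → E'}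
    {F' A' B' : E →L[ℝ] E'} {y : E} (hb : DifferentiableAt ℝ b (F y)) (hF : HasFDerivAt F F' y)
    (hA : HasFDerivAt A A' y) (hB : HasFDerivAt B B' y) :
    HasFDerivAt (fun z => b (F z) (A z) (B z))
      (((((fderiv ℝ b (F y)).comp F').flip (A y)).flip (B y))
        + ((b (F y)).flip (B y)).comp A' + (b (F y) (A y)).comp B') y := by
  have h1 : HasFDerivAt (fun z => b (F z)) ((fderiv ℝ b (F y)).comp F') y :=
    hb.hasFDerivAt.comp y hF
  refine ((h1.clm_apply hA).clm_apply hB).congr_fderiv ?_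
  ext x
  simp
  ring

/-- Product rule for a trilinear form applied to three vector fields. -/
theorem hasFDerivAt_form_apply₃ {T : E' → E' →L[ℝ] E' →L[ℝ] E' →L[ℝ] ℝ} {F A B C : E → E'}
    {F' A' B' C' : E →L[ℝ] E'} {y : E} (hT : DifferentiableAt ℝ T (F y)) (hF : HasFDerivAt F F' y)
    (hA : HasFDerivAt A A' y) (hB : HasFDerivAt B B' y) (hC : HasFDerivAt C C' y) :
    HasFDerivAt (fun z => T (F z) (A z) (B z) (C z))
      ((((((fderiv ℝ T (F y)).comp F').flip (A y)).flip (B y)).flip (C y))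
        + (((T (F y)).flip (B y)).flip (C y)).comp A' + ((T (F y) (A y)).flip (C y)).comp B'
        + (T (F y) (A y) (B y)).comp C') y := by
  have h1 : HasFDerivAt (fun z => T (F z)) ((fderiv ℝ T (F y)).comp F') y :=
    hT.hasFDerivAt.comp y hF
  refine (((h1.clm_apply hA).clm_apply hB).clm_apply hC).congr_fderiv ?_
  ext x
  simp
  ring

theorem hasFDerivAt_fderiv_apply {F : E → E'} {y : E} (hF : ContDiffAt ℝ 2 F y) (u : E) :
    HasFDerivAt (fun z => fderiv ℝ F z u) ((fderiv ℝ (fderiv ℝ F) y).flip u) y := by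
  have h1 : HasFDerivAt (fderiv ℝ F) (fderiv ℝ (fderiv ℝ F) y) y :=
    ((hF.fderiv_right (m := 1) (by norm_num)).differentiableAt (by norm_num)).hasFDerivAt
  refine (h1.clm_apply (hasFDerivAt_const u y)).congr_fderiv ?_
  ext x
  simp

theorem ContDiffAt.pullbackForm {b : E' → E' →L[ℝ] E' →L[ℝ] ℝ} {F : E → E'} {y : E} {n m : ℕ∞ω}
    (hb : ContDiffAt ℝ n b (F y)) (hF : ContDiffAt ℝ m F y) (hnm : n + 1 ≤ m) :
    ContDiffAt ℝ n (pullbackForm b F) y := by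
  have h1 : ContDiffAt ℝ n (fun z => b (F z)) y :=
    hb.comp y (hF.of_le (le_trans le_self_add hnm))
  have h2 : ContDiffAt ℝ n (fderiv ℝ F) y := hF.fderiv_right hnm
  have h3 : ContDiffAt ℝ n (fun z => (b (F z)).comp (fderiv ℝ F z)) y := h1.clm_comp h2
  have h4 : ContDiffAt ℝ n (fun z => ((b (F z)).comp (fderiv ℝ F z)).flip) y :=
    (ContinuousLinearMap.flipₗᵢ ℝ E E' ℝ).contDiff.contDiffAt.comp y h3
  have h5 := h4.clm_comp h2
  have h6 : ContDiffAt ℝ n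
      (fun z => ((((b (F z)).comp (fderiv ℝ F z)).flip).comp (fderiv ℝ F z)).flip) y :=
    (ContinuousLinearMap.flipₗᵢ ℝ E E ℝ).contDiff.contDiffAt.comp y h5
  exact h6

theorem fderiv_pullbackForm {b : E' → E' →L[ℝ] E' →L[ℝ] ℝ} {F : E → E'} {y : E}
    (hb : ContDiffAt ℝ 1 b (F y)) (hF : ContDiffAt ℝ 2 F y) (x u v : E) :
    fderiv ℝ (pullbackForm b F) y x u v =
      fderiv ℝ b (F y) (fderiv ℝ F y x) (fderiv ℝ F y u) (fderiv ℝ F y v)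
      + b (F y) (fderiv ℝ (fderiv ℝ F) y x u) (fderiv ℝ F y v)
      + b (F y) (fderiv ℝ F y u) (fderiv ℝ (fderiv ℝ F) y x v) := by
  have h0 : HasFDerivAt (pullbackForm b F) (fderiv ℝ (pullbackForm b F) y) y :=
    ((hb.pullbackForm hF (by norm_num)).differentiableAt (by norm_num)).hasFDerivAt
  have h1 := (h0.clm_apply (hasFDerivAt_const u y)).clm_apply (hasFDerivAt_const v y)
  have h2 := hasFDerivAt_form_apply (hb.differentiableAt (by norm_num))
    (hF.differentiableAt (by norm_num)).hasFDerivAt (hasFDerivAt_fderiv_apply hF u)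
    (hasFDerivAt_fderiv_apply hF v)
  have h3 := congrArg (fun L => L x) (h1.unique h2)
  simpa using h3

/-- The inhomogeneous transformation law of Christoffel symbols. Of the six terms containing D²F,
four cancel in pairs by the symmetry of `b` and of D²F, and the two equal ones absorb the factor ½.
Source and target may have different dimensions, so the law covers embeddings as well as chart
changes. -/
theorem lowChristoffel_pullbackForm {b : E' → E' →L[ℝ] E' →L[ℝ] ℝ} {F : E → E'} {y : E}
    (hb : ContDiffAt ℝ 1 b (F y)) (hF : ContDiffAt ℝ 2 F y)
    (hs : ∀ u v, b (F y) u v = b (F y) v u) (w u v : E) :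
    lowChristoffel (pullbackForm b F) y w u v =
      b (F y) (fderiv ℝ F y w) (fderiv ℝ (fderiv ℝ F) y u v)
      + lowChristoffel b (F y) (fderiv ℝ F y w) (fderiv ℝ F y u) (fderiv ℝ F y v) := by
  simp only [lowChristoffel, fderiv_pullbackForm hb hF]
  rw [hF.fderiv_fderiv_comm v u, hF.fderiv_fderiv_comm w u, hF.fderiv_fderiv_comm w v,
    hs (fderiv ℝ (fderiv ℝ F) y u v) (fderiv ℝ F y w),
    hs (fderiv ℝ F y v) (fderiv ℝ (fderiv ℝ F) y u w)]
  ring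

theorem fderiv_symm_of_eventually {b : E → E →L[ℝ] E →L[ℝ] ℝ} {y : E}
    (hb : DifferentiableAt ℝ b y) (hs : ∀ᶠ z in 𝓝 y, ∀ u v, b z u v = b z v u) (x u v : E) :
    fderiv ℝ b y x u v = fderiv ℝ b y x v u := by
  have h1 (u v : E) :=
    (hb.hasFDerivAt.clm_apply (hasFDerivAt_const u y)).clm_apply (hasFDerivAt_const v y)
  have h2 := (h1 u v).congr_of_eventuallyEq
    (f₁ := fun z => b z v u) (hs.mono fun z hz => hz v u)
  have h3 := congrArg (fun L => L x) ((h1 v u).unique h2)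
  simpa using h3.symm

theorem lowChristoffel_symm {b : E → E →L[ℝ] E →L[ℝ] ℝ} {y : E}
    (hb : DifferentiableAt ℝ b y) (hs : ∀ᶠ z in 𝓝 y, ∀ u v, b z u v = b z v u) (w u v : E) :
    lowChristoffel b y w u v = lowChristoffel b y w v u := by
  simp only [lowChristoffel]
  rw [fderiv_symm_of_eventually hb hs w u v]
  ring

/-- Metric compatibility. -/
theorem lowChristoffel_add {b : E → E →L[ℝ] E →L[ℝ] ℝ} {y : E}
    (hb : DifferentiableAt ℝ b y) (hs : ∀ᶠ z in 𝓝 y, ∀ u v, b z u v = b z v u) (x u v : E) :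
    lowChristoffel b y u x v + lowChristoffel b y v x u = fderiv ℝ b y x u v := by
  simp only [lowChristoffel]
  rw [fderiv_symm_of_eventually hb hs x v u, fderiv_symm_of_eventually hb hs v x u,
    fderiv_symm_of_eventually hb hs u x v]
  ring

/-- The first-order transformation law holds in a neighbourhood of `y`, hence may be differentiated
by the product rule. The Christoffel symbol is first expanded into `fderiv ℝ b`, a field of
trilinear forms. -/
theorem lowChristoffelDeriv_pullbackForm {b : E' → E' →L[ℝ] E' →L[ℝ] ℝ} {F : E → E'} {y : E}
    (hb : ContDiffAt ℝ 2 b (F y)) (hF : ContDiffAt ℝ 3 F y)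
    (hs : ∀ᶠ z in 𝓝 (F y), ∀ u v, b z u v = b z v u) (x w u v : E) :
    lowChristoffelDeriv (pullbackForm b F) y x w u v =
      fderiv ℝ b (F y) (fderiv ℝ F y x) (fderiv ℝ F y w) (fderiv ℝ (fderiv ℝ F) y u v)
      + b (F y) (fderiv ℝ (fderiv ℝ F) y x w) (fderiv ℝ (fderiv ℝ F) y u v)
      + b (F y) (fderiv ℝ F y w) (fderiv ℝ (fderiv ℝ (fderiv ℝ F)) y x u v)
      + lowChristoffelDeriv b (F y) (fderiv ℝ F y x) (fderiv ℝ F y w) (fderiv ℝ F y u)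
          (fderiv ℝ F y v)
      + lowChristoffel b (F y) (fderiv ℝ (fderiv ℝ F) y x w) (fderiv ℝ F y u) (fderiv ℝ F y v)
      + lowChristoffel b (F y) (fderiv ℝ F y w) (fderiv ℝ (fderiv ℝ F) y x u) (fderiv ℝ F y v)
      + lowChristoffel b (F y) (fderiv ℝ F y w) (fderiv ℝ F y u) (fderiv ℝ (fderiv ℝ F) y x v) := by
  rw [← fderiv_lowChristoffel (hb.pullbackForm hF (by norm_num))]
  have hF2 : ContDiffAt ℝ 2 F y := hF.of_le (by norm_num)
  have hc : ContinuousAt F y := hF.continuousAt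
  have hev : (fun z => lowChristoffel (pullbackForm b F) z w u v) =ᶠ[𝓝 y] fun z =>
      b (F z) (fderiv ℝ F z w) (fderiv ℝ (fderiv ℝ F) z u v)
      + (1 / 2) * (fderiv ℝ b (F z) (fderiv ℝ F z u) (fderiv ℝ F z v) (fderiv ℝ F z w)
        + fderiv ℝ b (F z) (fderiv ℝ F z v) (fderiv ℝ F z u) (fderiv ℝ F z w)
        - fderiv ℝ b (F z) (fderiv ℝ F z w) (fderiv ℝ F z u) (fderiv ℝ F z v)) := by
    filter_upwards [hc.eventually (hb.eventually (by simp)), hF.eventually (by simp),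
      hc.eventually hs] with z h1 h2 h3
    exact lowChristoffel_pullbackForm (h1.of_le (by norm_num)) (h2.of_le (by norm_num)) h3 w u v
  rw [hev.fderiv_eq]
  have dF := (hF.differentiableAt (by norm_num)).hasFDerivAt
  have dT : DifferentiableAt ℝ (fderiv ℝ b) (F y) :=
    (hb.fderiv_right (m := 1) (by norm_num)).differentiableAt (by norm_num)
  have d2 : ContDiffAt ℝ 2 (fderiv ℝ F) y := hF.fderiv_right (by norm_num)
  have dD2 : HasFDerivAt (fun z => fderiv ℝ (fderiv ℝ F) z u v)
      (((fderiv ℝ (fderiv ℝ (fderiv ℝ F)) y).flip u).flip v) y := by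
    refine ((hasFDerivAt_fderiv_apply d2 u).clm_apply (hasFDerivAt_const v y)).congr_fderiv ?_
    ext x
    simp
  have k1 := hasFDerivAt_form_apply (hb.differentiableAt (by norm_num)) dF
    (hasFDerivAt_fderiv_apply hF2 w) dD2
  have k2 (u v w : E) := hasFDerivAt_form_apply₃ dT dF (hasFDerivAt_fderiv_apply hF2 u)
    (hasFDerivAt_fderiv_apply hF2 v) (hasFDerivAt_fderiv_apply hF2 w)
  have h := k1.add ((((k2 u v w).add (k2 v u w)).sub (k2 w u v)).const_mul (1 / 2 : ℝ))
  have h' := congrArg (fun L => L x) h.fderiv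
  refine Eq.trans h' ?_
  simp only [lowChristoffel, lowChristoffelDeriv, _root_.add_apply,
    _root_.sub_apply, _root_.smul_apply, ContinuousLinearMap.flip_apply,
    ContinuousLinearMap.comp_apply, smul_eq_mul]
  ring

/-- The Gauss equation before raising indices. -/
theorem lowChristoffelDeriv_sub_pullbackForm {b : E' → E' →L[ℝ] E' →L[ℝ] ℝ} {F : E → E'} {y : E}
    (hb : ContDiffAt ℝ 2 b (F y)) (hF : ContDiffAt ℝ 3 F y)
    (hs : ∀ᶠ z in 𝓝 (F y), ∀ u v, b z u v = b z v u) (l k i j : E) :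
    lowChristoffelDeriv (pullbackForm b F) y i l j k
        - lowChristoffelDeriv (pullbackForm b F) y j l i k =
      lowChristoffelDeriv b (F y) (fderiv ℝ F y i) (fderiv ℝ F y l) (fderiv ℝ F y j) (fderiv ℝ F y k)
      - lowChristoffelDeriv b (F y) (fderiv ℝ F y j) (fderiv ℝ F y l) (fderiv ℝ F y i)
          (fderiv ℝ F y k)
      + (b (F y) (fderiv ℝ (fderiv ℝ F) y i l) (fderiv ℝ (fderiv ℝ F) y j k)
        + lowChristoffel b (F y) (fderiv ℝ (fderiv ℝ F) y i l) (fderiv ℝ F y j) (fderiv ℝ F y k)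
        + lowChristoffel b (F y) (fderiv ℝ (fderiv ℝ F) y j k) (fderiv ℝ F y i) (fderiv ℝ F y l))
      - (b (F y) (fderiv ℝ (fderiv ℝ F) y j l) (fderiv ℝ (fderiv ℝ F) y i k)
        + lowChristoffel b (F y) (fderiv ℝ (fderiv ℝ F) y j l) (fderiv ℝ F y i) (fderiv ℝ F y k)
        + lowChristoffel b (F y) (fderiv ℝ (fderiv ℝ F) y i k) (fderiv ℝ F y j)
            (fderiv ℝ F y l)) := by
  rw [lowChristoffelDeriv_pullbackForm hb hF hs, lowChristoffelDeriv_pullbackForm hb hF hs]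
  have db : DifferentiableAt ℝ b (F y) := hb.differentiableAt (by norm_num)
  have d2 : ContDiffAt ℝ 2 (fderiv ℝ F) y := hF.fderiv_right (by norm_num)
  -- Antisymmetrizing in i, j removes the third derivatives of `F` and the terms with D²F(i, j).
  -- Metric compatibility splits each remaining derivative of `b` into two Christoffel symbols, one
  -- of which cancels.
  have m1 := lowChristoffel_add db hs (fderiv ℝ F y i) (fderiv ℝ F y l)
    (fderiv ℝ (fderiv ℝ F) y j k)
  have m2 := lowChristoffel_add db hs (fderiv ℝ F y j) (fderiv ℝ F y l)
    (fderiv ℝ (fderiv ℝ F) y i k)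
  rw [d2.fderiv_fderiv_comm j i, (hF.of_le (by norm_num)).fderiv_fderiv_comm j i]
  linear_combination m2 - m1

end BilinearCalculus

/-! ### Contractions -/

section Contraction

variable {n m : ℕ}

/-- The matrix of a bilinear form in the standard basis. -/
noncomputable def formMatrix (B : EuclideanSpace ℝ (Fin n) →L[ℝ] EuclideanSpace ℝ (Fin n) →L[ℝ] ℝ) :
    Matrix (Fin n) (Fin n) ℝ :=
  Matrix.of fun i j => B (EuclideanSpace.single i 1) (EuclideanSpace.single j 1)

@[simp] theorem formMatrix_apply
    (B : EuclideanSpace ℝ (Fin n) →L[ℝ] EuclideanSpace ℝ (Fin n) →L[ℝ] ℝ) (i j : Fin n) :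
    formMatrix B i j = B (EuclideanSpace.single i 1) (EuclideanSpace.single j 1) := rfl

/-- The contraction `∑ A^{ij} Q(e_i, e_j)`. -/
noncomputable def coTrace (A : Matrix (Fin n) (Fin n) ℝ)
    (Q : EuclideanSpace ℝ (Fin n) → EuclideanSpace ℝ (Fin n) → ℝ) : ℝ :=
  ∑ i, ∑ j, A i j * Q (EuclideanSpace.single i 1) (EuclideanSpace.single j 1)

theorem euclidean_sum_single (v : EuclideanSpace ℝ (Fin n)) :
    ∑ i, v i • EuclideanSpace.single i (1 : ℝ) = v := by
  ext j
  simp [Finset.sum_apply, Pi.single_apply]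

theorem coTrace_add (A : Matrix (Fin n) (Fin n) ℝ)
    (Q Q' : EuclideanSpace ℝ (Fin n) → EuclideanSpace ℝ (Fin n) → ℝ) :
    coTrace A (fun u v => Q u v + Q' u v) = coTrace A Q + coTrace A Q' := by
  simp only [coTrace, mul_add, Finset.sum_add_distrib]

theorem coTrace_sub (A : Matrix (Fin n) (Fin n) ℝ)
    (Q Q' : EuclideanSpace ℝ (Fin n) → EuclideanSpace ℝ (Fin n) → ℝ) :
    coTrace A (fun u v => Q u v - Q' u v) = coTrace A Q - coTrace A Q' := by
  simp only [coTrace, mul_sub, Finset.sum_sub_distrib]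

theorem coTrace_const_mul (A : Matrix (Fin n) (Fin n) ℝ) (c : ℝ)
    (Q : EuclideanSpace ℝ (Fin n) → EuclideanSpace ℝ (Fin n) → ℝ) :
    coTrace A (fun u v => c * Q u v) = c * coTrace A Q := by
  simp only [coTrace, Finset.mul_sum]
  exact Finset.sum_congr rfl fun i _ => Finset.sum_congr rfl fun j _ => by ring

theorem coTrace_mul_const (A : Matrix (Fin n) (Fin n) ℝ) (c : ℝ)
    (Q : EuclideanSpace ℝ (Fin n) → EuclideanSpace ℝ (Fin n) → ℝ) :
    coTrace A (fun u v => Q u v * c) = coTrace A Q * c := by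
  simp only [mul_comm _ c, coTrace_const_mul]

theorem coTrace_swap {A : Matrix (Fin n) (Fin n) ℝ} (hA : ∀ i j, A i j = A j i)
    (Q : EuclideanSpace ℝ (Fin n) → EuclideanSpace ℝ (Fin n) → ℝ) :
    coTrace A (fun u v => Q v u) = coTrace A Q := by
  simp only [coTrace]
  rw [Finset.sum_comm]
  exact Finset.sum_congr rfl fun i _ => Finset.sum_congr rfl fun j _ => by rw [hA]

theorem bilinear_eq_sum {Q : EuclideanSpace ℝ (Fin m) → EuclideanSpace ℝ (Fin m) → ℝ}
    (h₁ : ∀ v, IsLinearMap ℝ fun u => Q u v) (h₂ : ∀ u, IsLinearMap ℝ (Q u))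
    (u v : EuclideanSpace ℝ (Fin m)) :
    Q u v = ∑ a, ∑ b, u a * v b * Q (EuclideanSpace.single a 1) (EuclideanSpace.single b 1) := by
  have e1 : Q u v = ∑ a, u a * Q (EuclideanSpace.single a 1) v := by
    conv_lhs => rw [← euclidean_sum_single u]
    have := map_sum (h₁ v).mk' (fun a => u a • EuclideanSpace.single a (1 : ℝ)) Finset.univ
    simp only [IsLinearMap.mk'_apply] at this
    rw [this]
    exact Finset.sum_congr rfl fun a _ => (h₁ v).map_smul _ _
  have e2 (w) : Q w v = ∑ b, v b * Q w (EuclideanSpace.single b 1) := by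
    conv_lhs => rw [← euclidean_sum_single v]
    have := map_sum (h₂ w).mk' (fun a => v a • EuclideanSpace.single a (1 : ℝ)) Finset.univ
    simp only [IsLinearMap.mk'_apply] at this
    rw [this]
    exact Finset.sum_congr rfl fun a _ => (h₂ w).map_smul _ _
  rw [e1]
  refine Finset.sum_congr rfl fun a _ => ?_
  rw [e2, Finset.mul_sum]
  exact Finset.sum_congr rfl fun b _ => by ring

theorem isLinearMap_form_left
    (B : EuclideanSpace ℝ (Fin m) →L[ℝ] EuclideanSpace ℝ (Fin m) →L[ℝ] ℝ)
    (v : EuclideanSpace ℝ (Fin m)) : IsLinearMap ℝ fun u => B u v :=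
  ⟨by simp, by simp⟩

theorem isLinearMap_form_right
    (B : EuclideanSpace ℝ (Fin m) →L[ℝ] EuclideanSpace ℝ (Fin m) →L[ℝ] ℝ)
    (u : EuclideanSpace ℝ (Fin m)) : IsLinearMap ℝ fun v => B u v :=
  ⟨by simp, by simp⟩

theorem form_apply_eq_sum
    (B : EuclideanSpace ℝ (Fin m) →L[ℝ] EuclideanSpace ℝ (Fin m) →L[ℝ] ℝ)
    (u v : EuclideanSpace ℝ (Fin m)) :
    B u v = ∑ a, ∑ b, u a * v b * formMatrix B a b :=
  bilinear_eq_sum (isLinearMap_form_left B) (isLinearMap_form_right B) u v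

/-- The inverse metric in terms of a frame `f` with Gram matrix inverse to `D`. -/
theorem coTrace_inv_eq_frame_sum {ι : Type*} [Fintype ι] [DecidableEq ι]
    (hι : Fintype.card ι = m)
    (B : EuclideanSpace ℝ (Fin m) →L[ℝ] EuclideanSpace ℝ (Fin m) →L[ℝ] ℝ)
    (f : ι → EuclideanSpace ℝ (Fin m)) (D : Matrix ι ι ℝ)
    (hD : D * Matrix.of (fun i j => B (f i) (f j)) = 1)
    {Q : EuclideanSpace ℝ (Fin m) → EuclideanSpace ℝ (Fin m) → ℝ}
    (h₁ : ∀ v, IsLinearMap ℝ fun u => Q u v) (h₂ : ∀ u, IsLinearMap ℝ (Q u)) :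
    coTrace (formMatrix B)⁻¹ Q = ∑ i, ∑ j, D i j * Q (f i) (f j) := by
  set P : Matrix (Fin m) ι ℝ := Matrix.of fun a i => f i a with hP
  have hG : Matrix.of (fun i j => B (f i) (f j)) = P.transpose * formMatrix B * P := by
    ext i j
    rw [Matrix.of_apply, form_apply_eq_sum, Matrix.mul_apply]
    simp only [Matrix.mul_apply, Finset.sum_mul, hP, Matrix.transpose_apply, Matrix.of_apply]
    rw [Finset.sum_comm]
    exact Finset.sum_congr rfl fun b _ => Finset.sum_congr rfl fun a _ => by ring
  have h1 : (D * P.transpose * formMatrix B) * P = 1 := by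
    rw [← hD, hG]; simp only [Matrix.mul_assoc]
  -- The cardinality of the frame enters here: `P` is square, so its left inverse is a right
  -- inverse, and the product can be regrouped to exhibit `P * D * P.transpose` as the inverse of
  -- the form.
  have h2 : P * (D * P.transpose * formMatrix B) = 1 :=
    (Matrix.mul_eq_one_comm_of_card_eq _ _ _ (by simpa using hι)).1 h1
  have h3 : (formMatrix B)⁻¹ = P * D * P.transpose := by
    apply Matrix.inv_eq_left_inv
    simpa only [Matrix.mul_assoc] using h2
  rw [h3, coTrace]
  have hQ (i j : ι) := bilinear_eq_sum h₁ h₂ (f i) (f j)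
  simp only [hQ, Matrix.mul_apply, Finset.sum_mul, Finset.mul_sum, Matrix.transpose_apply, hP,
    Matrix.of_apply]
  calc _ = ∑ a, ∑ b, ∑ i, ∑ j, D i j * (f i a * f j b *
        Q (EuclideanSpace.single a 1) (EuclideanSpace.single b 1)) := by
        refine Finset.sum_congr rfl fun a _ => Finset.sum_congr rfl fun b _ => ?_
        rw [Finset.sum_comm]
        exact Finset.sum_congr rfl fun i _ => Finset.sum_congr rfl fun j _ => by ring
    _ = ∑ a, ∑ i, ∑ b, ∑ j, D i j * (f i a * f j b *
        Q (EuclideanSpace.single a 1) (EuclideanSpace.single b 1)) :=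
        Finset.sum_congr rfl fun a _ => Finset.sum_comm
    _ = ∑ i, ∑ a, ∑ j, ∑ b, D i j * (f i a * f j b *
        Q (EuclideanSpace.single a 1) (EuclideanSpace.single b 1)) := by
        rw [Finset.sum_comm]
        exact Finset.sum_congr rfl fun i _ => Finset.sum_congr rfl fun a _ => Finset.sum_comm
    _ = _ := Finset.sum_congr rfl fun i _ => Finset.sum_comm

/-- A bilinear form is an inner product. -/
structure IsInner (B : EuclideanSpace ℝ (Fin m) →L[ℝ] EuclideanSpace ℝ (Fin m) →L[ℝ] ℝ) :
    Prop where
  symm : ∀ u v, B u v = B v u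
  pos : ∀ u, u ≠ 0 → 0 < B u u

theorem IsInner.posDef {B : EuclideanSpace ℝ (Fin m) →L[ℝ] EuclideanSpace ℝ (Fin m) →L[ℝ] ℝ}
    (hB : IsInner B) : (formMatrix B).PosDef := by
  refine Matrix.PosDef.of_dotProduct_mulVec_pos ?_ fun x hx => ?_
  · exact Matrix.IsHermitian.ext fun i j => by
      simp only [formMatrix_apply, star_trivial]
      exact hB.symm _ _
  · have h := hB.pos (WithLp.toLp 2 x) (by simpa using hx)
    rw [form_apply_eq_sum] at h
    refine lt_of_lt_of_eq h ?_
    simp only [dotProduct, Matrix.mulVec, Finset.mul_sum, star_trivial]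
    exact Finset.sum_congr rfl fun i _ => Finset.sum_congr rfl fun j _ => by ring

theorem IsInner.isUnit_det {B : EuclideanSpace ℝ (Fin m) →L[ℝ] EuclideanSpace ℝ (Fin m) →L[ℝ] ℝ}
    (hB : IsInner B) : IsUnit (formMatrix B).det :=
  hB.posDef.det_pos.ne'.isUnit

theorem IsInner.inv_symm {B : EuclideanSpace ℝ (Fin m) →L[ℝ] EuclideanSpace ℝ (Fin m) →L[ℝ] ℝ}
    (hB : IsInner B) (i j : Fin m) : (formMatrix B)⁻¹ i j = (formMatrix B)⁻¹ j i := by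
  have := hB.posDef.inv.isHermitian.apply i j
  simpa using this.symm

/-- Lowering and raising an index. -/
theorem IsInner.coTrace_form_mul
    {B : EuclideanSpace ℝ (Fin m) →L[ℝ] EuclideanSpace ℝ (Fin m) →L[ℝ] ℝ}
    (hB : IsInner B) (v : EuclideanSpace ℝ (Fin m)) {q : EuclideanSpace ℝ (Fin m) → ℝ}
    (hq : IsLinearMap ℝ q) :
    coTrace (formMatrix B)⁻¹ (fun a b => B a v * q b) = q v := by
  have h1 (a : Fin m) : B (EuclideanSpace.single a 1) v = ∑ c, formMatrix B c a * v c := by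
    conv_lhs => rw [← euclidean_sum_single v]
    rw [map_sum]
    exact Finset.sum_congr rfl fun c _ => by
      rw [map_smul, smul_eq_mul, mul_comm, formMatrix_apply, hB.symm]
  have h2 : q v = ∑ b, v b * q (EuclideanSpace.single b 1) := by
    conv_lhs => rw [← euclidean_sum_single v]
    have := map_sum hq.mk' (fun a => v a • EuclideanSpace.single a (1 : ℝ)) Finset.univ
    simp only [IsLinearMap.mk'_apply] at this
    rw [this]
    exact Finset.sum_congr rfl fun a _ => hq.map_smul _ _
  have h3 : formMatrix B * (formMatrix B)⁻¹ = 1 := Matrix.mul_nonsing_inv _ hB.isUnit_det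
  rw [h2, coTrace, Finset.sum_comm]
  refine Finset.sum_congr rfl fun b _ => ?_
  simp only [h1, Finset.sum_mul, Finset.mul_sum]
  rw [Finset.sum_comm]
  calc _ = ∑ c, (formMatrix B * (formMatrix B)⁻¹) c b * (v c * q (EuclideanSpace.single b 1)) := by
        refine Finset.sum_congr rfl fun c _ => ?_
        rw [Matrix.mul_apply, Finset.sum_mul]
        exact Finset.sum_congr rfl fun a _ => by ring
    _ = _ := by simp [h3, Matrix.one_apply]

end Contraction

/-! ### Curvature of a field of inner products -/

section Curvature

open Filter Topology

variable {n m : ℕ}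

theorem lowChristoffel_isLinearMap {E : Type*} [NormedAddCommGroup E] [NormedSpace ℝ E]
    (b : E → E →L[ℝ] E →L[ℝ] ℝ) (y u v : E) :
    IsLinearMap ℝ fun w => lowChristoffel b y w u v :=
  ⟨fun _ _ => by simp [lowChristoffel]; ring, fun _ _ => by simp [lowChristoffel]; ring⟩

/-- A field of bilinear forms which near `y` is a smooth metric. -/
structure IsMetricAt (b : EuclideanSpace ℝ (Fin m) →
      EuclideanSpace ℝ (Fin m) →L[ℝ] EuclideanSpace ℝ (Fin m) →L[ℝ] ℝ)
    (y : EuclideanSpace ℝ (Fin m)) : Prop where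
  smooth : ContDiffAt ℝ ∞ b y
  inner : ∀ᶠ z in 𝓝 y, IsInner (b z)

variable {b : EuclideanSpace ℝ (Fin m) →
      EuclideanSpace ℝ (Fin m) →L[ℝ] EuclideanSpace ℝ (Fin m) →L[ℝ] ℝ}
    {y : EuclideanSpace ℝ (Fin m)}

theorem IsMetricAt.contDiffAt (hb : IsMetricAt b y) (k : ℕ) : ContDiffAt ℝ k b y :=
  hb.smooth.of_le (by exact_mod_cast le_top)

theorem IsMetricAt.differentiableAt (hb : IsMetricAt b y) : DifferentiableAt ℝ b y :=
  hb.smooth.differentiableAt (by simp)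

theorem IsMetricAt.symm (hb : IsMetricAt b y) : ∀ᶠ z in 𝓝 y, ∀ u v, b z u v = b z v u :=
  hb.inner.mono fun _ h => h.symm

theorem IsMetricAt.isInner (hb : IsMetricAt b y) : IsInner (b y) := hb.inner.self_of_nhds

/-- The Riemann tensor with lowered indices, applied to vectors. -/
noncomputable def riemannForm (b : EuclideanSpace ℝ (Fin m) →
      EuclideanSpace ℝ (Fin m) →L[ℝ] EuclideanSpace ℝ (Fin m) →L[ℝ] ℝ)
    (y l k i j : EuclideanSpace ℝ (Fin m)) : ℝ :=
  lowChristoffelDeriv b y i l j k - lowChristoffelDeriv b y j l i k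
    - (coTrace (formMatrix (b y))⁻¹
        (fun p q => lowChristoffel b y p i l * lowChristoffel b y q j k)
      - coTrace (formMatrix (b y))⁻¹
        (fun p q => lowChristoffel b y p j l * lowChristoffel b y q i k))

theorem partialDeriv_formMatrix (hb : DifferentiableAt ℝ b y) (i j k : Fin m) :
    partialDeriv i (fun z => formMatrix (b z) j k) y =
      fderiv ℝ b y (EuclideanSpace.single i 1) (EuclideanSpace.single j 1)
        (EuclideanSpace.single k 1) := by
  have h := (hb.hasFDerivAt.clm_apply (hasFDerivAt_const (EuclideanSpace.single j (1 : ℝ)) y)).clm_apply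
    (hasFDerivAt_const (EuclideanSpace.single k (1 : ℝ)) y)
  simp only [partialDeriv, formMatrix_apply]
  rw [h.fderiv]
  simp

theorem christoffel_formMatrix (hb : DifferentiableAt ℝ b y) (k i j : Fin m) :
    christoffel (fun z => formMatrix (b z)) k i j y =
      ∑ l, (formMatrix (b y))⁻¹ k l * lowChristoffel b y (EuclideanSpace.single l 1)
        (EuclideanSpace.single i 1) (EuclideanSpace.single j 1) := by
  simp only [christoffel, partialDeriv_formMatrix hb, lowChristoffel, Finset.mul_sum]
  exact Finset.sum_congr rfl fun l _ => by ring

theorem IsInner.sum_formMatrix_mul_inv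
    {B : EuclideanSpace ℝ (Fin m) →L[ℝ] EuclideanSpace ℝ (Fin m) →L[ℝ] ℝ}
    (hB : IsInner B) (l : Fin m) (c : Fin m → ℝ) :
    ∑ k, formMatrix B l k * ∑ p, (formMatrix B)⁻¹ k p * c p = c l := by
  have h3 : formMatrix B * (formMatrix B)⁻¹ = 1 := Matrix.mul_nonsing_inv _ hB.isUnit_det
  have h := congrFun (congrArg (fun A => Matrix.mulVec A c) h3) l
  rw [← Matrix.mulVec_mulVec] at h
  simpa [Matrix.mulVec, dotProduct, Matrix.one_apply] using h

theorem sum_formMatrix_mul_christoffel (hb : DifferentiableAt ℝ b y) (hB : IsInner (b y))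
    (l i j : Fin m) :
    ∑ k, formMatrix (b y) l k * christoffel (fun z => formMatrix (b z)) k i j y =
      lowChristoffel b y (EuclideanSpace.single l 1) (EuclideanSpace.single i 1)
        (EuclideanSpace.single j 1) := by
  simp only [christoffel_formMatrix hb]
  exact hB.sum_formMatrix_mul_inv l _

theorem ContDiffAt.formMatrix_apply {k : ℕ∞ω} (hb : ContDiffAt ℝ k b y) (i j : Fin m) :
    ContDiffAt ℝ k (fun z => formMatrix (b z) i j) y :=
  (hb.clm_apply contDiffAt_const).clm_apply contDiffAt_const

theorem contDiffAt_matrix_det {E ι : Type*} [NormedAddCommGroup E] [NormedSpace ℝ E] [Fintype ι]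
    [DecidableEq ι] {k : ℕ∞ω} {G : E → Matrix ι ι ℝ} {s : Set E} {y : E}
    (hG : ∀ i j, ContDiffWithinAt ℝ k (fun z => G z i j) s y) :
    ContDiffWithinAt ℝ k (fun z => (G z).det) s y := by
  simp only [Matrix.det_apply]
  exact ContDiffWithinAt.sum fun σ _ => ContDiffWithinAt.const_smul _
    (contDiffWithinAt_prod fun i _ => hG _ _)

theorem contDiffAt_matrix_inv {E ι : Type*} [NormedAddCommGroup E] [NormedSpace ℝ E] [Fintype ι]
    [DecidableEq ι] {k : ℕ∞ω} {G : E → Matrix ι ι ℝ} {y : E}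
    (hG : ∀ i j, ContDiffAt ℝ k (fun z => G z i j) y) (hd : (G y).det ≠ 0) (i j : ι) :
    ContDiffAt ℝ k (fun z => (G z)⁻¹ i j) y := by
  simp only [Matrix.inv_def, Matrix.smul_apply, smul_eq_mul, Ring.inverse_eq_inv']
  have hdet : ContDiffAt ℝ k (fun z => (G z).det) y :=
    contDiffAt_matrix_det fun i j => hG i j
  refine (hdet.inv hd).mul ?_
  simp only [Matrix.adjugate_apply]
  refine contDiffAt_matrix_det (s := univ) fun p q => ?_
  simp only [Matrix.updateRow_apply]
  split_ifs
  · exact contDiffWithinAt_const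
  · exact hG p q

theorem IsMetricAt.contDiffAt_inv (hb : IsMetricAt b y) (i j : Fin m) :
    ContDiffAt ℝ ∞ (fun z => (formMatrix (b z))⁻¹ i j) y :=
  contDiffAt_matrix_inv (fun _ _ => hb.smooth.formMatrix_apply _ _) hb.isInner.isUnit_det.ne_zero i j

theorem ContDiffAt.partialDeriv {f : EuclideanSpace ℝ (Fin m) → ℝ} (hf : ContDiffAt ℝ ∞ f y)
    (i : Fin m) : ContDiffAt ℝ ∞ (partialDeriv i f) y :=
  (hf.fderiv_right (m := ∞) (by simp)).clm_apply contDiffAt_const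

theorem IsMetricAt.contDiffAt_christoffel (hb : IsMetricAt b y) (k i j : Fin m) :
    ContDiffAt ℝ ∞ (christoffel (fun z => formMatrix (b z)) k i j) y := by
  refine contDiffAt_const.mul (ContDiffAt.sum fun l _ => (hb.contDiffAt_inv k l).mul ?_)
  exact (((hb.smooth.formMatrix_apply _ _).partialDeriv _).add
    ((hb.smooth.formMatrix_apply _ _).partialDeriv _)).sub
    ((hb.smooth.formMatrix_apply _ _).partialDeriv _)

theorem IsMetricAt.contDiffAt_riemannUp (hb : IsMetricAt b y) (l k i j : Fin m) :
    ContDiffAt ℝ ∞ (riemannUp (fun z => formMatrix (b z)) l k i j) y := by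
  refine (((hb.contDiffAt_christoffel _ _ _).partialDeriv _).sub
    ((hb.contDiffAt_christoffel _ _ _).partialDeriv _)).add (ContDiffAt.sum fun p _ => ?_)
  exact ((hb.contDiffAt_christoffel _ _ _).mul (hb.contDiffAt_christoffel _ _ _)).sub
    ((hb.contDiffAt_christoffel _ _ _).mul (hb.contDiffAt_christoffel _ _ _))

theorem IsMetricAt.contDiffAt_coordScalarCurvature (hb : IsMetricAt b y) :
    ContDiffAt ℝ ∞ (coordScalarCurvature (fun z => formMatrix (b z))) y :=
  ContDiffAt.sum fun _ _ => ContDiffAt.sum fun _ _ => (hb.contDiffAt_inv _ _).mul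
    (ContDiffAt.sum fun _ _ => hb.contDiffAt_riemannUp _ _ _ _)

/-- Product rule for the identity G_{lp} Γ^p_{jk} = Γ_{ljk}, valid near `y`. Metric compatibility
turns ∂_i G_{lp} into two lowered symbols, which account for the two subtracted sums. -/
theorem IsMetricAt.sum_formMatrix_mul_partialDeriv_christoffel (hb : IsMetricAt b y)
    (l i j k : Fin m) :
    ∑ p, formMatrix (b y) l p * partialDeriv i (christoffel (fun z => formMatrix (b z)) p j k) y =
      lowChristoffelDeriv b y (EuclideanSpace.single i 1) (EuclideanSpace.single l 1)
        (EuclideanSpace.single j 1) (EuclideanSpace.single k 1)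
      - ∑ p, lowChristoffel b y (EuclideanSpace.single l 1) (EuclideanSpace.single i 1)
          (EuclideanSpace.single p 1) * christoffel (fun z => formMatrix (b z)) p j k y
      - coTrace (formMatrix (b y))⁻¹ (fun p q =>
          lowChristoffel b y p (EuclideanSpace.single i 1) (EuclideanSpace.single l 1) *
          lowChristoffel b y q (EuclideanSpace.single j 1) (EuclideanSpace.single k 1)) := by
  have hev : (fun z => ∑ p, formMatrix (b z) l p *
      christoffel (fun z => formMatrix (b z)) p j k z) =ᶠ[𝓝 y] fun z =>
        lowChristoffel b z (EuclideanSpace.single l 1) (EuclideanSpace.single j 1)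
          (EuclideanSpace.single k 1) := by
    filter_upwards [hb.inner, (hb.contDiffAt 1).eventually (by simp)] with z h1 h2
    exact sum_formMatrix_mul_christoffel (h2.differentiableAt (by simp)) h1 l j k
  have h1 := DFunLike.congr_fun (hev.fderiv_eq (𝕜 := ℝ)) (EuclideanSpace.single i (1 : ℝ))
  simp only [fderiv_lowChristoffel (hb.contDiffAt 2)] at h1
  have h2 : HasFDerivAt (fun z => ∑ p, formMatrix (b z) l p *
      christoffel (fun z => formMatrix (b z)) p j k z) _ y :=
    HasFDerivAt.fun_sum fun p _ =>
      (((hb.smooth.formMatrix_apply l p).differentiableAt (by simp)).hasFDerivAt.mul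
        ((hb.contDiffAt_christoffel p j k).differentiableAt (by simp)).hasFDerivAt)
  rw [h2.fderiv] at h1
  rw [← h1]
  have h3 (p : Fin m) := partialDeriv_formMatrix hb.differentiableAt i l p
  simp only [partialDeriv] at h3
  simp only [_root_.sum_apply, _root_.add_apply, _root_.smul_apply, smul_eq_mul, h3,
    ← lowChristoffel_add hb.differentiableAt hb.symm, coTrace,
    christoffel_formMatrix hb.differentiableAt, partialDeriv, ← Finset.sum_sub_distrib]
  refine Finset.sum_congr rfl fun p _ => ?_
  have h4 : ∑ x, (formMatrix (b y))⁻¹ p x *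
      (lowChristoffel b y (EuclideanSpace.single p 1) (EuclideanSpace.single i 1)
          (EuclideanSpace.single l 1) * lowChristoffel b y (EuclideanSpace.single x 1)
          (EuclideanSpace.single j 1) (EuclideanSpace.single k 1)) =
      lowChristoffel b y (EuclideanSpace.single p 1) (EuclideanSpace.single i 1)
          (EuclideanSpace.single l 1) * ∑ x, (formMatrix (b y))⁻¹ p x *
        lowChristoffel b y (EuclideanSpace.single x 1)
          (EuclideanSpace.single j 1) (EuclideanSpace.single k 1) := by
    rw [Finset.mul_sum]
    exact Finset.sum_congr rfl fun x _ => by ring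
  rw [h4]
  ring

/-- The ΓΓ terms of the definition cancel against half of those produced by lowering the index under
the derivative. The other half is the quadratic part of `riemannForm`, now with the opposite sign.
-/
theorem IsMetricAt.riemannDown_eq (hb : IsMetricAt b y) (l k i j : Fin m) :
    riemannDown (fun z => formMatrix (b z)) l k i j y =
      riemannForm b y (EuclideanSpace.single l 1) (EuclideanSpace.single k 1)
        (EuclideanSpace.single i 1) (EuclideanSpace.single j 1) := by
  have hC (i j k : Fin m) : ∑ p, formMatrix (b y) l p *
      ∑ q, christoffel (fun z => formMatrix (b z)) p i q y *
        christoffel (fun z => formMatrix (b z)) q j k y =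
      ∑ q, lowChristoffel b y (EuclideanSpace.single l 1) (EuclideanSpace.single i 1)
          (EuclideanSpace.single q 1) * christoffel (fun z => formMatrix (b z)) q j k y := by
    simp only [Finset.mul_sum]
    rw [Finset.sum_comm]
    refine Finset.sum_congr rfl fun q _ => ?_
    rw [← sum_formMatrix_mul_christoffel hb.differentiableAt hb.isInner, Finset.sum_mul]
    exact Finset.sum_congr rfl fun p _ => by ring
  simp only [riemannDown, riemannUp, mul_add, mul_sub, Finset.sum_add_distrib,
    Finset.sum_sub_distrib, hC, hb.sum_formMatrix_mul_partialDeriv_christoffel, riemannForm]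
  ring

theorem IsMetricAt.riemannUp_eq (hb : IsMetricAt b y) (l k i j : Fin m) :
    riemannUp (fun z => formMatrix (b z)) l k i j y =
      ∑ p, (formMatrix (b y))⁻¹ l p * riemannForm b y (EuclideanSpace.single p 1)
        (EuclideanSpace.single k 1) (EuclideanSpace.single i 1) (EuclideanSpace.single j 1) := by
  have h3 : (formMatrix (b y))⁻¹ * formMatrix (b y) = 1 :=
    Matrix.nonsing_inv_mul _ hb.isInner.isUnit_det
  have h := congrFun (congrArg (fun A => Matrix.mulVec A
    (fun l => riemannUp (fun z => formMatrix (b z)) l k i j y)) h3) l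
  rw [← Matrix.mulVec_mulVec] at h
  simp only [← hb.riemannDown_eq, riemannDown]
  simpa [Matrix.mulVec, dotProduct, Matrix.one_apply] using h.symm

/-- The Ricci tensor applied to vectors. -/
noncomputable def ricciForm (b : EuclideanSpace ℝ (Fin m) →
      EuclideanSpace ℝ (Fin m) →L[ℝ] EuclideanSpace ℝ (Fin m) →L[ℝ] ℝ)
    (y j k : EuclideanSpace ℝ (Fin m)) : ℝ :=
  coTrace (formMatrix (b y))⁻¹ fun i l => riemannForm b y l k i j

theorem IsMetricAt.ricci_eq (hb : IsMetricAt b y) (j k : Fin m) :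
    ricci (fun z => formMatrix (b z)) j k y =
      ricciForm b y (EuclideanSpace.single j 1) (EuclideanSpace.single k 1) := by
  simp only [ricci, hb.riemannUp_eq, ricciForm, coTrace]

theorem IsMetricAt.coordScalarCurvature_eq (hb : IsMetricAt b y) :
    coordScalarCurvature (fun z => formMatrix (b z)) y =
      coTrace (formMatrix (b y))⁻¹ (ricciForm b y) := by
  simp only [coordScalarCurvature, hb.ricci_eq, coTrace]

/-! ### Symmetries -/

theorem riemannForm_swap_right (l k i j : EuclideanSpace ℝ (Fin m)) :
    riemannForm b y l k j i = -riemannForm b y l k i j := by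
  simp only [riemannForm]; ring

/-- The two quadratic terms are exchanged because the inverse metric is symmetric; the
second-derivative part is antisymmetric because second derivatives of `b` commute. -/
theorem IsMetricAt.riemannForm_swap_left (hb : IsMetricAt b y) (l k i j : EuclideanSpace ℝ (Fin m)) :
    riemannForm b y k l i j = -riemannForm b y l k i j := by
  have h1 (i k j l : EuclideanSpace ℝ (Fin m)) := coTrace_swap hb.isInner.inv_symm
    (fun p q => lowChristoffel b y p i k * lowChristoffel b y q j l)
  have h2 (i k j l : EuclideanSpace ℝ (Fin m)) :
      coTrace (formMatrix (b y))⁻¹ (fun p q => lowChristoffel b y p i k * lowChristoffel b y q j l) =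
      coTrace (formMatrix (b y))⁻¹
        (fun p q => lowChristoffel b y p j l * lowChristoffel b y q i k) := by
    rw [← h1]; simp only [mul_comm]
  have hT (v w : EuclideanSpace ℝ (Fin m)) :
      fderiv ℝ (fderiv ℝ b) y i j v w = fderiv ℝ (fderiv ℝ b) y j i v w := by
    rw [(hb.contDiffAt 2).fderiv_fderiv_comm]
  simp only [riemannForm, lowChristoffelDeriv]
  rw [h2 i k j l, h2 j k i l]
  linear_combination (1 / 2) * hT l k + (1 / 2) * hT k l

/-! ### The Gauss equation -/

/-- The covariant Hessian `⟨a, ∇_u ∂_v F⟩` of a map `F`. -/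
noncomputable def covHessian {E : Type*} [NormedAddCommGroup E] [NormedSpace ℝ E] {E' : Type*}
    [NormedAddCommGroup E'] [NormedSpace ℝ E'] (b : E' → E' →L[ℝ] E' →L[ℝ] ℝ) (F : E → E') (y : E)
    (a : E') (u v : E) : ℝ :=
  b (F y) a (fderiv ℝ (fderiv ℝ F) y u v) + lowChristoffel b (F y) a (fderiv ℝ F y u) (fderiv ℝ F y v)

/-- The hypothesis `hν` says that the inverse metric is the pushforward of the inverse induced
metric plus ν ⊗ ν, tested on products of linear functionals. For a unit normal this gives the Gauss
equation. For ν = 0 and a local isometry it gives the invariance of the Riemann tensor. -/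
theorem IsMetricAt.riemannForm_pullbackForm {F : EuclideanSpace ℝ (Fin n) → EuclideanSpace ℝ (Fin m)}
    {y : EuclideanSpace ℝ (Fin n)} (hb : IsMetricAt b (F y)) (hF : ContDiffAt ℝ 3 F y)
    (ν : EuclideanSpace ℝ (Fin m))
    (hν : ∀ p q : EuclideanSpace ℝ (Fin m) → ℝ, IsLinearMap ℝ p → IsLinearMap ℝ q →
      coTrace (formMatrix (b (F y)))⁻¹ (fun u v => p u * q v) =
        coTrace (formMatrix (pullbackForm b F y))⁻¹
          (fun u v => p (fderiv ℝ F y u) * q (fderiv ℝ F y v)) + p ν * q ν)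
    (l k i j : EuclideanSpace ℝ (Fin n)) :
    riemannForm (pullbackForm b F) y l k i j =
      riemannForm b (F y) (fderiv ℝ F y l) (fderiv ℝ F y k) (fderiv ℝ F y i) (fderiv ℝ F y j)
      + covHessian b F y ν i l * covHessian b F y ν j k
      - covHessian b F y ν j l * covHessian b F y ν i k := by
  have hlow := lowChristoffel_pullbackForm (hb.contDiffAt 1) (hF.of_le (by norm_num))
    hb.isInner.symm
  have hlin (u v : EuclideanSpace ℝ (Fin n)) : IsLinearMap ℝ fun a => covHessian b F y a u v :=
    ⟨fun _ _ => by simp [covHessian, lowChristoffel]; ring,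
     fun _ _ => by simp [covHessian, lowChristoffel]; ring⟩
  -- The Christoffel symbols of the pullback are covariant Hessians of `F` paired with tangent
  -- vectors. Hence `hν` turns this tangential contraction into a full one minus the normal term.
  -- The D²F terms of the full contraction collapse by lowering and raising an index, and are
  -- exactly the extra terms of the unraised Gauss equation `hraw`.
  have hpair (i l j k : EuclideanSpace ℝ (Fin n)) :
      coTrace (formMatrix (pullbackForm b F y))⁻¹ (fun p q =>
        lowChristoffel (pullbackForm b F) y p i l * lowChristoffel (pullbackForm b F) y q j k) =
      b (F y) (fderiv ℝ (fderiv ℝ F) y i l) (fderiv ℝ (fderiv ℝ F) y j k)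
        + lowChristoffel b (F y) (fderiv ℝ (fderiv ℝ F) y i l) (fderiv ℝ F y j) (fderiv ℝ F y k)
        + lowChristoffel b (F y) (fderiv ℝ (fderiv ℝ F) y j k) (fderiv ℝ F y i) (fderiv ℝ F y l)
        + coTrace (formMatrix (b (F y)))⁻¹ (fun p q =>
          lowChristoffel b (F y) p (fderiv ℝ F y i) (fderiv ℝ F y l) *
          lowChristoffel b (F y) q (fderiv ℝ F y j) (fderiv ℝ F y k))
        - covHessian b F y ν i l * covHessian b F y ν j k := by
    have h1 := hν _ _ (hlin i l) (hlin j k)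
    have h2 := hb.isInner.coTrace_form_mul (fderiv ℝ (fderiv ℝ F) y i l) (hlin j k)
    have h3 := hb.isInner.coTrace_form_mul (fderiv ℝ (fderiv ℝ F) y j k)
      (lowChristoffel_isLinearMap b (F y) (fderiv ℝ F y i) (fderiv ℝ F y l))
    rw [← coTrace_swap hb.isInner.inv_symm] at h3
    have h4 : (fun u v => covHessian b F y u i l * covHessian b F y v j k) = fun u v =>
        b (F y) u (fderiv ℝ (fderiv ℝ F) y i l) * covHessian b F y v j k
        + (b (F y) v (fderiv ℝ (fderiv ℝ F) y j k)
            * lowChristoffel b (F y) u (fderiv ℝ F y i) (fderiv ℝ F y l)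
          + lowChristoffel b (F y) u (fderiv ℝ F y i) (fderiv ℝ F y l) *
            lowChristoffel b (F y) v (fderiv ℝ F y j) (fderiv ℝ F y k)) := by
      ext u v
      simp only [covHessian]; ring
    rw [h4, coTrace_add, coTrace_add, h2, h3] at h1
    simp only [hlow]
    simp only [covHessian] at h1 ⊢
    linarith
  have hraw := lowChristoffelDeriv_sub_pullbackForm (hb.contDiffAt 2) hF hb.symm l k i j
  simp only [riemannForm, hpair, hraw]
  ring

end Curvature

/-! ### Hypersurfaces, local isometries and the contracted Gauss equation -/

section Hypersurface

open Filter Topology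

variable {n m : ℕ}
  {b : EuclideanSpace ℝ (Fin m) →
      EuclideanSpace ℝ (Fin m) →L[ℝ] EuclideanSpace ℝ (Fin m) →L[ℝ] ℝ}
  {F : EuclideanSpace ℝ (Fin n) → EuclideanSpace ℝ (Fin m)} {y : EuclideanSpace ℝ (Fin n)}

theorem ContDiffAt.nat_of_infty {E E' : Type*} [NormedAddCommGroup E] [NormedSpace ℝ E]
    [NormedAddCommGroup E'] [NormedSpace ℝ E'] {f : E → E'} {x : E} (hf : ContDiffAt ℝ ∞ f x)
    (k : ℕ) : ContDiffAt ℝ k f x :=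
  hf.of_le (by exact_mod_cast le_top)

theorem IsMetricAt.pullbackForm (hb : IsMetricAt b (F y)) (hF : ContDiffAt ℝ ∞ F y)
    (hi : Function.Injective (fderiv ℝ F y)) : IsMetricAt (pullbackForm b F) y where
  smooth := hb.smooth.pullbackForm hF (by simp)
  inner := by
    have h1 : ∀ᶠ z in 𝓝 y, Function.Injective (fderiv ℝ F z) :=
      (hF.fderiv_right (m := 0) (by simp)).continuousAt.eventually
        (ContinuousLinearMap.isOpen_injective.mem_nhds hi)
    filter_upwards [h1, hF.continuousAt.eventually hb.inner] with z hz hz'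
    exact ⟨fun u v => hz'.symm _ _, fun u hu => hz'.pos _ fun h0 => hu (hz (h0.trans (map_zero _).symm))⟩

theorem IsMetricAt.isInner_pullbackForm (hb : IsMetricAt b (F y))
    (hi : Function.Injective (fderiv ℝ F y)) : IsInner (_root_.pullbackForm b F y) :=
  ⟨fun _ _ => hb.isInner.symm _ _, fun _ hu => hb.isInner.pos _
    fun h0 => hu (hi (h0.trans (map_zero _).symm))⟩

/-- The inverse metric under a local isometry. -/
theorem IsMetricAt.coTrace_isometry {b : EuclideanSpace ℝ (Fin n) →
      EuclideanSpace ℝ (Fin n) →L[ℝ] EuclideanSpace ℝ (Fin n) →L[ℝ] ℝ}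
    {F : EuclideanSpace ℝ (Fin n) → EuclideanSpace ℝ (Fin n)}
    (hb : IsMetricAt b (F y)) (hi : Function.Injective (fderiv ℝ F y))
    {Q : EuclideanSpace ℝ (Fin n) → EuclideanSpace ℝ (Fin n) → ℝ}
    (h₁ : ∀ v, IsLinearMap ℝ fun u => Q u v) (h₂ : ∀ u, IsLinearMap ℝ (Q u)) :
    coTrace (formMatrix (b (F y)))⁻¹ Q = coTrace (formMatrix (_root_.pullbackForm b F y))⁻¹
      fun u v => Q (fderiv ℝ F y u) (fderiv ℝ F y v) :=
  coTrace_inv_eq_frame_sum (by simp) (b (F y)) (fun i => fderiv ℝ F y (EuclideanSpace.single i 1))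
    (formMatrix (_root_.pullbackForm b F y))⁻¹
    (Matrix.nonsing_inv_mul _ (hb.isInner_pullbackForm hi).isUnit_det) h₁ h₂

/-- The inverse metric at a point of a hypersurface. -/
theorem IsMetricAt.coTrace_hypersurface {b : EuclideanSpace ℝ (Fin (n + 1)) →
      EuclideanSpace ℝ (Fin (n + 1)) →L[ℝ] EuclideanSpace ℝ (Fin (n + 1)) →L[ℝ] ℝ}
    {F : EuclideanSpace ℝ (Fin n) → EuclideanSpace ℝ (Fin (n + 1))}
    (hb : IsMetricAt b (F y)) (hi : Function.Injective (fderiv ℝ F y))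
    {ν : EuclideanSpace ℝ (Fin (n + 1))} (hν : b (F y) ν ν = 1)
    (hνF : ∀ u, b (F y) ν (fderiv ℝ F y u) = 0)
    {Q : EuclideanSpace ℝ (Fin (n + 1)) → EuclideanSpace ℝ (Fin (n + 1)) → ℝ}
    (h₁ : ∀ v, IsLinearMap ℝ fun u => Q u v) (h₂ : ∀ u, IsLinearMap ℝ (Q u)) :
    coTrace (formMatrix (b (F y)))⁻¹ Q = coTrace (formMatrix (_root_.pullbackForm b F y))⁻¹
      (fun u v => Q (fderiv ℝ F y u) (fderiv ℝ F y v)) + Q ν ν := by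
  -- The frame consists of the coordinate tangent vectors together with ν. Its Gram matrix is block
  -- diagonal, with blocks the induced metric and 1.
  have h := coTrace_inv_eq_frame_sum (ι := Fin n ⊕ Unit) (by simp) (b (F y))
    (Sum.elim (fun i => fderiv ℝ F y (EuclideanSpace.single i 1)) fun _ => ν)
    (Matrix.fromBlocks (formMatrix (_root_.pullbackForm b F y))⁻¹ 0 0 1) ?_ h₁ h₂
  · rw [h, coTrace]
    simp
  · have h2 : Matrix.of (fun i j => b (F y)
        (Sum.elim (fun i => fderiv ℝ F y (EuclideanSpace.single i 1)) (fun _ : Unit => ν) i)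
        (Sum.elim (fun i => fderiv ℝ F y (EuclideanSpace.single i 1)) (fun _ : Unit => ν) j)) =
        Matrix.fromBlocks (formMatrix (_root_.pullbackForm b F y)) 0 0 1 := by
      ext i j
      rcases i with i | i <;> rcases j with j | j
      · simp
      · simp [hb.isInner.symm _ ν, hνF]
      · simp [hνF]
      · simp [hν]
    rw [h2, Matrix.fromBlocks_multiply,
      Matrix.nonsing_inv_mul _ (hb.isInner_pullbackForm hi).isUnit_det]
    simp

theorem riemannForm_isLinearMap₁ (b : EuclideanSpace ℝ (Fin m) →
      EuclideanSpace ℝ (Fin m) →L[ℝ] EuclideanSpace ℝ (Fin m) →L[ℝ] ℝ)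
    (y k i j : EuclideanSpace ℝ (Fin m)) : IsLinearMap ℝ fun l => riemannForm b y l k i j := by
  have hl (l l' : EuclideanSpace ℝ (Fin m)) (a i) : lowChristoffel b y a i (l + l') =
      lowChristoffel b y a i l + lowChristoffel b y a i l' := by simp [lowChristoffel]; ring
  have hs (c : ℝ) (l : EuclideanSpace ℝ (Fin m)) (a i) : lowChristoffel b y a i (c • l) =
      c * lowChristoffel b y a i l := by simp [lowChristoffel]; ring
  constructor
  · intro l l'
    simp only [riemannForm, hl, add_mul, coTrace_add]
    simp only [lowChristoffelDeriv, map_add, _root_.add_apply]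
    ring
  · intro c l
    simp only [riemannForm, hs, mul_assoc, coTrace_const_mul]
    simp only [lowChristoffelDeriv, map_smul, _root_.smul_apply, smul_eq_mul]
    ring

theorem riemannForm_isLinearMap₃ (b : EuclideanSpace ℝ (Fin m) →
      EuclideanSpace ℝ (Fin m) →L[ℝ] EuclideanSpace ℝ (Fin m) →L[ℝ] ℝ)
    (y l k j : EuclideanSpace ℝ (Fin m)) : IsLinearMap ℝ fun i => riemannForm b y l k i j := by
  have hl (l l' : EuclideanSpace ℝ (Fin m)) (a i) : lowChristoffel b y a (l + l') i =
      lowChristoffel b y a l i + lowChristoffel b y a l' i := by simp [lowChristoffel]; ring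
  have hs (c : ℝ) (l : EuclideanSpace ℝ (Fin m)) (a i) : lowChristoffel b y a (c • l) i =
      c * lowChristoffel b y a l i := by simp [lowChristoffel]; ring
  constructor
  · intro i i'
    simp only [riemannForm, hl, add_mul, mul_add, coTrace_add]
    simp only [lowChristoffelDeriv, map_add, _root_.add_apply]
    ring
  · intro c i
    simp only [riemannForm, hs, mul_assoc, mul_left_comm _ c, coTrace_const_mul]
    simp only [lowChristoffelDeriv, map_smul, _root_.smul_apply, smul_eq_mul]
    ring

theorem IsMetricAt.riemannForm_isLinearMap₂ {y : EuclideanSpace ℝ (Fin m)} (hb : IsMetricAt b y)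
    (l i j : EuclideanSpace ℝ (Fin m)) : IsLinearMap ℝ fun k => riemannForm b y l k i j := by
  have h := riemannForm_isLinearMap₁ b y l i j
  constructor
  · intro k k'
    simp only [hb.riemannForm_swap_left _ l, h.map_add]
    ring
  · intro c k
    simp only [hb.riemannForm_swap_left _ l, h.map_smul, smul_eq_mul]
    ring

theorem riemannForm_isLinearMap₄ (b : EuclideanSpace ℝ (Fin m) →
      EuclideanSpace ℝ (Fin m) →L[ℝ] EuclideanSpace ℝ (Fin m) →L[ℝ] ℝ)
    (y l k i : EuclideanSpace ℝ (Fin m)) : IsLinearMap ℝ fun j => riemannForm b y l k i j := by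
  have h := riemannForm_isLinearMap₃ b y l k i
  constructor
  · intro j j'
    simp only [riemannForm_swap_right _ _ _ i, h.map_add]
    ring
  · intro c j
    simp only [riemannForm_swap_right _ _ _ i, h.map_smul, smul_eq_mul]
    ring

theorem IsMetricAt.ricciForm_isLinearMap_right {y : EuclideanSpace ℝ (Fin m)} (hb : IsMetricAt b y)
    (j : EuclideanSpace ℝ (Fin m)) : IsLinearMap ℝ (ricciForm b y j) := by
  constructor
  · intro k k'
    simp only [ricciForm, (hb.riemannForm_isLinearMap₂ _ _ _).map_add, coTrace_add]
  · intro c k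
    simp only [ricciForm, (hb.riemannForm_isLinearMap₂ _ _ _).map_smul, coTrace_const_mul,
      smul_eq_mul]

theorem ricciForm_isLinearMap_left {y : EuclideanSpace ℝ (Fin m)}
    (k : EuclideanSpace ℝ (Fin m)) : IsLinearMap ℝ fun j => ricciForm b y j k := by
  constructor
  · intro j j'
    simp only [ricciForm, (riemannForm_isLinearMap₄ _ _ _ _ _).map_add, coTrace_add]
  · intro c j
    simp only [ricciForm, (riemannForm_isLinearMap₄ _ _ _ _ _).map_smul, coTrace_const_mul,
      smul_eq_mul]

theorem isLinearMap_mul_left {p q : EuclideanSpace ℝ (Fin m) → ℝ} (hp : IsLinearMap ℝ p)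
    (v : EuclideanSpace ℝ (Fin m)) : IsLinearMap ℝ fun u => p u * q v :=
  ⟨fun _ _ => by rw [hp.map_add, add_mul], fun _ _ => by
    rw [hp.map_smul, smul_eq_mul, smul_eq_mul, mul_assoc]⟩

theorem isLinearMap_mul_right {p q : EuclideanSpace ℝ (Fin m) → ℝ} (hq : IsLinearMap ℝ q)
    (u : EuclideanSpace ℝ (Fin m)) : IsLinearMap ℝ fun v => p u * q v :=
  ⟨fun _ _ => by rw [hq.map_add, mul_add], fun _ _ => by
    rw [hq.map_smul, smul_eq_mul, smul_eq_mul, mul_left_comm]⟩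

/-- Scalar curvature is invariant under local isometries. -/
theorem IsMetricAt.coordScalarCurvature_pullbackForm {b : EuclideanSpace ℝ (Fin n) →
      EuclideanSpace ℝ (Fin n) →L[ℝ] EuclideanSpace ℝ (Fin n) →L[ℝ] ℝ}
    {F : EuclideanSpace ℝ (Fin n) → EuclideanSpace ℝ (Fin n)}
    (hb : IsMetricAt b (F y)) (hF : ContDiffAt ℝ ∞ F y)
    (hi : Function.Injective (fderiv ℝ F y)) :
    coordScalarCurvature (fun z => formMatrix (_root_.pullbackForm b F z)) y =
      coordScalarCurvature (fun z => formMatrix (b z)) (F y) := by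
  -- For a local isometry the inverse metric has no normal part, so the Gauss equation is used with
  -- ν = 0 and its Hessian terms vanish.
  have hg := hb.riemannForm_pullbackForm (hF.nat_of_infty 3) 0
    (fun p q hp hq => by
      rw [hb.coTrace_isometry hi (isLinearMap_mul_left hp) (isLinearMap_mul_right hq)]
      simp [hp.map_zero])
  rw [(hb.pullbackForm hF hi).coordScalarCurvature_eq, hb.coordScalarCurvature_eq,
    hb.coTrace_isometry hi (fun v => ricciForm_isLinearMap_left v) hb.ricciForm_isLinearMap_right]
  have h0 (u v : EuclideanSpace ℝ (Fin n)) : covHessian b F y 0 u v = 0 := by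
    simp [covHessian, lowChristoffel]
  congr 1
  ext j k
  rw [ricciForm, ricciForm, hb.coTrace_isometry hi
    (Q := fun i l => riemannForm b (F y) l (fderiv ℝ F y k) i (fderiv ℝ F y j))
    (fun v => riemannForm_isLinearMap₃ _ _ _ _ _) (fun u => riemannForm_isLinearMap₁ _ _ _ _ _)]
  simp only [hg, h0]
  simp

/-- The contracted Gauss equation. -/
theorem IsMetricAt.gauss_contracted {b : EuclideanSpace ℝ (Fin (n + 1)) →
      EuclideanSpace ℝ (Fin (n + 1)) →L[ℝ] EuclideanSpace ℝ (Fin (n + 1)) →L[ℝ] ℝ}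
    {F : EuclideanSpace ℝ (Fin n) → EuclideanSpace ℝ (Fin (n + 1))}
    (hb : IsMetricAt b (F y)) (hF : ContDiffAt ℝ ∞ F y) (hi : Function.Injective (fderiv ℝ F y))
    {ν : EuclideanSpace ℝ (Fin (n + 1))} (hν : b (F y) ν ν = 1)
    (hνF : ∀ u, b (F y) ν (fderiv ℝ F y u) = 0) :
    2 * coTrace (formMatrix (_root_.pullbackForm b F y))⁻¹
        (fun u v => ricciForm b (F y) (fderiv ℝ F y u) (fderiv ℝ F y v)) =
      coordScalarCurvature (fun z => formMatrix (b z)) (F y)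
      + coordScalarCurvature (fun z => formMatrix (_root_.pullbackForm b F z)) y
      - coTrace (formMatrix (_root_.pullbackForm b F y))⁻¹ (covHessian b F y ν) ^ 2
      + coTrace (formMatrix (_root_.pullbackForm b F y))⁻¹ (fun j k =>
          coTrace (formMatrix (_root_.pullbackForm b F y))⁻¹ fun i l =>
            covHessian b F y ν j l * covHessian b F y ν i k) := by
  have hg := hb.riemannForm_pullbackForm (hF.nat_of_infty 3) ν
    (fun p q hp hq =>
      hb.coTrace_hypersurface hi hν hνF (isLinearMap_mul_left hp) (isLinearMap_mul_right hq))
  have hRic (j k : EuclideanSpace ℝ (Fin (n + 1))) := hb.coTrace_hypersurface hi hν hνF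
    (Q := fun i l => riemannForm b (F y) l k i j)
    (fun v => riemannForm_isLinearMap₃ _ _ _ _ _) (fun u => riemannForm_isLinearMap₁ _ _ _ _ _)
  have hP : coTrace (formMatrix (_root_.pullbackForm b F y))⁻¹
        (fun u v => ricciForm b (F y) (fderiv ℝ F y u) (fderiv ℝ F y v)) =
      coTrace (formMatrix (_root_.pullbackForm b F y))⁻¹ (fun j k =>
          coTrace (formMatrix (_root_.pullbackForm b F y))⁻¹ fun i l =>
          riemannForm b (F y) (fderiv ℝ F y l) (fderiv ℝ F y k) (fderiv ℝ F y i) (fderiv ℝ F y j))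
      + coTrace (formMatrix (_root_.pullbackForm b F y))⁻¹ (fun j k =>
          riemannForm b (F y) ν (fderiv ℝ F y k) ν (fderiv ℝ F y j)) := by
    rw [← coTrace_add]
    simp only [ricciForm, hRic]
  -- Ric(ν, ν) is a purely tangential trace because R(ν, ν, ν, ν) = 0. It coincides with the normal
  -- part of the tangential trace of Ric found in `hP`.
  have hN : ricciForm b (F y) ν ν = coTrace (formMatrix (_root_.pullbackForm b F y))⁻¹ (fun j k =>
          riemannForm b (F y) ν (fderiv ℝ F y k) ν (fderiv ℝ F y j)) := by
    have h0 : riemannForm b (F y) ν ν ν ν = 0 := by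
      have := riemannForm_swap_right (b := b) (y := F y) ν ν ν ν
      linarith
    rw [ricciForm, hRic, h0, add_zero]
    congr 1
    ext j k
    rw [hb.riemannForm_swap_left, riemannForm_swap_right, neg_neg]
  have hR : coordScalarCurvature (fun z => formMatrix (b z)) (F y) =
      coTrace (formMatrix (_root_.pullbackForm b F y))⁻¹
        (fun u v => ricciForm b (F y) (fderiv ℝ F y u) (fderiv ℝ F y v)) + ricciForm b (F y) ν ν := by
    rw [hb.coordScalarCurvature_eq, hb.coTrace_hypersurface hi hν hνF
      (fun v => ricciForm_isLinearMap_left v) hb.ricciForm_isLinearMap_right]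
  have hS : coordScalarCurvature (fun z => formMatrix (_root_.pullbackForm b F z)) y =
      coTrace (formMatrix (_root_.pullbackForm b F y))⁻¹ (fun j k =>
          coTrace (formMatrix (_root_.pullbackForm b F y))⁻¹ fun i l =>
          riemannForm b (F y) (fderiv ℝ F y l) (fderiv ℝ F y k) (fderiv ℝ F y i) (fderiv ℝ F y j))
      + coTrace (formMatrix (_root_.pullbackForm b F y))⁻¹ (covHessian b F y ν) ^ 2
      - coTrace (formMatrix (_root_.pullbackForm b F y))⁻¹ (fun j k =>
          coTrace (formMatrix (_root_.pullbackForm b F y))⁻¹ fun i l =>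
            covHessian b F y ν j l * covHessian b F y ν i k) := by
    rw [(hb.pullbackForm hF hi).coordScalarCurvature_eq]
    change coTrace _ (fun j k => ricciForm (_root_.pullbackForm b F) y j k) = _
    simp only [ricciForm, hg, coTrace_sub, coTrace_add]
    congr 2
    rw [sq, ← coTrace_const_mul]
    congr 1
    ext j k
    rw [← coTrace_mul_const]
  -- Let P be the tangential trace of Ric, T the tangential double trace of Riem and N = Ric(ν, ν).
  -- Then P = T + N, R = P + N and ℛ = T + K² - |K|², whence 2P = R + T = R + ℛ - K² + |K|².
  linarith

end Hypersurface

/-! ### The pointwise estimate in coordinates -/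

section PointwiseInequality

open Filter Topology
open scoped Kronecker

variable {n m : ℕ}

/-- Cauchy–Schwarz for the two eigenvalues of M = AK: the difference of the two sides is (λ₁ - λ₂)²,
the discriminant of the characteristic polynomial of M. -/
theorem coTrace_sq_le {A : Matrix (Fin 2) (Fin 2) ℝ} (hA : A.PosDef)
    {K : EuclideanSpace ℝ (Fin 2) → EuclideanSpace ℝ (Fin 2) → ℝ} (hK : ∀ u v, K u v = K v u) :
    coTrace A K ^ 2 ≤ 2 * coTrace A (fun j k => coTrace A fun i l => K j l * K i k) := by
  have h10 : A 1 0 = A 0 1 := by simpa using hA.isHermitian.apply 0 1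
  have h00 : 0 < A 0 0 := hA.diag_pos
  have hdet : 0 < A 0 0 * A 1 1 - A 0 1 * A 0 1 := by
    have := hA.det_pos
    rwa [Matrix.det_fin_two, h10] at this
  simp only [coTrace, Fin.sum_univ_two]
  rw [h10, hK (EuclideanSpace.single 1 1) (EuclideanSpace.single 0 1)]
  generalize K (EuclideanSpace.single 0 1) (EuclideanSpace.single 0 1) = p
  generalize K (EuclideanSpace.single 0 1) (EuclideanSpace.single 1 1) = q
  generalize K (EuclideanSpace.single 1 1) (EuclideanSpace.single 1 1) = r
  generalize A 0 0 = a at *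
  generalize A 0 1 = d at *
  generalize A 1 1 = c at *
  -- The discriminant is (M₀₀ - M₁₁)² + 4 M₀₁ M₁₀, with M₀₀ - M₁₁ = ap - cr and M₀₁ = aq + dr.
  -- Multiplying it by a² and completing the square gives this sum, which is nonnegative because det
  -- A > 0.
  have h : 0 ≤ (a * (a * p - c * r) + 2 * d * (a * q + d * r)) ^ 2
      + 4 * (a * c - d * d) * (a * q + d * r) ^ 2 := by positivity
  rw [← sub_nonneg]
  refine nonneg_of_mul_nonneg_right (a := a * a) (le_of_le_of_eq h ?_) (by positivity)
  ring

theorem covHessian_symm {b : EuclideanSpace ℝ (Fin m) →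
      EuclideanSpace ℝ (Fin m) →L[ℝ] EuclideanSpace ℝ (Fin m) →L[ℝ] ℝ}
    {F : EuclideanSpace ℝ (Fin n) → EuclideanSpace ℝ (Fin m)} {y : EuclideanSpace ℝ (Fin n)}
    (hb : IsMetricAt b (F y)) (hF : ContDiffAt ℝ ∞ F y) (a : EuclideanSpace ℝ (Fin m))
    (u v : EuclideanSpace ℝ (Fin n)) : covHessian b F y a u v = covHessian b F y a v u := by
  rw [covHessian, covHessian, (hF.nat_of_infty 2).fderiv_fderiv_comm u v,
    lowChristoffel_symm hb.differentiableAt hb.symm]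

/-- This is the quadratic form of the Kronecker product `A ⊗ B`, itself positive semidefinite, at
the vector ∑ e_i ⊗ e_i. -/
theorem Matrix.PosSemidef.sum_mul_nonneg {ι : Type*} [Fintype ι] [DecidableEq ι]
    {A B : Matrix ι ι ℝ} (hA : A.PosSemidef) (hB : B.PosSemidef) :
    0 ≤ ∑ i, ∑ j, A i j * B i j := by
  have h := (hA.kronecker hB).dotProduct_mulVec_nonneg fun p : ι × ι => if p.1 = p.2 then 1 else 0
  refine le_of_le_of_eq h ?_
  simp [dotProduct, Matrix.mulVec, Fintype.sum_prod_type]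

/-- With the lowered Riemann tensor reshaped into an m × m³ matrix `X`, the quadratic tensor is X
(G⁻¹ ⊗ G⁻¹ ⊗ G⁻¹) Xᵀ. -/
theorem posSemidef_riemannSq {b : EuclideanSpace ℝ (Fin m) →
      EuclideanSpace ℝ (Fin m) →L[ℝ] EuclideanSpace ℝ (Fin m) →L[ℝ] ℝ}
    {y : EuclideanSpace ℝ (Fin m)} (hb : IsInner (b y)) :
    (Matrix.of fun i j => riemannSq (fun z => formMatrix (b z)) i j y).PosSemidef := by
  have hG := hb.posDef.inv.posSemidef
  set X : Matrix (Fin m) (Fin m × Fin m × Fin m) ℝ := Matrix.of fun a I =>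
    riemannDown (fun z => formMatrix (b z)) a I.1 I.2.1 I.2.2 y with hX
  have h := (hG.kronecker (hG.kronecker hG)).mul_mul_conjTranspose_same X
  refine (congrArg Matrix.PosSemidef ?_).mpr h
  ext i j
  simp only [riemannSq, hX, Matrix.of_apply, Matrix.mul_apply, Matrix.conjTranspose_apply,
    star_trivial, Fintype.sum_prod_type, Matrix.kroneckerMap_apply, Finset.sum_mul]
  have swap {f : Fin m → Fin m → Fin m → Fin m → Fin m → Fin m → ℝ} :
      ∑ p, ∑ q, ∑ s, ∑ p', ∑ q', ∑ s', f p q s p' q' s' =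
        ∑ p', ∑ q', ∑ s', ∑ p, ∑ q, ∑ s, f p q s p' q' s' := by
    have := Finset.sum_comm (s := (Finset.univ : Finset (Fin m × Fin m × Fin m)))
      (t := (Finset.univ : Finset (Fin m × Fin m × Fin m)))
      (f := fun I I' => f I.1 I.2.1 I.2.2 I'.1 I'.2.1 I'.2.2)
    simpa only [Fintype.sum_prod_type] using this
  rw [swap]
  refine Finset.sum_congr rfl fun _ _ => Finset.sum_congr rfl fun _ _ =>
    Finset.sum_congr rfl fun _ _ => Finset.sum_congr rfl fun _ _ => Finset.sum_congr rfl fun _ _ =>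
    Finset.sum_congr rfl fun _ _ => ?_
  ring

/-- A positive semidefinite form stays so after restriction along `L`, and its contraction with a
positive semidefinite matrix is nonnegative. This fixes the sign of the α-term in the area
variation. -/
theorem coTrace_riemannSq_nonneg {b : EuclideanSpace ℝ (Fin m) →
      EuclideanSpace ℝ (Fin m) →L[ℝ] EuclideanSpace ℝ (Fin m) →L[ℝ] ℝ}
    {y : EuclideanSpace ℝ (Fin m)} (hb : IsInner (b y))
    (L : EuclideanSpace ℝ (Fin n) → EuclideanSpace ℝ (Fin m))
    {A : Matrix (Fin n) (Fin n) ℝ} (hA : A.PosSemidef) :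
    0 ≤ coTrace A fun u v => ∑ i, ∑ j, L u i * L v j *
      riemannSq (fun z => formMatrix (b z)) i j y := by
  set X : Matrix (Fin n) (Fin m) ℝ := Matrix.of fun k i => L (EuclideanSpace.single k 1) i with hX
  have h := hA.sum_mul_nonneg ((posSemidef_riemannSq hb).mul_mul_conjTranspose_same X)
  refine le_of_le_of_eq h (Finset.sum_congr rfl fun k _ => Finset.sum_congr rfl fun l _ => ?_)
  congr 1
  simp only [hX, Matrix.mul_apply, Matrix.of_apply, Matrix.conjTranspose_apply, star_trivial,
    Finset.sum_mul]
  rw [Finset.sum_comm]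
  exact Finset.sum_congr rfl fun i _ => Finset.sum_congr rfl fun j _ => by ring

/-- Jacobi's formula, read off in size two from the explicit determinant and adjugate. Derivatives
are taken within `J` to include endpoints. -/
theorem hasDerivWithinAt_sqrt_det {g : ℝ → Matrix (Fin 2) (Fin 2) ℝ} {g' : Matrix (Fin 2) (Fin 2) ℝ}
    {J : Set ℝ} {t : ℝ} (hg : ∀ i j, HasDerivWithinAt (fun s => g s i j) (g' i j) J t)
    (hp : (g t).PosDef) :
    HasDerivWithinAt (fun s => √(g s).det)
      (1 / 2 * √(g t).det * ∑ i, ∑ j, (g t)⁻¹ i j * g' i j) J t := by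
  have h1 := (((hg 0 0).mul (hg 1 1)).sub ((hg 0 1).mul (hg 1 0))).sqrt
    (by simpa [Matrix.det_fin_two] using hp.det_pos.ne')
  have h10 : g t 1 0 = g t 0 1 := by simpa using hp.isHermitian.apply 0 1
  have hd := hp.det_pos
  have hs : √(g t).det * √(g t).det = (g t).det := Real.mul_self_sqrt hd.le
  have hs0 : 0 < √(g t).det := Real.sqrt_pos.2 hd
  refine (h1.congr_deriv ?_).congr (fun s _ => ?_) ?_
  · simp only [Pi.mul_apply, Pi.sub_apply, ← Matrix.det_fin_two]
    rw [Matrix.inv_def, Matrix.adjugate_fin_two]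
    simp only [Fin.sum_univ_two, Matrix.smul_apply, smul_eq_mul, Ring.inverse_eq_inv',
      Matrix.of_apply, Matrix.cons_val', Matrix.cons_val_zero, Matrix.cons_val_one,
      Matrix.cons_val_fin_one, h10]
    field_simp
    rw [sq, hs]
    field_simp
    ring
  · simp [Matrix.det_fin_two]
  · simp [Matrix.det_fin_two]

/-- The pointwise form of the area estimate, in local coordinates. -/
theorem exists_deriv_area_density {b : ℝ → EuclideanSpace ℝ (Fin 3) →
      EuclideanSpace ℝ (Fin 3) →L[ℝ] EuclideanSpace ℝ (Fin 3) →L[ℝ] ℝ}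
    {F : EuclideanSpace ℝ (Fin 2) → EuclideanSpace ℝ (Fin 3)} {y : EuclideanSpace ℝ (Fin 2)}
    {J : Set ℝ} {t α : ℝ} (hα : 0 ≤ α)
    (hb : IsMetricAt (b t) (F y)) (hF : ContDiffAt ℝ ∞ F y)
    (hi : Function.Injective (fderiv ℝ F y))
    {ν : EuclideanSpace ℝ (Fin 3)} (hν : b t (F y) ν ν = 1)
    (hνF : ∀ u, b t (F y) ν (fderiv ℝ F y u) = 0)
    (hflow : ∀ i j, HasDerivWithinAt (fun s => formMatrix (b s (F y)) i j)
      (-2 * ricci (fun z => formMatrix (b t z)) i j (F y)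
        - α / 2 * riemannSq (fun z => formMatrix (b t z)) i j (F y)) J t)
    (hR : 0 ≤ coordScalarCurvature (fun z => formMatrix (b t z)) (F y)) :
    ∃ D : ℝ, HasDerivWithinAt (fun s => √(formMatrix (pullbackForm (b s) F y)).det) D J t ∧
      D ≤ -(1 / 4) * ((2 * coordScalarCurvature (fun z => formMatrix (pullbackForm (b t) F z)) y
        - coTrace (formMatrix (pullbackForm (b t) F y))⁻¹ (covHessian (b t) F y ν) ^ 2)
          * √(formMatrix (pullbackForm (b t) F y)).det) := by
  have hγ := (hb.isInner_pullbackForm hi).posDef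
  -- The embedding does not depend on time, so the induced metric evolves by the pullback of the
  -- right-hand side of the flow.
  set g' : Matrix (Fin 2) (Fin 2) ℝ := Matrix.of fun k l => ∑ i, ∑ j,
    (fderiv ℝ F y (EuclideanSpace.single k 1) i * fderiv ℝ F y (EuclideanSpace.single l 1) j) *
    (-2 * ricci (fun z => formMatrix (b t z)) i j (F y)
        - α / 2 * riemannSq (fun z => formMatrix (b t z)) i j (F y)) with hg'
  have hd (k l : Fin 2) : HasDerivWithinAt
      (fun s => formMatrix (pullbackForm (b s) F y) k l) (g' k l) J t := by
    have h : HasDerivWithinAt (fun s => ∑ i, ∑ j,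
      (fderiv ℝ F y (EuclideanSpace.single k 1) i * fderiv ℝ F y (EuclideanSpace.single l 1) j) *
        formMatrix (b s (F y)) i j) (g' k l) J t :=
      HasDerivWithinAt.fun_sum fun i _ => HasDerivWithinAt.fun_sum fun j _ =>
        (hflow i j).const_mul _
    refine h.congr (fun s _ => ?_) ?_
    · rw [formMatrix_apply, pullbackForm_apply, form_apply_eq_sum]
    · rw [formMatrix_apply, pullbackForm_apply, form_apply_eq_sum]
  refine ⟨_, hasDerivWithinAt_sqrt_det hd hγ, ?_⟩
  have hsum : ∑ i, ∑ j, (formMatrix (pullbackForm (b t) F y))⁻¹ i j * g' i j =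
      -2 * coTrace (formMatrix (pullbackForm (b t) F y))⁻¹
        (fun u v => ricciForm (b t) (F y) (fderiv ℝ F y u) (fderiv ℝ F y v))
      - α / 2 * coTrace (formMatrix (pullbackForm (b t) F y))⁻¹ (fun u v => ∑ i, ∑ j,
          fderiv ℝ F y u i * fderiv ℝ F y v j *
            riemannSq (fun z => formMatrix (b t z)) i j (F y)) := by
    rw [← coTrace_const_mul, ← coTrace_const_mul, ← coTrace_sub, coTrace]
    refine Finset.sum_congr rfl fun k _ => Finset.sum_congr rfl fun l _ => ?_
    rw [bilinear_eq_sum (fun v => ricciForm_isLinearMap_left v) hb.ricciForm_isLinearMap_right]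
    simp only [hg', Matrix.of_apply, mul_sub, Finset.sum_sub_distrib, Finset.mul_sum, hb.ricci_eq]
    congr 1 <;>
    exact Finset.sum_congr rfl fun i _ => Finset.sum_congr rfl fun j _ => by ring
  have h1 := hb.gauss_contracted hF hi hν hνF
  have h2 := coTrace_sq_le hγ.inv (K := covHessian (b t) F y ν) (covHessian_symm hb hF ν)
  have h3 := coTrace_riemannSq_nonneg hb.isInner (fderiv ℝ F y) hγ.inv.posSemidef
  have h4 := mul_nonneg hα h3
  rw [hsum]
  have hs := Real.sqrt_nonneg (formMatrix (pullbackForm (b t) F y)).det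
  have key : 1 / 2 * (-2 * coTrace (formMatrix (pullbackForm (b t) F y))⁻¹
        (fun u v => ricciForm (b t) (F y) (fderiv ℝ F y u) (fderiv ℝ F y v))
      - α / 2 * coTrace (formMatrix (pullbackForm (b t) F y))⁻¹ (fun u v => ∑ i, ∑ j,
          fderiv ℝ F y u i * fderiv ℝ F y v j *
            riemannSq (fun z => formMatrix (b t z)) i j (F y))) ≤
      -(1 / 4) * (2 * coordScalarCurvature (fun z => formMatrix (pullbackForm (b t) F z)) y
        - coTrace (formMatrix (pullbackForm (b t) F y))⁻¹ (covHessian (b t) F y ν) ^ 2) := by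
    -- Up to the α-term, which is nonpositive, the left side is -½ (R + ℛ - K² + |K|²). Inserting R
    -- ≥ 0 and |K|² ≥ ½ K² bounds it by -½ (ℛ - ½ K²).
    linarith
  have := mul_le_mul_of_nonneg_right key hs
  linarith

end PointwiseInequality

/-! ### Covariant Hessians under changes of coordinates -/

section ChartChange

open Filter Topology

variable {E E' E'' : Type*} [NormedAddCommGroup E] [NormedSpace ℝ E]
  [NormedAddCommGroup E'] [NormedSpace ℝ E'] [NormedAddCommGroup E''] [NormedSpace ℝ E'']

theorem fderiv_fderiv_comp {φ : E' → E''} {F : E → E'} {y : E} (hφ : ContDiffAt ℝ 2 φ (F y))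
    (hF : ContDiffAt ℝ 2 F y) (u v : E) :
    fderiv ℝ (fderiv ℝ (φ ∘ F)) y u v =
      fderiv ℝ (fderiv ℝ φ) (F y) (fderiv ℝ F y u) (fderiv ℝ F y v)
      + fderiv ℝ φ (F y) (fderiv ℝ (fderiv ℝ F) y u v) := by
  have hev : fderiv ℝ (φ ∘ F) =ᶠ[𝓝 y] fun z => (fderiv ℝ φ (F z)).comp (fderiv ℝ F z) := by
    filter_upwards [hF.eventually (by simp), hF.continuousAt.eventually (hφ.eventually (by simp))]
      with z h1 h2
    exact fderiv_comp _ (h2.differentiableAt (by simp)) (h1.differentiableAt (by simp))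
  rw [hev.fderiv_eq]
  have h1 : HasFDerivAt (fun z => fderiv ℝ φ (F z)) _ y :=
    ((hφ.fderiv_right (m := 1) (by norm_num)).differentiableAt (by norm_num)).hasFDerivAt.comp y
      (hF.differentiableAt (by simp)).hasFDerivAt
  have h2 := ((hF.fderiv_right (m := 1) (by norm_num)).differentiableAt (by norm_num)).hasFDerivAt
  rw [(h1.clm_comp h2).fderiv]
  simp [add_comm]

theorem pullbackForm_comp (b : E'' → E'' →L[ℝ] E'' →L[ℝ] ℝ) {φ : E' → E''} {F : E → E'} {y : E}
    (hφ : DifferentiableAt ℝ φ (F y)) (hF : DifferentiableAt ℝ F y) :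
    pullbackForm b (φ ∘ F) y = pullbackForm (pullbackForm b φ) F y := by
  ext u v
  simp [fderiv_comp _ hφ hF]

/-- Tensoriality in the target: the D²φ term of the second-order chain rule is precisely the
inhomogeneous term in the transformation law of the Christoffel symbols. -/
theorem covHessian_comp_left {b : E'' → E'' →L[ℝ] E'' →L[ℝ] ℝ} {φ : E' → E''} {F : E → E'} {y : E}
    (hb : ContDiffAt ℝ 1 b (φ (F y))) (hs : ∀ u v, b (φ (F y)) u v = b (φ (F y)) v u)
    (hφ : ContDiffAt ℝ 2 φ (F y)) (hF : ContDiffAt ℝ 2 F y) (a : E') (u v : E) :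
    covHessian b (φ ∘ F) y (fderiv ℝ φ (F y) a) u v =
      covHessian (pullbackForm b φ) F y a u v := by
  rw [covHessian, covHessian, lowChristoffel_pullbackForm hb hφ hs, fderiv_fderiv_comp hφ hF,
    fderiv_comp _ (hφ.differentiableAt (by simp)) (hF.differentiableAt (by simp))]
  simp
  ring

/-- Reparametrizing the source costs an error term along the tangent space of `F`, which drops out
when `a` is normal. This is why only the normal part of the Hessian is geometric. -/
theorem covHessian_comp_right {b : E'' → E'' →L[ℝ] E'' →L[ℝ] ℝ} {F : E' → E''} {ψ : E → E'} {y : E}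
    (hF : ContDiffAt ℝ 2 F (ψ y)) (hψ : ContDiffAt ℝ 2 ψ y) (a : E'') (u v : E) :
    covHessian b (F ∘ ψ) y a u v = covHessian b F (ψ y) a (fderiv ℝ ψ y u) (fderiv ℝ ψ y v)
      + b (F (ψ y)) a (fderiv ℝ F (ψ y) (fderiv ℝ (fderiv ℝ ψ) y u v)) := by
  rw [covHessian, covHessian, fderiv_fderiv_comp hF hψ,
    fderiv_comp _ (hF.differentiableAt (by simp)) (hψ.differentiableAt (by simp))]
  simp
  ring

theorem covHessian_congr {b b' : E' → E' →L[ℝ] E' →L[ℝ] ℝ} {F F' : E → E'} {y : E}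
    (hF : F =ᶠ[𝓝 y] F') (hb : b =ᶠ[𝓝 (F y)] b') (a : E') (u v : E) :
    covHessian b F y a u v = covHessian b' F' y a u v := by
  have h0 := hF.eq_of_nhds
  have h1 := hb.eq_of_nhds
  rw [h0] at hb h1
  simp only [covHessian, lowChristoffel, h0, h1, hb.fderiv_eq (𝕜 := ℝ), hF.fderiv_eq (𝕜 := ℝ),
    hF.fderiv (𝕜 := ℝ).fderiv_eq (𝕜 := ℝ)]

theorem pullbackForm_congr {b b' : E' → E' →L[ℝ] E' →L[ℝ] ℝ} {F F' : E → E'} {y : E}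
    (hF : F =ᶠ[𝓝 y] F') (hb : b (F y) = b' (F y)) :
    pullbackForm b F y = pullbackForm b' F' y := by
  have h0 := hF.eq_of_nhds
  rw [h0] at hb
  simp only [pullbackForm, h0, hb, hF.fderiv_eq (𝕜 := ℝ)]

end ChartChange

/-! ### The mean curvature and its square without a choice of normal -/

section MeanCurvature

open Filter Topology

variable {n m : ℕ}

/-- The trace of the covariant Hessian of `F`, in the direction `a`. -/
noncomputable def meanTrace (b : EuclideanSpace ℝ (Fin m) →
      EuclideanSpace ℝ (Fin m) →L[ℝ] EuclideanSpace ℝ (Fin m) →L[ℝ] ℝ)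
    (F : EuclideanSpace ℝ (Fin n) → EuclideanSpace ℝ (Fin m)) (y : EuclideanSpace ℝ (Fin n))
    (a : EuclideanSpace ℝ (Fin m)) : ℝ :=
  coTrace (formMatrix (pullbackForm b F y))⁻¹ (covHessian b F y a)

theorem covHessian_isLinearMap {E E' : Type*} [NormedAddCommGroup E] [NormedSpace ℝ E]
    [NormedAddCommGroup E'] [NormedSpace ℝ E'] (b : E' → E' →L[ℝ] E' →L[ℝ] ℝ) (F : E → E')
    (y u v : E) : IsLinearMap ℝ fun a => covHessian b F y a u v :=
  ⟨fun _ _ => by simp [covHessian, lowChristoffel]; ring,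
   fun _ _ => by simp [covHessian, lowChristoffel]; ring⟩

theorem meanTrace_isLinearMap (b : EuclideanSpace ℝ (Fin m) →
      EuclideanSpace ℝ (Fin m) →L[ℝ] EuclideanSpace ℝ (Fin m) →L[ℝ] ℝ)
    (F : EuclideanSpace ℝ (Fin n) → EuclideanSpace ℝ (Fin m)) (y : EuclideanSpace ℝ (Fin n)) :
    IsLinearMap ℝ (meanTrace b F y) := by
  constructor
  · intro a a'
    rw [meanTrace, meanTrace, meanTrace, ← coTrace_add]
    congr 1
    ext u v
    exact (covHessian_isLinearMap b F y u v).map_add a a'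
  · intro c a
    rw [meanTrace, meanTrace, smul_eq_mul, ← coTrace_const_mul]
    congr 1
    ext u v
    exact (covHessian_isLinearMap b F y u v).map_smul c a

/-- The squared length of the normal part of the trace of the covariant Hessian of `F`. -/
noncomputable def meanSq (b : EuclideanSpace ℝ (Fin m) →
      EuclideanSpace ℝ (Fin m) →L[ℝ] EuclideanSpace ℝ (Fin m) →L[ℝ] ℝ)
    (F : EuclideanSpace ℝ (Fin n) → EuclideanSpace ℝ (Fin m)) (y : EuclideanSpace ℝ (Fin n)) : ℝ :=
  coTrace (formMatrix (b (F y)))⁻¹ (fun p q => meanTrace b F y p * meanTrace b F y q)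
    - coTrace (formMatrix (pullbackForm b F y))⁻¹
      (fun u v => meanTrace b F y (fderiv ℝ F y u) * meanTrace b F y (fderiv ℝ F y v))

/-- In the inverse metric, ν ⊗ ν is what remains after removing the tangential part. The right-hand
side does not involve ν, so the square of the mean curvature is continuous even if the normals are
chosen discontinuously. -/
theorem IsMetricAt.meanTrace_sq {b : EuclideanSpace ℝ (Fin (n + 1)) →
      EuclideanSpace ℝ (Fin (n + 1)) →L[ℝ] EuclideanSpace ℝ (Fin (n + 1)) →L[ℝ] ℝ}
    {F : EuclideanSpace ℝ (Fin n) → EuclideanSpace ℝ (Fin (n + 1))} {y : EuclideanSpace ℝ (Fin n)}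
    (hb : IsMetricAt b (F y)) (hi : Function.Injective (fderiv ℝ F y))
    {ν : EuclideanSpace ℝ (Fin (n + 1))} (hν : b (F y) ν ν = 1)
    (hνF : ∀ u, b (F y) ν (fderiv ℝ F y u) = 0) :
    meanTrace b F y ν ^ 2 = meanSq b F y := by
  rw [meanSq, hb.coTrace_hypersurface hi hν hνF
    (isLinearMap_mul_left (meanTrace_isLinearMap b F y))
    (isLinearMap_mul_right (meanTrace_isLinearMap b F y))]
  ring

variable {b b' : EuclideanSpace ℝ (Fin m) →
      EuclideanSpace ℝ (Fin m) →L[ℝ] EuclideanSpace ℝ (Fin m) →L[ℝ] ℝ}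
    {F F' : EuclideanSpace ℝ (Fin n) → EuclideanSpace ℝ (Fin m)}
    {φ : EuclideanSpace ℝ (Fin m) → EuclideanSpace ℝ (Fin m)}
    {ψ : EuclideanSpace ℝ (Fin n) → EuclideanSpace ℝ (Fin n)} {y : EuclideanSpace ℝ (Fin n)}

/-- The Hessian is tensorial in the target, the tangential error from reparametrizing the source is
killed by normality, and the trace is invariant under the isometry `ψ`. -/
theorem meanTrace_chart_change (hF' : F' =ᶠ[𝓝 y] φ ∘ F ∘ ψ)
    (hbb : pullbackForm b' φ =ᶠ[𝓝 (F (ψ y))] b) (hb' : IsMetricAt b' (φ (F (ψ y))))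
    (hb : IsMetricAt b (F (ψ y))) (hφ : ContDiffAt ℝ ∞ φ (F (ψ y)))
    (hF : ContDiffAt ℝ ∞ F (ψ y)) (hψ : ContDiffAt ℝ ∞ ψ y)
    (hFi : Function.Injective (fderiv ℝ F (ψ y))) (hψi : Function.Injective (fderiv ℝ ψ y))
    {ν : EuclideanSpace ℝ (Fin m)} (hν : ∀ u, b (F (ψ y)) ν (fderiv ℝ F (ψ y) u) = 0) :
    meanTrace b' F' y (fderiv ℝ φ (F (ψ y)) ν) = meanTrace b F (ψ y) ν := by
  have hc (u v : EuclideanSpace ℝ (Fin n)) : covHessian b' F' y (fderiv ℝ φ (F (ψ y)) ν) u v =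
      covHessian b F (ψ y) ν (fderiv ℝ ψ y u) (fderiv ℝ ψ y v) := by
    rw [covHessian_congr hF' EventuallyEq.rfl]
    have h1 := covHessian_comp_left (F := F ∘ ψ) (y := y) (hb'.contDiffAt 1) hb'.isInner.symm
      (hφ.nat_of_infty 2) ((hF.comp y hψ).nat_of_infty 2) ν u v
    refine h1.trans ?_
    rw [covHessian_congr (F := F ∘ ψ) (y := y) EventuallyEq.rfl hbb,
      covHessian_comp_right (hF.nat_of_infty 2) (hψ.nat_of_infty 2), hν, add_zero]
  have hp : pullbackForm b' F' y = pullbackForm (pullbackForm b F) ψ y := by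
    rw [pullbackForm_congr hF' rfl,
      pullbackForm_comp (F := F ∘ ψ) b' (hφ.differentiableAt (by simp))
        ((hF.comp y hψ).differentiableAt (by simp)),
      pullbackForm_congr (F := F ∘ ψ) (y := y) EventuallyEq.rfl hbb.eq_of_nhds,
      pullbackForm_comp b (hF.differentiableAt (by simp)) (hψ.differentiableAt (by simp))]
  have hl (a : EuclideanSpace ℝ (Fin m)) (v : EuclideanSpace ℝ (Fin n)) :
      IsLinearMap ℝ fun u => covHessian b F (ψ y) a u v :=
    ⟨fun _ _ => by simp [covHessian, lowChristoffel]; ring,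
     fun _ _ => by simp [covHessian, lowChristoffel]; ring⟩
  have hr (a : EuclideanSpace ℝ (Fin m)) (u : EuclideanSpace ℝ (Fin n)) :
      IsLinearMap ℝ fun v => covHessian b F (ψ y) a u v :=
    ⟨fun _ _ => by simp [covHessian, lowChristoffel]; ring,
     fun _ _ => by simp [covHessian, lowChristoffel]; ring⟩
  rw [meanTrace, meanTrace, (hb.pullbackForm hF hFi).coTrace_isometry hψi (hl ν) (hr ν), hp]
  congr 1
  ext u v
  exact hc u v

theorem continuousAt_covHessian (hb : IsMetricAt b (F y)) (hF : ContDiffAt ℝ ∞ F y)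
    {a : EuclideanSpace ℝ (Fin n) → EuclideanSpace ℝ (Fin m)} (ha : ContinuousAt a y)
    (u v : EuclideanSpace ℝ (Fin n)) :
    ContinuousAt (fun z => covHessian b F z (a z) u v) y := by
  have hF1 : ContinuousAt (fderiv ℝ F) y := (hF.fderiv_right (m := 0) (by simp)).continuousAt
  have hF2 : ContinuousAt (fderiv ℝ (fderiv ℝ F)) y :=
    ((hF.fderiv_right (m := ∞) (by simp)).fderiv_right (m := 0) (by simp)).continuousAt
  have hb0 : ContinuousAt (fun z => b (F z)) y :=
    ContinuousAt.comp (g := b) hb.smooth.continuousAt hF.continuousAt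
  have hb1 : ContinuousAt (fun z => fderiv ℝ b (F z)) y :=
    ContinuousAt.comp (g := fderiv ℝ b)
      (hb.smooth.fderiv_right (m := 0) (by simp)).continuousAt hF.continuousAt
  have hFu (u : EuclideanSpace ℝ (Fin n)) : ContinuousAt (fun z => fderiv ℝ F z u) y :=
    hF1.clm_apply continuousAt_const
  have hFuv : ContinuousAt (fun z => fderiv ℝ (fderiv ℝ F) z u v) y :=
    (hF2.clm_apply continuousAt_const).clm_apply continuousAt_const
  refine ((hb0.clm_apply ha).clm_apply hFuv).add (continuousAt_const.mul ?_)
  exact ((((hb1.clm_apply (hFu u)).clm_apply (hFu v)).clm_apply ha).add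
    (((hb1.clm_apply (hFu v)).clm_apply (hFu u)).clm_apply ha)).sub
    (((hb1.clm_apply ha).clm_apply (hFu u)).clm_apply (hFu v))

theorem continuousAt_coTrace {A : EuclideanSpace ℝ (Fin n) → Matrix (Fin m) (Fin m) ℝ}
    (hA : ∀ i j, ContinuousAt (fun z => A z i j) y)
    {Q : EuclideanSpace ℝ (Fin n) → EuclideanSpace ℝ (Fin m) → EuclideanSpace ℝ (Fin m) → ℝ}
    (hQ : ∀ u v, ContinuousAt (fun z => Q z u v) y) :
    ContinuousAt (fun z => coTrace (A z) (Q z)) y :=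
  tendsto_finsetSum _ fun i _ => tendsto_finsetSum _ fun j _ => (hA i j).mul (hQ _ _)

theorem continuousAt_meanTrace (hb : IsMetricAt b (F y)) (hF : ContDiffAt ℝ ∞ F y)
    (hi : Function.Injective (fderiv ℝ F y))
    {a : EuclideanSpace ℝ (Fin n) → EuclideanSpace ℝ (Fin m)} (ha : ContinuousAt a y) :
    ContinuousAt (fun z => meanTrace b F z (a z)) y :=
  continuousAt_coTrace (fun i j => ((hb.pullbackForm hF hi).contDiffAt_inv i j).continuousAt)
    fun u v => continuousAt_covHessian hb hF ha u v

theorem continuousAt_meanSq (hb : IsMetricAt b (F y)) (hF : ContDiffAt ℝ ∞ F y)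
    (hi : Function.Injective (fderiv ℝ F y)) : ContinuousAt (meanSq b F) y := by
  have hF1 : ContinuousAt (fderiv ℝ F) y := (hF.fderiv_right (m := 0) (by simp)).continuousAt
  refine (continuousAt_coTrace (fun i j => ?_) fun u v => ?_).sub
    (continuousAt_coTrace (fun i j => ((hb.pullbackForm hF hi).contDiffAt_inv i j).continuousAt)
      fun u v => ?_)
  · exact ContinuousAt.comp (g := fun z => (formMatrix (b z))⁻¹ i j)
      (hb.contDiffAt_inv i j).continuousAt hF.continuousAt
  · exact (continuousAt_meanTrace hb hF hi continuousAt_const).mul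
      (continuousAt_meanTrace hb hF hi continuousAt_const)
  · exact (continuousAt_meanTrace hb hF hi (hF1.clm_apply continuousAt_const)).mul
      (continuousAt_meanTrace hb hF hi (hF1.clm_apply continuousAt_const))

end MeanCurvature

/-! ### Locality of curvature, and bilinear forms built from matrices -/

section Germs

open Filter Topology

variable {n : ℕ}

theorem partialDeriv_eventuallyEq {f g : EuclideanSpace ℝ (Fin n) → ℝ}
    {y : EuclideanSpace ℝ (Fin n)} (h : f =ᶠ[𝓝 y] g) (i : Fin n) :
    partialDeriv i f =ᶠ[𝓝 y] partialDeriv i g := by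
  filter_upwards [h.eventually_nhds] with z hz
  simp only [partialDeriv]
  rw [Filter.EventuallyEq.fderiv_eq hz]

theorem christoffel_eventuallyEq {G G' : EuclideanSpace ℝ (Fin n) → Matrix (Fin n) (Fin n) ℝ}
    {y : EuclideanSpace ℝ (Fin n)} (h : G =ᶠ[𝓝 y] G') (k i j : Fin n) :
    christoffel G k i j =ᶠ[𝓝 y] christoffel G' k i j := by
  filter_upwards [h.eventually_nhds] with z hz
  have hz' : G =ᶠ[𝓝 z] G' := hz
  have hp (i j l : Fin n) : partialDeriv l (fun z => G z i j) z =
      partialDeriv l (fun z => G' z i j) z :=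
    (partialDeriv_eventuallyEq (hz'.mono fun w hw => by simp only [hw]) l).eq_of_nhds
  simp only [christoffel, hp, hz'.eq_of_nhds]

theorem coordScalarCurvature_congr
    {G G' : EuclideanSpace ℝ (Fin n) → Matrix (Fin n) (Fin n) ℝ}
    {y : EuclideanSpace ℝ (Fin n)} (h : G =ᶠ[𝓝 y] G') :
    coordScalarCurvature G y = coordScalarCurvature G' y := by
  have h1 (k i j l : Fin n) : partialDeriv l (christoffel G k i j) y =
      partialDeriv l (christoffel G' k i j) y :=
    (partialDeriv_eventuallyEq (christoffel_eventuallyEq h k i j) l).eq_of_nhds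
  have h2 (k i j : Fin n) : christoffel G k i j y = christoffel G' k i j y :=
    (christoffel_eventuallyEq h k i j).eq_of_nhds
  simp only [coordScalarCurvature, ricci, riemannUp, h1, h2, h.eq_of_nhds]

/-- The bilinear form with a given matrix. -/
noncomputable def matrixForm (A : Matrix (Fin n) (Fin n) ℝ) :
    EuclideanSpace ℝ (Fin n) →L[ℝ] EuclideanSpace ℝ (Fin n) →L[ℝ] ℝ :=
  ∑ i, ∑ j, A i j • (EuclideanSpace.proj (𝕜 := ℝ) i).smulRight (EuclideanSpace.proj (𝕜 := ℝ) j)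

theorem matrixForm_apply (A : Matrix (Fin n) (Fin n) ℝ) (u v : EuclideanSpace ℝ (Fin n)) :
    matrixForm A u v = ∑ i, ∑ j, u i * v j * A i j := by
  simp only [matrixForm, _root_.sum_apply, _root_.smul_apply, ContinuousLinearMap.smulRight_apply,
    smul_eq_mul, PiLp.proj_apply]
  exact Finset.sum_congr rfl fun i _ => Finset.sum_congr rfl fun j _ => by ring

@[simp] theorem formMatrix_matrixForm (A : Matrix (Fin n) (Fin n) ℝ) :
    formMatrix (matrixForm A) = A := by
  ext i j
  simp [matrixForm_apply]

theorem matrixForm_eq_of_formMatrix {A : Matrix (Fin n) (Fin n) ℝ}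
    {B : EuclideanSpace ℝ (Fin n) →L[ℝ] EuclideanSpace ℝ (Fin n) →L[ℝ] ℝ}
    (h : A = formMatrix B) : matrixForm A = B := by
  ext u v
  rw [matrixForm_apply, form_apply_eq_sum, h]

theorem contDiffAt_matrixForm {G : EuclideanSpace ℝ (Fin n) → Matrix (Fin n) (Fin n) ℝ}
    {y : EuclideanSpace ℝ (Fin n)} {k : ℕ∞ω} (h : ∀ i j, ContDiffAt ℝ k (fun z => G z i j) y) :
    ContDiffAt ℝ k (fun z => matrixForm (G z)) y :=
  ContDiffAt.sum fun i _ => ContDiffAt.sum fun j _ => (h i j).smul contDiffAt_const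

end Germs

/-! ### Maps and fields of bilinear forms in charts -/

section Charts

open Filter Topology

variable {n m : ℕ} {N : Type*} [TopologicalSpace N] [ChartedSpace (EuclideanSpace ℝ (Fin n)) N]
  [IsManifold (𝓡 n) ∞ N] {N' : Type*} [TopologicalSpace N']
  [ChartedSpace (EuclideanSpace ℝ (Fin m)) N'] [IsManifold (𝓡 m) ∞ N']

theorem mdifferentiable_of_mem_maximalAtlas
    {e : OpenPartialHomeomorph N (EuclideanSpace ℝ (Fin n))}
    (he : e ∈ IsManifold.maximalAtlas (𝓡 n) ∞ N) : e.MDifferentiable (𝓡 n) (𝓡 n) :=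
  ⟨(contMDiffOn_of_mem_maximalAtlas he).mdifferentiableOn (by simp),
    (contMDiffOn_symm_of_mem_maximalAtlas he).mdifferentiableOn (by simp)⟩

/-- The expression of `F` in the charts `e` and `c`. -/
def coordMap (e : OpenPartialHomeomorph N (EuclideanSpace ℝ (Fin n)))
    (c : OpenPartialHomeomorph N' (EuclideanSpace ℝ (Fin m))) (F : N → N')
    (u : EuclideanSpace ℝ (Fin n)) : EuclideanSpace ℝ (Fin m) :=
  c (F (e.symm u))

variable {e : OpenPartialHomeomorph N (EuclideanSpace ℝ (Fin n))}
    {c : OpenPartialHomeomorph N' (EuclideanSpace ℝ (Fin m))} {F : N → N'}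
    {y : EuclideanSpace ℝ (Fin n)}

theorem contDiffAt_coordMap (he : e ∈ IsManifold.maximalAtlas (𝓡 n) ∞ N)
    (hc : c ∈ IsManifold.maximalAtlas (𝓡 m) ∞ N') (hF : ContMDiff (𝓡 n) (𝓡 m) ∞ F)
    (hy : y ∈ e.target) (hFy : F (e.symm y) ∈ c.source) : ContDiffAt ℝ ∞ (coordMap e c F) y := by
  rw [← contMDiffAt_iff_contDiffAt]
  have h1 := contMDiffAt_symm_of_mem_maximalAtlas he hy
  have h2 := contMDiffAt_of_mem_maximalAtlas hc hFy
  exact h2.comp y ((hF (e.symm y)).comp y h1)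

theorem eventually_mem_source (hF : Continuous F) (hy : y ∈ e.target)
    (hFy : F (e.symm y) ∈ c.source) :
    ∀ᶠ z in 𝓝 y, z ∈ e.target ∧ F (e.symm z) ∈ c.source := by
  have h1 : ContinuousAt (fun z => F (e.symm z)) y :=
    hF.continuousAt.comp (e.continuousAt_symm hy)
  have h2 : ∀ᶠ z in 𝓝 y, z ∈ e.target := e.open_target.mem_nhds hy
  exact h2.and (h1.eventually (c.open_source.mem_nhds hFy))

theorem symm_coordMap (hFy : F (e.symm y) ∈ c.source) :
    c.symm (coordMap e c F y) = F (e.symm y) := c.left_inv hFy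

/-- The chain rule relating `F` and its coordinate expression. -/
theorem mfderiv_symm_fderiv_coordMap (he : e ∈ IsManifold.maximalAtlas (𝓡 n) ∞ N)
    (hc : c ∈ IsManifold.maximalAtlas (𝓡 m) ∞ N') (hF : ContMDiff (𝓡 n) (𝓡 m) ∞ F)
    (hy : y ∈ e.target) (hFy : F (e.symm y) ∈ c.source) (u : EuclideanSpace ℝ (Fin n)) :
    @Eq (EuclideanSpace ℝ (Fin m))
      (mfderiv (𝓡 m) (𝓡 m) c.symm (coordMap e c F y) (fderiv ℝ (coordMap e c F) y u))
      (mfderiv (𝓡 n) (𝓡 m) F (e.symm y) (mfderiv (𝓡 n) (𝓡 n) e.symm y u)) := by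
  have he' := mdifferentiable_of_mem_maximalAtlas he
  have hc' := mdifferentiable_of_mem_maximalAtlas hc
  have h1 : MDifferentiableAt (𝓡 n) (𝓡 n) e.symm y := he'.mdifferentiableAt_symm hy
  have h2 : MDifferentiableAt (𝓡 n) (𝓡 m) F (e.symm y) := (hF _).mdifferentiableAt (by simp)
  have h3 : MDifferentiableAt (𝓡 m) (𝓡 m) c.symm (coordMap e c F y) :=
    hc'.mdifferentiableAt_symm (c.map_source hFy)
  have h4 : MDifferentiableAt (𝓡 n) (𝓡 m) (coordMap e c F) y :=
    mdifferentiableAt_iff_differentiableAt.2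
      ((contDiffAt_coordMap he hc hF hy hFy).differentiableAt (by simp))
  have hev : c.symm ∘ coordMap e c F =ᶠ[𝓝 y] F ∘ e.symm := by
    filter_upwards [eventually_mem_source hF.continuous hy hFy] with z hz
    exact symm_coordMap hz.2
  have h5 := hev.mfderiv_eq (I := 𝓡 n) (I' := 𝓡 m)
  rw [mfderiv_comp y h3 h4, mfderiv_comp y h2 h1, mfderiv_eq_fderiv] at h5
  exact DFunLike.congr_fun h5 u

theorem injective_fderiv_coordMap (he : e ∈ IsManifold.maximalAtlas (𝓡 n) ∞ N)
    (hc : c ∈ IsManifold.maximalAtlas (𝓡 m) ∞ N') (hF : ContMDiff (𝓡 n) (𝓡 m) ∞ F)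
    (hy : y ∈ e.target) (hFy : F (e.symm y) ∈ c.source)
    (hi : Function.Injective (mfderiv (𝓡 n) (𝓡 m) F (e.symm y))) :
    Function.Injective (fderiv ℝ (coordMap e c F) y) := by
  intro u v huv
  have h1 := mfderiv_symm_fderiv_coordMap he hc hF hy hFy u
  rw [huv, mfderiv_symm_fderiv_coordMap he hc hF hy hFy v] at h1
  exact (mdifferentiable_of_mem_maximalAtlas he).symm.mfderiv_injective hy (hi h1.symm)

/-- In the charts of the immersion normal form the map is u ↦ (u, 0) followed by a linear
equivalence. Its derivative is injective, and chart derivatives are bijective. -/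
theorem Manifold.IsImmersionAt.mfderiv_injective {F : N → N'} {x : N}
    (h : Manifold.IsImmersionAt (𝓡 n) (𝓡 m) ∞ F x) (hF : ContMDiff (𝓡 n) (𝓡 m) ∞ F) :
    Function.Injective (mfderiv (𝓡 n) (𝓡 m) F x) := by
  have he := h.domChart_mem_maximalAtlas
  have hc := h.codChart_mem_maximalAtlas
  have hx := h.mem_domChart_source
  have hy : h.domChart x ∈ h.domChart.target := h.domChart.map_source hx
  have hxe : h.domChart.symm (h.domChart x) = x := h.domChart.left_inv hx
  have hFy : F (h.domChart.symm (h.domChart x)) ∈ h.codChart.source := by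
    rw [hxe]; exact h.mem_codChart_source
  have hw : coordMap h.domChart h.codChart F =ᶠ[𝓝 (h.domChart x)] fun u => h.equiv (u, 0) := by
    filter_upwards [h.domChart.open_target.mem_nhds hy] with z hz
    exact h.writtenInCharts (show z ∈ (h.domChart.extend (𝓡 n)).target by simpa using hz)
  have hd : HasFDerivAt (fun u => h.equiv (u, 0))
      ((h.equiv : (EuclideanSpace ℝ (Fin n) × h.complement) →L[ℝ] EuclideanSpace ℝ (Fin m)).comp
        (ContinuousLinearMap.inl ℝ (EuclideanSpace ℝ (Fin n)) h.complement)) (h.domChart x) :=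
    ((h.equiv : (EuclideanSpace ℝ (Fin n) × h.complement) →L[ℝ] EuclideanSpace ℝ (Fin m)).comp
      (ContinuousLinearMap.inl ℝ (EuclideanSpace ℝ (Fin n)) h.complement)).hasFDerivAt
  have hinj : Function.Injective (fderiv ℝ (coordMap h.domChart h.codChart F) (h.domChart x)) := by
    rw [hw.fderiv_eq, hd.fderiv]
    intro u v huv
    have : h.equiv (u, 0) = h.equiv (v, 0) := huv
    exact (Prod.ext_iff.1 (h.equiv.injective this)).1
  -- The point `h.domChart.symm (h.domChart x)` equals `x` only propositionally, and the type of the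
  -- derivative depends on it. Injectivity is proved at the former point and then transported.
  suffices hs : Function.Injective (mfderiv (𝓡 n) (𝓡 m) F (h.domChart.symm (h.domChart x))) by
    have key : ∀ p, p = x → Function.Injective (mfderiv (𝓡 n) (𝓡 m) F p) →
        Function.Injective (mfderiv (𝓡 n) (𝓡 m) F x) := by
      rintro p rfl hp; exact hp
    exact key _ hxe hs
  intro v w hvw
  obtain ⟨v', rfl⟩ := (mdifferentiable_of_mem_maximalAtlas he).symm.mfderiv_surjective hy v
  obtain ⟨w', rfl⟩ := (mdifferentiable_of_mem_maximalAtlas he).symm.mfderiv_surjective hy w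
  have h1 := mfderiv_symm_fderiv_coordMap he hc hF hy hFy v'
  rw [hvw, ← mfderiv_symm_fderiv_coordMap he hc hF hy hFy w'] at h1
  rw [hinj ((mdifferentiable_of_mem_maximalAtlas hc).symm.mfderiv_injective
    (h.codChart.map_source hFy) h1)]

/-- A field of bilinear forms. -/
structure IsBilinearField (β : ∀ x : N, TangentSpace (𝓡 n) x → TangentSpace (𝓡 n) x → ℝ) :
    Prop where
  left : ∀ x w, IsLinearMap ℝ fun v => β x v w
  right : ∀ x v, IsLinearMap ℝ (β x v)

/-- The form `β` in the chart `e`. -/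
noncomputable def chartForm (β : ∀ x : N, TangentSpace (𝓡 n) x → TangentSpace (𝓡 n) x → ℝ)
    (e : OpenPartialHomeomorph N (EuclideanSpace ℝ (Fin n))) (y : EuclideanSpace ℝ (Fin n)) :
    EuclideanSpace ℝ (Fin n) →L[ℝ] EuclideanSpace ℝ (Fin n) →L[ℝ] ℝ :=
  matrixForm (coordMatrix β e y)

@[simp] theorem formMatrix_chartForm
    (β : ∀ x : N, TangentSpace (𝓡 n) x → TangentSpace (𝓡 n) x → ℝ)
    (e : OpenPartialHomeomorph N (EuclideanSpace ℝ (Fin n))) (y : EuclideanSpace ℝ (Fin n)) :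
    formMatrix (chartForm β e y) = coordMatrix β e y := formMatrix_matrixForm _

theorem IsBilinearField.chartForm_apply
    {β : ∀ x : N, TangentSpace (𝓡 n) x → TangentSpace (𝓡 n) x → ℝ} (hβ : IsBilinearField β)
    (e : OpenPartialHomeomorph N (EuclideanSpace ℝ (Fin n))) (y u v : EuclideanSpace ℝ (Fin n)) :
    chartForm β e y u v = β (e.symm y) (mfderiv (𝓡 n) (𝓡 n) e.symm y u)
      (mfderiv (𝓡 n) (𝓡 n) e.symm y v) := by
  rw [chartForm, matrixForm_apply]
  refine (bilinear_eq_sum (Q := fun u v => β (e.symm y) (mfderiv (𝓡 n) (𝓡 n) e.symm y u)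
      (mfderiv (𝓡 n) (𝓡 n) e.symm y v)) (fun v => ⟨fun a b => ?_, fun c a => ?_⟩)
      (fun u => ⟨fun a b => ?_, fun c a => ?_⟩) u v).symm
  · exact (congrArg (fun w => β (e.symm y) w _) (map_add _ a b)).trans ((hβ.left _ _).map_add _ _)
  · exact (congrArg (fun w => β (e.symm y) w _) (map_smul _ c a)).trans ((hβ.left _ _).map_smul _ _)
  · exact (congrArg (fun w => β (e.symm y) _ w) (map_add _ a b)).trans ((hβ.right _ _).map_add _ _)
  · exact (congrArg (fun w => β (e.symm y) _ w) (map_smul _ c a)).trans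
      ((hβ.right _ _).map_smul _ _)

/-- Vectors at `p` and at `q` can be compared because every tangent space is by definition the model
space. -/
theorem form_congr_point (β : ∀ x : N, TangentSpace (𝓡 n) x → TangentSpace (𝓡 n) x → ℝ) {p q : N}
    (h : p = q) {v v' w w' : EuclideanSpace ℝ (Fin n)} (hv : v = v') (hw : w = w') :
    β p v w = β q v' w' := by
  subst h hv hw; rfl

/-- The pullback of a form, in charts. -/
theorem IsBilinearField.coordMatrix_pullback
    {β : ∀ x : N', TangentSpace (𝓡 m) x → TangentSpace (𝓡 m) x → ℝ} (hβ : IsBilinearField β)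
    (he : e ∈ IsManifold.maximalAtlas (𝓡 n) ∞ N)
    (hc : c ∈ IsManifold.maximalAtlas (𝓡 m) ∞ N') (hF : ContMDiff (𝓡 n) (𝓡 m) ∞ F)
    (hy : y ∈ e.target) (hFy : F (e.symm y) ∈ c.source) :
    coordMatrix (fun p v w => β (F p) (mfderiv (𝓡 n) (𝓡 m) F p v) (mfderiv (𝓡 n) (𝓡 m) F p w))
      e y = formMatrix (pullbackForm (chartForm β c) (coordMap e c F) y) := by
  ext i j
  rw [formMatrix_apply, pullbackForm_apply, hβ.chartForm_apply]
  exact form_congr_point β (symm_coordMap hFy).symm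
    (mfderiv_symm_fderiv_coordMap he hc hF hy hFy _).symm
    (mfderiv_symm_fderiv_coordMap he hc hF hy hFy _).symm

/-- A form in two charts. -/
theorem IsBilinearField.coordMatrix_chart_change
    {β : ∀ x : N, TangentSpace (𝓡 n) x → TangentSpace (𝓡 n) x → ℝ} (hβ : IsBilinearField β)
    {e c : OpenPartialHomeomorph N (EuclideanSpace ℝ (Fin n))}
    (he : e ∈ IsManifold.maximalAtlas (𝓡 n) ∞ N)
    (hc : c ∈ IsManifold.maximalAtlas (𝓡 n) ∞ N)
    (hy : y ∈ e.target) (hFy : e.symm y ∈ c.source) :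
    coordMatrix β e y = formMatrix (pullbackForm (chartForm β c) (coordMap e c id) y) := by
  rw [← hβ.coordMatrix_pullback he hc contMDiff_id hy hFy]
  ext i j
  simp [coordMatrix]

end Charts

/-! ### Metrics, scalar curvature and extrinsic curvature in charts -/

section Geometry

open Filter Topology

variable {n m : ℕ} {N : Type*} [TopologicalSpace N] [ChartedSpace (EuclideanSpace ℝ (Fin n)) N]
  [IsManifold (𝓡 n) ∞ N]

theorem SmoothMetric.isBilinearField (g : SmoothMetric n N) : IsBilinearField g.form where
  left x w := ⟨fun u v => by simp [SmoothMetric.form], fun c v => by simp [SmoothMetric.form]⟩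
  right x v := ⟨fun u v => by simp [SmoothMetric.form], fun c v => by simp [SmoothMetric.form]⟩

theorem SmoothMetric.isInner_chartForm (g : SmoothMetric n N)
    {c : OpenPartialHomeomorph N (EuclideanSpace ℝ (Fin n))}
    (hc : c ∈ IsManifold.maximalAtlas (𝓡 n) ∞ N) {y : EuclideanSpace ℝ (Fin n)}
    (hy : y ∈ c.target) : IsInner (chartForm g.form c y) := by
  constructor
  · intro u v
    rw [g.isBilinearField.chartForm_apply, g.isBilinearField.chartForm_apply]
    exact g.symm _ _ _
  · intro u hu
    rw [g.isBilinearField.chartForm_apply]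
    refine g.pos _ _ fun h0 => hu ?_
    exact (mdifferentiable_of_mem_maximalAtlas hc).symm.mfderiv_injective hy
      (h0.trans (map_zero _).symm)

theorem IsRG2Flow.isMetricAt {α : ℝ} {J : Set ℝ} {h : ℝ → SmoothMetric n N}
    (hflow : IsRG2Flow α J h) {t : ℝ} (ht : t ∈ J)
    {c : OpenPartialHomeomorph N (EuclideanSpace ℝ (Fin n))}
    (hc : c ∈ IsManifold.maximalAtlas (𝓡 n) ∞ N) {y : EuclideanSpace ℝ (Fin n)}
    (hy : y ∈ c.target) : IsMetricAt (chartForm (h t).form c) y where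
  smooth := by
    refine contDiffAt_matrixForm fun i j => ?_
    have h1 : ContDiffOn ℝ ∞ (fun z => coordMatrix (h t).form c z i j) c.target :=
      (hflow.smooth c hc i j).comp (f := fun z => (t, z)) (by fun_prop) fun z hz => ⟨ht, hz⟩
    exact h1.contDiffAt (c.open_target.mem_nhds hy)
  inner := by
    filter_upwards [c.open_target.mem_nhds hy] with z hz
    exact (h t).isInner_chartForm hc hz

theorem mfderiv_symm_mfderiv {c : OpenPartialHomeomorph N (EuclideanSpace ℝ (Fin n))}
    (hc : c ∈ IsManifold.maximalAtlas (𝓡 n) ∞ N) {x : N} (hx : x ∈ c.source)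
    (v : TangentSpace (𝓡 n) x) :
    @Eq (EuclideanSpace ℝ (Fin n))
      (mfderiv (𝓡 n) (𝓡 n) c.symm (c x) (mfderiv (𝓡 n) (𝓡 n) c x v)) v :=
  DFunLike.congr_fun ((mdifferentiable_of_mem_maximalAtlas hc).symm_comp_deriv hx) v

theorem chartForm_mfderiv {β : ∀ x : N, TangentSpace (𝓡 n) x → TangentSpace (𝓡 n) x → ℝ}
    (hβ : IsBilinearField β) {c : OpenPartialHomeomorph N (EuclideanSpace ℝ (Fin n))}
    (hc : c ∈ IsManifold.maximalAtlas (𝓡 n) ∞ N) {x : N} (hx : x ∈ c.source)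
    (v : TangentSpace (𝓡 n) x) {w : EuclideanSpace ℝ (Fin n)} {w' : TangentSpace (𝓡 n) x}
    (hw : @Eq (EuclideanSpace ℝ (Fin n)) (mfderiv (𝓡 n) (𝓡 n) c.symm (c x) w) w') :
    chartForm β c (c x) (mfderiv (𝓡 n) (𝓡 n) c x v) w = β x v w' := by
  refine (hβ.chartForm_apply c (c x) (mfderiv (𝓡 n) (𝓡 n) c x v) w).trans ?_
  exact form_congr_point β (c.left_inv hx) (mfderiv_symm_mfderiv hc hx v) hw

/-- Scalar curvature can be computed in any chart. -/
theorem scalarCurvature_eq_coordScalarCurvature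
    {β : ∀ x : N, TangentSpace (𝓡 n) x → TangentSpace (𝓡 n) x → ℝ} (hβ : IsBilinearField β)
    {e : OpenPartialHomeomorph N (EuclideanSpace ℝ (Fin n))}
    (he : e ∈ IsManifold.maximalAtlas (𝓡 n) ∞ N) {y : EuclideanSpace ℝ (Fin n)}
    (hy : y ∈ e.target)
    (hm : IsMetricAt (chartForm β (chartAt _ (e.symm y))) (chartAt _ (e.symm y) (e.symm y))) :
    scalarCurvature β (e.symm y) = coordScalarCurvature (coordMatrix β e) y := by
  set c := chartAt (EuclideanSpace ℝ (Fin n)) (e.symm y) with hcdef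
  have hc : c ∈ IsManifold.maximalAtlas (𝓡 n) ∞ N := IsManifold.chart_mem_maximalAtlas _
  have hyc : id (e.symm y) ∈ c.source := mem_chart_source _ _
  have hid : ContMDiff (𝓡 n) (𝓡 n) ∞ (id : N → N) := contMDiff_id
  have hev : coordMatrix β e =ᶠ[𝓝 y]
      fun z => formMatrix (pullbackForm (chartForm β c) (coordMap e c id) z) := by
    filter_upwards [eventually_mem_source continuous_id hy hyc] with z hz
    exact hβ.coordMatrix_chart_change he hc hz.1 hz.2
  rw [coordScalarCurvature_congr hev]
  have hi := injective_fderiv_coordMap he hc hid hy hyc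
    (by rw [mfderiv_id]; exact Function.injective_id)
  rw [IsMetricAt.coordScalarCurvature_pullbackForm hm (contDiffAt_coordMap he hc hid hy hyc) hi]
  simp only [formMatrix_chartForm]
  rfl

/-- The Jacobian factor does not involve `b`. Along the flow it is therefore constant in time, and a
differential inequality for the density passes from one chart to another. -/
theorem sqrt_det_pullbackForm (b : EuclideanSpace ℝ (Fin n) →
      EuclideanSpace ℝ (Fin n) →L[ℝ] EuclideanSpace ℝ (Fin n) →L[ℝ] ℝ)
    (ψ : EuclideanSpace ℝ (Fin n) → EuclideanSpace ℝ (Fin n)) (y : EuclideanSpace ℝ (Fin n)) :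
    √(formMatrix (pullbackForm b ψ y)).det =
      |(Matrix.of fun a i => fderiv ℝ ψ y (EuclideanSpace.single i 1) a : Matrix _ _ ℝ).det| *
        √(formMatrix (b (ψ y))).det := by
  set P : Matrix (Fin n) (Fin n) ℝ :=
    Matrix.of fun a i => fderiv ℝ ψ y (EuclideanSpace.single i 1) a with hP
  have hG : formMatrix (pullbackForm b ψ y) = P.transpose * formMatrix (b (ψ y)) * P := by
    ext i j
    rw [formMatrix_apply, pullbackForm_apply, form_apply_eq_sum, Matrix.mul_apply]
    simp only [Matrix.mul_apply, Finset.sum_mul, hP, Matrix.transpose_apply, Matrix.of_apply]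
    rw [Finset.sum_comm]
    exact Finset.sum_congr rfl fun b _ => Finset.sum_congr rfl fun a _ => by ring
  rw [hG, Matrix.det_mul, Matrix.det_mul, Matrix.det_transpose,
    show P.det * (formMatrix (b (ψ y))).det * P.det = P.det ^ 2 * (formMatrix (b (ψ y))).det by ring,
    Real.sqrt_mul (sq_nonneg _), Real.sqrt_sq_eq_abs]

variable {M : Type*} [TopologicalSpace M] [ChartedSpace (EuclideanSpace ℝ (Fin 3)) M]
  [IsManifold (𝓡 3) ∞ M]
  {S : Type*} [TopologicalSpace S] [ChartedSpace (EuclideanSpace ℝ (Fin 2)) S]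
  [IsManifold (𝓡 2) ∞ S] {F : S → M}

theorem isBilinearField_inducedMetric (g : SmoothMetric 3 M) (F : S → M) :
    IsBilinearField (inducedMetric g F) where
  left x w := ⟨fun u v => by simp [inducedMetric, SmoothMetric.form],
    fun c v => by simp [inducedMetric, SmoothMetric.form]⟩
  right x v := ⟨fun u v => by simp [inducedMetric, SmoothMetric.form],
    fun c v => by simp [inducedMetric, SmoothMetric.form]⟩

variable {e : OpenPartialHomeomorph S (EuclideanSpace ℝ (Fin 2))}
  {c : OpenPartialHomeomorph M (EuclideanSpace ℝ (Fin 3))} {y : EuclideanSpace ℝ (Fin 2)}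

theorem coordMatrix_inducedMetric (g : SmoothMetric 3 M)
    (he : e ∈ IsManifold.maximalAtlas (𝓡 2) ∞ S) (hc : c ∈ IsManifold.maximalAtlas (𝓡 3) ∞ M)
    (hF : ContMDiff (𝓡 2) (𝓡 3) ∞ F) (hy : y ∈ e.target) (hFy : F (e.symm y) ∈ c.source) :
    coordMatrix (inducedMetric g F) e y =
      formMatrix (pullbackForm (chartForm g.form c) (coordMap e c F) y) :=
  g.isBilinearField.coordMatrix_pullback he hc hF hy hFy

theorem IsMetricAt.congr {b b' : EuclideanSpace ℝ (Fin n) →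
      EuclideanSpace ℝ (Fin n) →L[ℝ] EuclideanSpace ℝ (Fin n) →L[ℝ] ℝ}
    {y : EuclideanSpace ℝ (Fin n)} (hb : IsMetricAt b y) (h : b' =ᶠ[𝓝 y] b) : IsMetricAt b' y where
  smooth := hb.smooth.congr_of_eventuallyEq h
  inner := by
    filter_upwards [hb.inner, h] with z h1 h2
    rwa [h2]

theorem IsMetricAt.inducedMetric {g : SmoothMetric 3 M}
    (he : e ∈ IsManifold.maximalAtlas (𝓡 2) ∞ S) (hc : c ∈ IsManifold.maximalAtlas (𝓡 3) ∞ M)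
    (hF : ContMDiff (𝓡 2) (𝓡 3) ∞ F) (hFi : ∀ p, Function.Injective (mfderiv (𝓡 2) (𝓡 3) F p))
    (hy : y ∈ e.target) (hFy : F (e.symm y) ∈ c.source)
    (hm : IsMetricAt (chartForm g.form c) (coordMap e c F y)) :
    IsMetricAt (chartForm (inducedMetric g F) e) y := by
  refine (hm.pullbackForm (contDiffAt_coordMap he hc hF hy hFy)
    (injective_fderiv_coordMap he hc hF hy hFy (hFi _))).congr ?_
  filter_upwards [eventually_mem_source hF.continuous hy hFy] with z hz
  exact matrixForm_eq_of_formMatrix (coordMatrix_inducedMetric g he hc hF hz.1 hz.2)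

theorem fderiv_apply_apply {k : ℕ} {f : EuclideanSpace ℝ (Fin n) → EuclideanSpace ℝ (Fin k)}
    {z : EuclideanSpace ℝ (Fin n)} (hf : DifferentiableAt ℝ f z) (b : Fin k)
    (u : EuclideanSpace ℝ (Fin n)) : fderiv ℝ (fun z => f z b) z u = fderiv ℝ f z u b := by
  have := ((EuclideanSpace.proj (𝕜 := ℝ) b).hasFDerivAt.comp z hf.hasFDerivAt).fderiv
  exact DFunLike.congr_fun this u

theorem localMap_self (F : S → M) (p : S) :
    localMap F p (chartAt (EuclideanSpace ℝ (Fin 2)) p p) =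
      chartAt (EuclideanSpace ℝ (Fin 3)) (F p) (F p) := by
  rw [localMap, (chartAt _ p).left_inv (mem_chart_source _ p)]

theorem lowChristoffel_eq_sum {b : EuclideanSpace ℝ (Fin n) →
      EuclideanSpace ℝ (Fin n) →L[ℝ] EuclideanSpace ℝ (Fin n) →L[ℝ] ℝ}
    (y w u v : EuclideanSpace ℝ (Fin n)) :
    lowChristoffel b y w u v = ∑ a, ∑ k, ∑ l, w a * (u k * v l *
      lowChristoffel b y (EuclideanSpace.single a 1) (EuclideanSpace.single k 1)
        (EuclideanSpace.single l 1)) := by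
  have h1 : lowChristoffel b y w u v =
      ∑ a, w a * lowChristoffel b y (EuclideanSpace.single a 1) u v := by
    conv_lhs => rw [← euclidean_sum_single w]
    have := map_sum (lowChristoffel_isLinearMap b y u v).mk'
      (fun a => w a • EuclideanSpace.single a (1 : ℝ)) Finset.univ
    simp only [IsLinearMap.mk'_apply] at this
    rw [this]
    exact Finset.sum_congr rfl fun a _ => (lowChristoffel_isLinearMap b y u v).map_smul _ _
  rw [h1]
  refine Finset.sum_congr rfl fun a _ => ?_
  rw [bilinear_eq_sum (Q := fun u v => lowChristoffel b y (EuclideanSpace.single a 1) u v)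
    (fun v => ⟨fun _ _ => by simp [lowChristoffel]; ring, fun _ _ => by
      simp [lowChristoffel]; ring⟩) (fun v => ⟨fun _ _ => by simp [lowChristoffel]; ring,
      fun _ _ => by simp [lowChristoffel]; ring⟩), Finset.mul_sum]
  exact Finset.sum_congr rfl fun k _ => Finset.mul_sum _ _ _

/-- Contracting with ν lowers the index of Γ, and second partial derivatives of components are
components of D²F. The minus sign comes from the convention K_{ij} = -⟨ν, ∇_i ∂_j F⟩. -/
theorem extrinsicCurvature_eq_covHessian {g : SmoothMetric 3 M} (hF : ContMDiff (𝓡 2) (𝓡 3) ∞ F)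
    (p : S) (ν : TangentSpace (𝓡 3) (F p))
    (hm : IsMetricAt (chartForm g.form (chartAt _ (F p))) (chartAt _ (F p) (F p))) (i j : Fin 2) :
    extrinsicCurvature g F p ν i j =
      -covHessian (chartForm g.form (chartAt _ (F p))) (localMap F p) (chartAt _ p p)
        (mfderiv (𝓡 3) (𝓡 3) (chartAt (EuclideanSpace ℝ (Fin 3)) (F p)) (F p) ν)
        (EuclideanSpace.single i 1) (EuclideanSpace.single j 1) := by
  have he : chartAt (EuclideanSpace ℝ (Fin 2)) p ∈ IsManifold.maximalAtlas (𝓡 2) ∞ S :=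
    IsManifold.chart_mem_maximalAtlas _
  have hc : chartAt (EuclideanSpace ℝ (Fin 3)) (F p) ∈ IsManifold.maximalAtlas (𝓡 3) ∞ M :=
    IsManifold.chart_mem_maximalAtlas _
  have hpe := (chartAt (EuclideanSpace ℝ (Fin 2)) p).left_inv (mem_chart_source _ p)
  have hs : ContDiffAt ℝ ∞ (localMap F p) (chartAt _ p p) :=
    contDiffAt_coordMap he hc hF (mem_chart_target _ p)
      (by rw [hpe]; exact mem_chart_source _ _)
  set f := localMap F p with hf
  set u := chartAt (EuclideanSpace ℝ (Fin 2)) p p with hu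
  have hfu : f u = chartAt (EuclideanSpace ℝ (Fin 3)) (F p) (F p) := localMap_self F p
  set c := chartAt (EuclideanSpace ℝ (Fin 3)) (F p) with hcdef
  set b := chartForm g.form c with hb
  set w : EuclideanSpace ℝ (Fin 3) := mfderiv (𝓡 3) (𝓡 3) c (F p) ν with hw
  have hG : coordMatrix g.form c = fun z => formMatrix (b z) := by
    ext1 z; rw [hb, formMatrix_chartForm]
  have h1 (k : Fin 3) (i : Fin 2) : partialDeriv i (fun z => f z k) u =
      fderiv ℝ f u (EuclideanSpace.single i 1) k :=
    fderiv_apply_apply (hs.differentiableAt (by simp)) k _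
  have h2 (k : Fin 3) (i j : Fin 2) : partialDeriv i (partialDeriv j (fun z => f z k)) u =
      fderiv ℝ (fderiv ℝ f) u (EuclideanSpace.single i 1) (EuclideanSpace.single j 1) k := by
    have hev : partialDeriv j (fun z => f z k) =ᶠ[𝓝 u]
        fun z => fderiv ℝ f z (EuclideanSpace.single j 1) k := by
      filter_upwards [(hs.nat_of_infty 1).eventually (by simp)] with z hz
      exact fderiv_apply_apply (hz.differentiableAt (by simp)) k _
    have hd := hasFDerivAt_fderiv_apply (hs.nat_of_infty 2) (EuclideanSpace.single j 1)
    rw [(partialDeriv_eventuallyEq hev i).eq_of_nhds, partialDeriv,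
      fderiv_apply_apply (f := fun z => fderiv ℝ f z (EuclideanSpace.single j 1))
        hd.differentiableAt, hd.fderiv]
    rfl
  have h3 (a k l : Fin 3) := sum_formMatrix_mul_christoffel hm.differentiableAt hm.isInner a k l
  have h4 : extrinsicCurvature g F p ν i j = ∑ a, ∑ b', -(coordMatrix g.form c (c (F p)) a b' * w a) *
    (partialDeriv i (partialDeriv j (fun z => f z b')) u
      + ∑ k, ∑ l, christoffel (coordMatrix g.form c) b' k l (c (F p)) *
        partialDeriv i (fun z => f z k) u * partialDeriv j (fun z => f z l) u) := rfl
  rw [h4, hG]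
  simp only [h1, h2]
  rw [covHessian, form_apply_eq_sum, hfu, lowChristoffel_eq_sum, neg_add, ← Finset.sum_neg_distrib,
    ← Finset.sum_neg_distrib, ← Finset.sum_add_distrib]
  refine Finset.sum_congr rfl fun a _ => ?_
  simp only [← h3, mul_add, Finset.sum_add_distrib, ← Finset.sum_neg_distrib]
  congr 1
  · exact Finset.sum_congr rfl fun b' _ => by ring
  · simp only [Finset.mul_sum, ← Finset.sum_neg_distrib]
    rw [Finset.sum_comm]
    refine Finset.sum_congr rfl fun k _ => ?_
    rw [Finset.sum_comm]
    exact Finset.sum_congr rfl fun l _ => Finset.sum_congr rfl fun b' _ => by ring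

theorem meanCurvature_eq_meanTrace {g : SmoothMetric 3 M} (hF : ContMDiff (𝓡 2) (𝓡 3) ∞ F)
    (p : S) (ν : TangentSpace (𝓡 3) (F p))
    (hm : IsMetricAt (chartForm g.form (chartAt _ (F p))) (chartAt _ (F p) (F p))) :
    meanCurvature g F p ν =
      -meanTrace (chartForm g.form (chartAt _ (F p))) (localMap F p) (chartAt _ p p)
        (mfderiv (𝓡 3) (𝓡 3) (chartAt (EuclideanSpace ℝ (Fin 3)) (F p)) (F p) ν) := by
  have hpe := (chartAt (EuclideanSpace ℝ (Fin 2)) p).left_inv (mem_chart_source _ p)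
  rw [meanCurvature, coordMatrix_inducedMetric g (IsManifold.chart_mem_maximalAtlas _)
    (IsManifold.chart_mem_maximalAtlas (F p)) hF (mem_chart_target _ p)
    (by rw [hpe]; exact mem_chart_source _ _)]
  unfold meanTrace coTrace
  rw [← Finset.sum_neg_distrib]
  refine Finset.sum_congr rfl fun i _ => ?_
  rw [← Finset.sum_neg_distrib]
  refine Finset.sum_congr rfl fun j _ => ?_
  rw [extrinsicCurvature_eq_covHessian hF p ν hm, mul_neg]
  rfl

end Geometry

/-! ### Geometry of the surface and the pointwise area estimate on it -/

section SurfaceGeometry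

open Filter Topology

theorem fderiv_coordMap_id_mfderiv {n : ℕ} {N : Type*} [TopologicalSpace N]
    [ChartedSpace (EuclideanSpace ℝ (Fin n)) N] [IsManifold (𝓡 n) ∞ N]
    {c c' : OpenPartialHomeomorph N (EuclideanSpace ℝ (Fin n))}
    (hc : c ∈ IsManifold.maximalAtlas (𝓡 n) ∞ N) (hc' : c' ∈ IsManifold.maximalAtlas (𝓡 n) ∞ N)
    {x : N} (hx : x ∈ c.source) (hx' : x ∈ c'.source) (v : TangentSpace (𝓡 n) x) :
    @Eq (EuclideanSpace ℝ (Fin n))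
      (fderiv ℝ (coordMap c c' id) (c x) (mfderiv (𝓡 n) (𝓡 n) c x v))
      (mfderiv (𝓡 n) (𝓡 n) c' x v) := by
  have hev : coordMap c c' id ∘ c =ᶠ[𝓝 x] c' := by
    filter_upwards [c.open_source.mem_nhds hx] with z hz
    simp [coordMap, c.left_inv hz]
  have h1 : MDifferentiableAt (𝓡 n) (𝓡 n) (coordMap c c' id) (c x) :=
    mdifferentiableAt_iff_differentiableAt.2 ((contDiffAt_coordMap hc hc' contMDiff_id
      (c.map_source hx) (by simpa [c.left_inv hx] using hx')).differentiableAt (by simp))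
  have h2 := (mdifferentiable_of_mem_maximalAtlas hc).mdifferentiableAt hx
  have h3 := hev.mfderiv_eq (I := 𝓡 n) (I' := 𝓡 n)
  rw [mfderiv_comp x h1 h2, mfderiv_eq_fderiv] at h3
  exact DFunLike.congr_fun h3 v

variable {M : Type*} [TopologicalSpace M] [ChartedSpace (EuclideanSpace ℝ (Fin 3)) M]
  [IsManifold (𝓡 3) ∞ M]
  {S : Type*} [TopologicalSpace S] [ChartedSpace (EuclideanSpace ℝ (Fin 2)) S]
  [IsManifold (𝓡 2) ∞ S] {F : S → M}
  {e : OpenPartialHomeomorph S (EuclideanSpace ℝ (Fin 2))}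
  {c : OpenPartialHomeomorph M (EuclideanSpace ℝ (Fin 3))} {y : EuclideanSpace ℝ (Fin 2)}
  {g : SmoothMetric 3 M}

theorem IsUnitNormal.chartForm_self (hc : c ∈ IsManifold.maximalAtlas (𝓡 3) ∞ M)
    {p : S} (hFy : F p ∈ c.source) {ν : TangentSpace (𝓡 3) (F p)} (hν : IsUnitNormal g F p ν) :
    chartForm g.form c (c (F p)) (mfderiv (𝓡 3) (𝓡 3) c (F p) ν)
      (mfderiv (𝓡 3) (𝓡 3) c (F p) ν) = 1 :=
  (chartForm_mfderiv g.isBilinearField hc hFy ν (mfderiv_symm_mfderiv hc hFy ν)).trans hν.1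

theorem IsUnitNormal.chartForm_tangent (he : e ∈ IsManifold.maximalAtlas (𝓡 2) ∞ S)
    (hc : c ∈ IsManifold.maximalAtlas (𝓡 3) ∞ M) (hF : ContMDiff (𝓡 2) (𝓡 3) ∞ F)
    (hy : y ∈ e.target) (hFy : F (e.symm y) ∈ c.source)
    {ν : TangentSpace (𝓡 3) (F (e.symm y))} (hν : IsUnitNormal g F (e.symm y) ν)
    (u : EuclideanSpace ℝ (Fin 2)) :
    chartForm g.form c (coordMap e c F y) (mfderiv (𝓡 3) (𝓡 3) c (F (e.symm y)) ν)
      (fderiv ℝ (coordMap e c F) y u) = 0 :=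
  (chartForm_mfderiv g.isBilinearField hc hFy ν
    (mfderiv_symm_fderiv_coordMap he hc hF hy hFy u)).trans (hν.2 _)

/-- The square of the mean curvature can be computed in any charts. -/
theorem meanCurvature_sq_eq_meanSq
    (hg : ∀ c ∈ IsManifold.maximalAtlas (𝓡 3) ∞ M, ∀ z ∈ c.target,
      IsMetricAt (chartForm g.form c) z)
    (he : e ∈ IsManifold.maximalAtlas (𝓡 2) ∞ S) (hc : c ∈ IsManifold.maximalAtlas (𝓡 3) ∞ M)
    (hF : ContMDiff (𝓡 2) (𝓡 3) ∞ F) (hFi : ∀ p, Function.Injective (mfderiv (𝓡 2) (𝓡 3) F p))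
    (hy : y ∈ e.target) (hFy : F (e.symm y) ∈ c.source)
    {ν : TangentSpace (𝓡 3) (F (e.symm y))} (hν : IsUnitNormal g F (e.symm y) ν) :
    meanCurvature g F (e.symm y) ν ^ 2 = meanSq (chartForm g.form c) (coordMap e c F) y := by
  set e' := chartAt (EuclideanSpace ℝ (Fin 2)) (e.symm y) with he'def
  set c' := chartAt (EuclideanSpace ℝ (Fin 3)) (F (e.symm y)) with hc'def
  have he' : e' ∈ IsManifold.maximalAtlas (𝓡 2) ∞ S := IsManifold.chart_mem_maximalAtlas _
  have hc' : c' ∈ IsManifold.maximalAtlas (𝓡 3) ∞ M := IsManifold.chart_mem_maximalAtlas _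
  have hpe' : (e.symm y) ∈ e'.source := mem_chart_source _ _
  have hpc' : F (e.symm y) ∈ c'.source := mem_chart_source _ _
  have hpe : (e.symm y) ∈ e.source := e.map_target hy
  have hψy : coordMap e' e id (e' (e.symm y)) = y := by
    simp only [coordMap, id, e'.left_inv hpe', e.right_inv hy]
  have hφy : coordMap c c' id (coordMap e c F y) = c' (F (e.symm y)) := by
    simp only [coordMap, id]
    rw [c.left_inv hFy]
  have hmc : IsMetricAt (chartForm g.form c) (coordMap e c F y) := hg c hc _ (c.map_source hFy)
  have hFs := contDiffAt_coordMap he hc hF hy hFy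
  have hFinj := injective_fderiv_coordMap he hc hF hy hFy (hFi _)
  rw [← hmc.meanTrace_sq hFinj (hν.chartForm_self hc hFy) (hν.chartForm_tangent he hc hF hy hFy),
    meanCurvature_eq_meanTrace hF (e.symm y) ν (hg c' hc' _ (c'.map_source hpc')), neg_sq]
  refine congrArg (fun r : ℝ => r ^ 2) ?_
  have hyid : id (c.symm (coordMap e c F y)) ∈ c'.source := by
    simp only [coordMap, id]
    rw [c.left_inv hFy]
    exact hpc'
  have hy'id : id (e'.symm (e' (e.symm y))) ∈ e.source := by rwa [id, e'.left_inv hpe']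
  have hF' : localMap F (e.symm y) =ᶠ[𝓝 (e' (e.symm y))] coordMap c c' id ∘ coordMap e c F ∘ coordMap e' e id := by
    have h1 := eventually_mem_source (e := e') (c := e) continuous_id (e'.map_source hpe') hy'id
    have h2 := eventually_mem_source (e := e') (c := c) hF.continuous (e'.map_source hpe')
      (by rwa [e'.left_inv hpe'])
    filter_upwards [h1, h2] with z hz1 hz2
    change c' (F (e'.symm z)) = c' (c.symm (c (F (e.symm (e (e'.symm z))))))
    rw [e.left_inv (show e'.symm z ∈ e.source from hz1.2), c.left_inv hz2.2]
  have hbb : pullbackForm (chartForm g.form c') (coordMap c c' id) =ᶠ[𝓝 (coordMap e c F y)]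
      chartForm g.form c := by
    filter_upwards [eventually_mem_source (e := c) (c := c') continuous_id (c.map_source hFy) hyid]
      with z hz
    exact (matrixForm_eq_of_formMatrix
      (g.isBilinearField.coordMatrix_chart_change hc hc' hz.1 hz.2)).symm
  have hφ := contDiffAt_coordMap hc hc' contMDiff_id (c.map_source hFy) hyid
  have hψ := contDiffAt_coordMap he' he contMDiff_id (e'.map_source hpe') hy'id
  have hψi := injective_fderiv_coordMap he' he contMDiff_id (e'.map_source hpe') hy'id
    (by rw [mfderiv_id]; exact Function.injective_id)
  -- The preferred charts vary with the point, whereas continuity has to be checked in fixed charts.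
  -- Here the target is changed from `c` to `c'` and the source from `e'` to `e`.
  have key := meanTrace_chart_change (b' := chartForm g.form c') (b := chartForm g.form c)
    (F := coordMap e c F) (φ := coordMap c c' id) (ψ := coordMap e' e id) (y := e' (e.symm y))
    (ν := mfderiv (𝓡 3) (𝓡 3) c (F (e.symm y)) ν) hF'
    (by rw [hψy]; exact hbb) (by rw [hψy, hφy]; exact hg c' hc' _ (c'.map_source hpc'))
    (by rw [hψy]; exact hmc) (by rw [hψy]; exact hφ) (by rw [hψy]; exact hFs) hψ
    (by rw [hψy]; exact hFinj) hψi
    (by rw [hψy]; exact hν.chartForm_tangent he hc hF hy hFy)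
  rw [hψy] at key
  refine Eq.trans ?_ key
  exact congrArg (meanTrace (chartForm g.form c') (localMap F (e.symm y)) (e' (e.symm y)))
    (fderiv_coordMap_id_mfderiv hc hc' hFy hpc' ν).symm

theorem meanCurvature_sq_eq_meanTrace_sq {p : S}
    (hg : ∀ c ∈ IsManifold.maximalAtlas (𝓡 3) ∞ M, ∀ z ∈ c.target,
      IsMetricAt (chartForm g.form c) z) (hF : ContMDiff (𝓡 2) (𝓡 3) ∞ F)
    (ν : TangentSpace (𝓡 3) (F p)) :
    meanCurvature g F p ν ^ 2 =
      meanTrace (chartForm g.form (chartAt _ (F p))) (localMap F p) (chartAt _ p p)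
        (mfderiv (𝓡 3) (𝓡 3) (chartAt (EuclideanSpace ℝ (Fin 3)) (F p)) (F p) ν) ^ 2 := by
  rw [meanCurvature_eq_meanTrace hF p ν (hg _ (IsManifold.chart_mem_maximalAtlas _) _
    (mem_chart_target _ _)), neg_sq]

/-- The pointwise area estimate in the preferred charts. -/
theorem IsRG2Flow.exists_deriv_sqrt_det_chartAt {α : ℝ} (hα : 0 ≤ α) {J : Set ℝ}
    {h : ℝ → SmoothMetric 3 M} (hflow : IsRG2Flow α J h) {t : ℝ} (ht : t ∈ J)
    (hF : ContMDiff (𝓡 2) (𝓡 3) ∞ F) (hFi : ∀ p, Function.Injective (mfderiv (𝓡 2) (𝓡 3) F p))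
    {p : S} (hR : 0 ≤ scalarCurvature (h t).form (F p)) {ν : TangentSpace (𝓡 3) (F p)}
    (hν : IsUnitNormal (h t) F p ν) :
    ∃ D : ℝ, HasDerivWithinAt (fun s => √(coordMatrix (inducedMetric (h s) F)
        (chartAt _ p) (chartAt (EuclideanSpace ℝ (Fin 2)) p p)).det) D J t ∧
      D ≤ -(1 / 4) * ((2 * scalarCurvature (inducedMetric (h t) F) p
        - meanCurvature (h t) F p ν ^ 2) * √(coordMatrix (inducedMetric (h t) F)
        (chartAt _ p) (chartAt (EuclideanSpace ℝ (Fin 2)) p p)).det) := by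
  set e := chartAt (EuclideanSpace ℝ (Fin 2)) p with hedef
  set c := chartAt (EuclideanSpace ℝ (Fin 3)) (F p) with hcdef
  have he : e ∈ IsManifold.maximalAtlas (𝓡 2) ∞ S := IsManifold.chart_mem_maximalAtlas _
  have hc : c ∈ IsManifold.maximalAtlas (𝓡 3) ∞ M := IsManifold.chart_mem_maximalAtlas _
  have hpe : p ∈ e.source := mem_chart_source _ _
  have hpc : F p ∈ c.source := mem_chart_source _ _
  have hy := e.map_source hpe
  have hep : e.symm (e p) = p := e.left_inv hpe
  have hFy : F (e.symm (e p)) ∈ c.source := by rwa [hep]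
  have hFp : coordMap e c F (e p) = c (F p) := by simp only [coordMap, hep]
  have hm : IsMetricAt (chartForm (h t).form c) (coordMap e c F (e p)) :=
    hflow.isMetricAt ht hc (c.map_source hFy)
  have hcoord (s : ℝ) := coordMatrix_inducedMetric (h s) he hc hF hy hFy
  have hcoordev : coordMatrix (inducedMetric (h t) F) e =ᶠ[𝓝 (e p)]
      fun z => formMatrix (pullbackForm (chartForm (h t).form c) (coordMap e c F) z) := by
    filter_upwards [eventually_mem_source hF.continuous hy hFy] with z hz
    exact coordMatrix_inducedMetric (h t) he hc hF hz.1 hz.2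
  have hνF (u : EuclideanSpace ℝ (Fin 2)) : chartForm (h t).form c (coordMap e c F (e p))
      (mfderiv (𝓡 3) (𝓡 3) c (F p) ν) (fderiv ℝ (coordMap e c F) (e p) u) = 0 := by
    -- Normality is known at `p`, while the chain rule produces the derivative of `F` at `e.symm (e
    -- p)`; the equality of base points is substituted in this generalized form.
    have key : ∀ q, q = p → ∀ v : EuclideanSpace ℝ (Fin 2),
        (h t).form (F p) ν (mfderiv (𝓡 2) (𝓡 3) F q v) = 0 := by
      rintro q rfl v; exact hν.2 v
    rw [hFp]
    exact (chartForm_mfderiv (h t).isBilinearField hc hpc ν (by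
      rw [← hFp]; exact mfderiv_symm_fderiv_coordMap he hc hF hy hFy u)).trans (key _ hep _)
  obtain ⟨D, hD, hle⟩ := exists_deriv_area_density (b := fun s => chartForm (h s).form c)
    (J := J) (ν := mfderiv (𝓡 3) (𝓡 3) c (F p) ν) hα hm
    (contDiffAt_coordMap he hc hF hy hFy) (injective_fderiv_coordMap he hc hF hy hFy (hFi _))
    (by rw [hFp]; exact hν.chartForm_self hc hpc) hνF
    (fun i j => by
      simp only [formMatrix_chartForm]
      exact hflow.flow c hc t ht _ (c.map_source hFy) i j)
    (by simp only [formMatrix_chartForm]; rw [hFp]; exact hR)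
  refine ⟨D, ?_, ?_⟩
  · simpa only [hcoord] using hD
  · rw [meanCurvature_sq_eq_meanTrace_sq (fun c hc z hz => hflow.isMetricAt ht hc hz) hF,
      scalarCurvature, coordScalarCurvature_congr hcoordev, hcoord]
    exact hle

/-- The pointwise area estimate in an arbitrary chart. -/
theorem IsRG2Flow.exists_deriv_sqrt_det {α : ℝ} (hα : 0 ≤ α) {J : Set ℝ}
    {h : ℝ → SmoothMetric 3 M} (hflow : IsRG2Flow α J h) {t : ℝ} (ht : t ∈ J)
    (hF : ContMDiff (𝓡 2) (𝓡 3) ∞ F) (hFi : ∀ p, Function.Injective (mfderiv (𝓡 2) (𝓡 3) F p))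
    (hR : ∀ p, 0 ≤ scalarCurvature (h t).form (F p)) {ν : ∀ p : S, TangentSpace (𝓡 3) (F p)}
    (hν : ∀ p, IsUnitNormal (h t) F p (ν p))
    (he : e ∈ IsManifold.maximalAtlas (𝓡 2) ∞ S) (hy : y ∈ e.target) :
    ∃ D : ℝ, HasDerivWithinAt (fun s => √(coordMatrix (inducedMetric (h s) F) e y).det) D J t ∧
      D ≤ -(1 / 4) * ((2 * scalarCurvature (inducedMetric (h t) F) (e.symm y)
        - meanCurvature (h t) F (e.symm y) (ν (e.symm y)) ^ 2) *
          √(coordMatrix (inducedMetric (h t) F) e y).det) := by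
  obtain ⟨D, hD, hle⟩ := hflow.exists_deriv_sqrt_det_chartAt hα ht hF hFi (hR (e.symm y))
    (hν (e.symm y))
  set e' := chartAt (EuclideanSpace ℝ (Fin 2)) (e.symm y) with he'def
  have he' : e' ∈ IsManifold.maximalAtlas (𝓡 2) ∞ S := IsManifold.chart_mem_maximalAtlas _
  have hdet (s : ℝ) := sqrt_det_pullbackForm (chartForm (inducedMetric (h s) F) e')
    (coordMap e e' id) y
  have hcc (s : ℝ) := (isBilinearField_inducedMetric (h s) F).coordMatrix_chart_change he he' hy
    (mem_chart_source _ _)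
  simp only [← hcc, formMatrix_chartForm] at hdet
  -- Both the derivative of the density and its upper bound scale by this time-independent
  -- nonnegative factor, so the estimate in the preferred chart carries over to `e`.
  set P : ℝ := |(Matrix.of fun a i => fderiv ℝ (coordMap e e' id) y
    (EuclideanSpace.single i 1) a : Matrix (Fin 2) (Fin 2) ℝ).det| with hP
  have hP0 : 0 ≤ P := abs_nonneg _
  have hdet' (s : ℝ) : √(coordMatrix (inducedMetric (h s) F) e y).det =
      P * √(coordMatrix (inducedMetric (h s) F) e' (e' (e.symm y))).det := hdet s
  refine ⟨P * D, ?_, ?_⟩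
  · simp only [hdet']
    exact hD.const_mul P
  · rw [hdet']
    refine (mul_le_mul_of_nonneg_left hle hP0).trans_eq ?_
    ring

end SurfaceGeometry

/-! ### Differentiation under the integral sign, one-sided at endpoints -/

section ParametricIntegral

open Filter Topology MeasureTheory

variable {E : Type*} [NormedAddCommGroup E] [NormedSpace ℝ E]

/-- A function which is `C¹` in time and space is Lipschitz in time, uniformly on compact sets. -/
theorem exists_lipschitz_const_of_contDiffWithinAt {J : Set ℝ} (hJ : Convex ℝ J) {t : ℝ}
    (ht : t ∈ J) {f : ℝ → E → ℝ} {K : Set E} (hK : IsCompact K)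
    (hf : ∀ y ∈ K, ContDiffWithinAt ℝ 1 (fun q : ℝ × E => f q.1 q.2) (J ×ˢ univ) (t, y)) :
    ∃ C, 0 ≤ C ∧ ∀ᶠ s in 𝓝[J] t, ∀ y ∈ K, |f s y - f t y| ≤ C * |s - t| := by
  refine hK.induction_on (p := fun K => ∃ C, 0 ≤ C ∧ ∀ᶠ s in 𝓝[J] t, ∀ y ∈ K,
    |f s y - f t y| ≤ C * |s - t|) ⟨0, le_rfl, by simp⟩ ?_ ?_ ?_
  · rintro A B hAB ⟨C, hC, h⟩
    exact ⟨C, hC, h.mono fun s hs y hy => hs y (hAB hy)⟩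
  · rintro A B ⟨C, hC, h⟩ ⟨C', hC', h'⟩
    refine ⟨C + C', add_nonneg hC hC', ?_⟩
    filter_upwards [h, h'] with s hs hs' y hy
    rw [add_mul]
    rcases hy with hy | hy
    · exact (hs y hy).trans (le_add_of_nonneg_right (by positivity))
    · exact (hs' y hy).trans (le_add_of_nonneg_left (by positivity))
  · intro y hy
    -- Convexity of `J ×ˢ univ` makes a function that is C¹ within it locally Lipschitz, also when
    -- `t` is an endpoint of `J`.
    obtain ⟨C, U, hU, hL⟩ := (hf y hy).exists_lipschitzOnWith (hJ.prod convex_univ)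
    rw [nhdsWithin_prod_eq, nhdsWithin_univ, mem_prod_iff] at hU
    obtain ⟨A, hA, V, hV, hAV⟩ := hU
    refine ⟨V, mem_nhdsWithin_of_mem_nhds hV, C, C.2, ?_⟩
    filter_upwards [hA] with s hs z hz
    have h := hL.dist_le_mul (s, z) (hAV ⟨hs, hz⟩) (t, z) (hAV ⟨mem_of_mem_nhdsWithin ht hA, hz⟩)
    simpa [Real.dist_eq, Prod.dist_eq] using h

variable [MeasurableSpace E] [BorelSpace E] [FiniteDimensional ℝ E] {μ : Measure E}
  [IsFiniteMeasureOnCompacts μ]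

theorem integrableOn_mul_of_compact_support {T K : Set E} (hT : MeasurableSet T) (hK : IsCompact K)
    (hKT : K ⊆ T) {χ φ : E → ℝ} (hχ : ContinuousOn χ T) (hφ : ContinuousOn φ T)
    (h0 : ∀ y ∈ T \ K, χ y = 0) : IntegrableOn (fun y => χ y * φ y) T μ :=
  ((hχ.mul hφ).mono hKT |>.integrableOn_compact hK).of_forall_sdiff_eq_zero hT
    fun y hy => by simp [h0 y hy]

/-- Dominated convergence: the difference quotients of χf are bounded by a constant on `K`, by the
uniform Lipschitz estimate, and vanish on `T \ K`. Since χ ≥ 0, the bound on `D` survives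
multiplication by χ and integration. -/
theorem exists_hasDerivWithinAt_setIntegral_le {J : Set ℝ} (hJ : Convex ℝ J) (hJ' : J.Nontrivial)
    {t : ℝ} (ht : t ∈ J) {T K : Set E} (hT : MeasurableSet T) (hK : IsCompact K) (hKT : K ⊆ T)
    {χ B D : E → ℝ} {f : ℝ → E → ℝ} (hχ : ContinuousOn χ T) (h0 : ∀ y ∈ T \ K, χ y = 0)
    (hχ0 : ∀ y, 0 ≤ χ y) (hχ1 : ∀ y, χ y ≤ 1)
    (hf : ∀ s ∈ J, ∀ y ∈ T, ContDiffWithinAt ℝ 1 (fun q : ℝ × E => f q.1 q.2) (J ×ˢ univ) (s, y))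
    (hD : ∀ y ∈ T, HasDerivWithinAt (fun s => f s y) (D y) J t) (hB : ContinuousOn B T)
    (hDB : ∀ y ∈ T, D y ≤ B y) :
    ∃ A', HasDerivWithinAt (fun s => ∫ y in T, χ y * f s y ∂μ) A' J t ∧
      A' ≤ ∫ y in T, χ y * B y ∂μ := by
  obtain ⟨C, hC, hlip⟩ := exists_lipschitz_const_of_contDiffWithinAt hJ ht hK
    fun y hy => hf t ht y (hKT hy)
  have hfc (s : ℝ) (hs : s ∈ J) : ContinuousOn (f s) T := by
    intro y hy
    have h1 : ContinuousWithinAt (fun z : E => (s, z)) T y := by fun_prop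
    exact (hf s hs y hy).continuousWithinAt.comp h1 fun z _ => ⟨hs, mem_univ _⟩
  have hint (s : ℝ) (hs : s ∈ J) : IntegrableOn (fun y => χ y * f s y) T μ :=
    integrableOn_mul_of_compact_support hT hK hKT hχ (hfc s hs) h0
  -- A connected set with more than one point accumulates at each of its points. Without this there
  -- would be no difference quotients from which to recover `D`.
  have hne : (𝓝[J \ {t}] t).NeBot := by
    have h : (𝓝[≠] t ⊓ 𝓟 J).NeBot := hJ.isPreconnected.preperfect_of_nontrivial hJ' t ht
    rwa [nhdsWithin, inf_assoc, inf_principal, inter_comm] at h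
  have hmono : 𝓝[J \ {t}] t ≤ 𝓝[J] t := nhdsWithin_mono _ sdiff_subset
  have hmemJ : ∀ᶠ s in 𝓝[J \ {t}] t, s ∈ J \ {t} := self_mem_nhdsWithin
  have hslope (y : E) (hy : y ∈ T) : Tendsto (fun s => χ y * slope (fun s => f s y) t s)
      (𝓝[J \ {t}] t) (𝓝 (χ y * D y)) :=
    (hasDerivWithinAt_iff_tendsto_slope.1 (hD y hy)).const_mul _
  have hbound : ∀ᶠ s in 𝓝[J \ {t}] t, ∀ y ∈ T,
      ‖χ y * slope (fun s => f s y) t s‖ ≤ K.indicator (fun _ => C) y := by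
    filter_upwards [hmono hlip, hmemJ] with s hs hsJ y hy
    by_cases hyK : y ∈ K
    · rw [indicator_of_mem hyK, norm_mul, Real.norm_of_nonneg (hχ0 y)]
      have h1 : ‖slope (fun s => f s y) t s‖ ≤ C := by
        have hst : 0 < |s - t| := abs_pos.2 (sub_ne_zero.2 hsJ.2)
        rw [slope_def_field, Real.norm_eq_abs, abs_div, div_le_iff₀ hst]
        exact hs y hyK
      calc χ y * ‖slope (fun s => f s y) t s‖ ≤ 1 * C :=
            mul_le_mul (hχ1 y) h1 (norm_nonneg _) zero_le_one
        _ = C := one_mul C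
    · rw [indicator_of_notMem hyK, h0 y ⟨hy, hyK⟩, zero_mul, norm_zero]
  have hslope_eq (s : ℝ) : (fun y => χ y * slope (fun s => f s y) t s) =
      fun y => (s - t)⁻¹ * (χ y * f s y - χ y * f t y) := by
    ext y
    rw [slope_def_field]
    ring
  have hslope_int : ∀ᶠ s in 𝓝[J \ {t}] t,
      IntegrableOn (fun y => χ y * slope (fun s => f s y) t s) T μ := by
    filter_upwards [hmemJ] with s hs
    rw [hslope_eq]
    exact ((hint s hs.1).sub (hint t ht)).const_mul _
  have hbint : IntegrableOn (K.indicator fun _ => C) T μ :=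
    ((integrable_indicator_iff hK.measurableSet).2
      (integrableOn_const hK.measure_lt_top.ne)).integrableOn
  have hlim := tendsto_integral_filter_of_dominated_convergence (μ := μ.restrict T)
    (K.indicator fun _ => C) (hslope_int.mono fun s hs => hs.aestronglyMeasurable)
    (hbound.mono fun s hs => (ae_restrict_iff' hT).2 (ae_of_all _ hs)) hbint
    ((ae_restrict_iff' hT).2 (ae_of_all _ hslope))
  have hDint : IntegrableOn (fun y => χ y * D y) T μ := by
    -- Measurability of `D` is not assumed: it is inherited from the difference quotients along a
    -- sequence of times. Dropping the first `N` times makes all of these quotients integrable.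
    obtain ⟨u, hu⟩ := exists_seq_tendsto (𝓝[J \ {t}] t)
    obtain ⟨N, hN⟩ := eventually_atTop.1 (hu.eventually hslope_int)
    refine Integrable.mono' hbint ?_ ?_
    · refine aestronglyMeasurable_of_tendsto_ae atTop
        (f := fun k y => χ y * slope (fun s => f s y) t (u (k + N)))
        (fun k => (hN _ (Nat.le_add_left N k)).aestronglyMeasurable) ?_
      exact (ae_restrict_iff' hT).2 (ae_of_all _ fun y hy =>
        ((hslope y hy).comp hu).comp (tendsto_add_atTop_nat N))
    · exact (ae_restrict_iff' hT).2 (ae_of_all _ fun y hy =>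
        le_of_tendsto (hslope y hy).norm (hbound.mono fun s hs => hs y hy))
  refine ⟨∫ y in T, χ y * D y ∂μ, hasDerivWithinAt_iff_tendsto_slope.2 (hlim.congr' ?_), ?_⟩
  · filter_upwards [hmemJ] with s hs
    rw [hslope_eq, integral_const_mul, integral_sub (hint s hs.1) (hint t ht), slope_def_field]
    ring
  · exact setIntegral_mono_on hDint (integrableOn_mul_of_compact_support hT hK hKT hχ hB h0) hT
      fun y hy => mul_le_mul_of_nonneg_left (hDB y hy) (hχ0 y)

end ParametricIntegral

/-! ### Regularity of the integrands and reduction to finitely many charts -/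

section Area

open Filter Topology MeasureTheory

variable {M : Type*} [TopologicalSpace M] [ChartedSpace (EuclideanSpace ℝ (Fin 3)) M]
  [IsManifold (𝓡 3) ∞ M]
  {S : Type*} [TopologicalSpace S] [ChartedSpace (EuclideanSpace ℝ (Fin 2)) S]
  [IsManifold (𝓡 2) ∞ S] {F : S → M}
  {e : OpenPartialHomeomorph S (EuclideanSpace ℝ (Fin 2))}
  {α t : ℝ} {J : Set ℝ} {h : ℝ → SmoothMetric 3 M}

theorem IsRG2Flow.isMetricAt_inducedMetric (hflow : IsRG2Flow α J h) (ht : t ∈ J)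
    (hF : ContMDiff (𝓡 2) (𝓡 3) ∞ F) (hFi : ∀ p, Function.Injective (mfderiv (𝓡 2) (𝓡 3) F p))
    (he : e ∈ IsManifold.maximalAtlas (𝓡 2) ∞ S) {y : EuclideanSpace ℝ (Fin 2)}
    (hy : y ∈ e.target) : IsMetricAt (chartForm (inducedMetric (h t) F) e) y := by
  have hc := IsManifold.chart_mem_maximalAtlas (I := 𝓡 3) (n := ∞) (F (e.symm y))
  exact IsMetricAt.inducedMetric he hc hF hFi hy (mem_chart_source _ _)
    (hflow.isMetricAt ht hc ((chartAt _ (F (e.symm y))).map_source (mem_chart_source _ _)))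

/-- Near each point the integrand is rewritten in a fixed pair of charts, with `meanSq` in place of
the mean curvature, since ν need not be continuous. Continuity is what makes the integrals over the
charts converge. -/
theorem IsRG2Flow.continuousOn_compactness_integrand (hflow : IsRG2Flow α J h) (ht : t ∈ J)
    (hF : ContMDiff (𝓡 2) (𝓡 3) ∞ F) (hFi : ∀ p, Function.Injective (mfderiv (𝓡 2) (𝓡 3) F p))
    {ν : ∀ p : S, TangentSpace (𝓡 3) (F p)} (hν : ∀ p, IsUnitNormal (h t) F p (ν p))
    (he : e ∈ IsManifold.maximalAtlas (𝓡 2) ∞ S) :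
    ContinuousOn (fun z => 2 * scalarCurvature (inducedMetric (h t) F) (e.symm z)
      - meanCurvature (h t) F (e.symm z) (ν (e.symm z)) ^ 2) e.target := by
  intro y hy
  refine ContinuousAt.continuousWithinAt ?_
  have hc := IsManifold.chart_mem_maximalAtlas (I := 𝓡 3) (n := ∞) (F (e.symm y))
  have hyc := mem_chart_source (EuclideanSpace ℝ (Fin 3)) (F (e.symm y))
  have hev : (fun z => 2 * scalarCurvature (inducedMetric (h t) F) (e.symm z)
      - meanCurvature (h t) F (e.symm z) (ν (e.symm z)) ^ 2) =ᶠ[𝓝 y] fun z =>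
      2 * coordScalarCurvature (fun z => formMatrix (chartForm (inducedMetric (h t) F) e z)) z
        - meanSq (chartForm (h t).form (chartAt _ (F (e.symm y))))
            (coordMap e (chartAt _ (F (e.symm y))) F) z := by
    filter_upwards [eventually_mem_source hF.continuous hy hyc] with z hz
    rw [meanCurvature_sq_eq_meanSq (fun c hc z hz => hflow.isMetricAt ht hc hz) he hc hF hFi
      hz.1 hz.2 (hν _), scalarCurvature_eq_coordScalarCurvature
      (isBilinearField_inducedMetric (h t) F) he hz.1
      (hflow.isMetricAt_inducedMetric ht hF hFi (IsManifold.chart_mem_maximalAtlas _)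
        (mem_chart_target _ _))]
    simp only [formMatrix_chartForm]
  refine ContinuousAt.congr ?_ hev.symm
  exact (continuousAt_const.mul
    (hflow.isMetricAt_inducedMetric ht hF hFi he hy).contDiffAt_coordScalarCurvature.continuousAt).sub
    (continuousAt_meanSq (hflow.isMetricAt ht hc (OpenPartialHomeomorph.map_source _ hyc))
      (contDiffAt_coordMap he hc hF hy hyc) (injective_fderiv_coordMap he hc hF hy hyc (hFi _)))

/-- The entries of the induced metric are sums of products of first derivatives of `F` and jointly
smooth ambient components. The determinant does not vanish, so its square root is also C¹ in time
and space. -/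
theorem IsRG2Flow.contDiffWithinAt_sqrt_det (hflow : IsRG2Flow α J h) (ht : t ∈ J)
    (hF : ContMDiff (𝓡 2) (𝓡 3) ∞ F) (hFi : ∀ p, Function.Injective (mfderiv (𝓡 2) (𝓡 3) F p))
    (he : e ∈ IsManifold.maximalAtlas (𝓡 2) ∞ S) {y : EuclideanSpace ℝ (Fin 2)}
    (hy : y ∈ e.target) :
    ContDiffWithinAt ℝ 1 (fun q : ℝ × EuclideanSpace ℝ (Fin 2) =>
      √(coordMatrix (inducedMetric (h q.1) F) e q.2).det) (J ×ˢ univ) (t, y) := by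
  set c := chartAt (EuclideanSpace ℝ (Fin 3)) (F (e.symm y)) with hcdef
  have hc : c ∈ IsManifold.maximalAtlas (𝓡 3) ∞ M := IsManifold.chart_mem_maximalAtlas _
  have hyc : F (e.symm y) ∈ c.source := mem_chart_source _ _
  have hnear := eventually_mem_source hF.continuous hy hyc
  have hf := contDiffAt_coordMap he hc hF hy hyc
  have hdet0 : (coordMatrix (inducedMetric (h t) F) e y).det ≠ 0 := by
    have := (hflow.isMetricAt_inducedMetric ht hF hFi he hy).isInner.isUnit_det.ne_zero
    rwa [formMatrix_chartForm] at this
  refine ContDiffWithinAt.sqrt (contDiffAt_matrix_det fun i j => ?_) hdet0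
  have hentry (a b : Fin 3) : ContDiffWithinAt ℝ 1 (fun q : ℝ × EuclideanSpace ℝ (Fin 2) =>
      coordMatrix (h q.1).form c (coordMap e c F q.2) a b) (J ×ˢ univ) (t, y) := by
    have h1 : ContDiffWithinAt ℝ 1 (fun z : ℝ × EuclideanSpace ℝ (Fin 3) =>
        coordMatrix (h z.1).form c z.2 a b) (J ×ˢ c.target) (t, coordMap e c F y) :=
      (hflow.smooth c hc a b _ ⟨ht, c.map_source hyc⟩).of_le (by simp)
    have h2 : ContDiffWithinAt ℝ 1 (fun q : ℝ × EuclideanSpace ℝ (Fin 2) =>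
        (q.1, coordMap e c F q.2)) (J ×ˢ univ) (t, y) := by
      have h3 : ContDiffAt ℝ 1 (coordMap e c F) (t, y).2 := hf.nat_of_infty 1
      exact (contDiffAt_fst.prodMk (h3.comp (t, y) contDiffAt_snd)).contDiffWithinAt
    refine h1.comp_of_preimage_mem_nhdsWithin (t, y) h2 ?_
    rw [nhdsWithin_prod_eq, nhdsWithin_univ]
    filter_upwards [prod_mem_prod self_mem_nhdsWithin hnear] with q hq
    exact ⟨hq.1, c.map_source hq.2.2⟩
  have hcol (i : Fin 2) (a : Fin 3) : ContDiffWithinAt ℝ 1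
      (fun q : ℝ × EuclideanSpace ℝ (Fin 2) =>
        fderiv ℝ (coordMap e c F) q.2 (EuclideanSpace.single i 1) a) (J ×ˢ univ) (t, y) := by
    have h1 : ContDiffAt ℝ 1
        (fun z => fderiv ℝ (coordMap e c F) z (EuclideanSpace.single i 1) a) (t, y).2 :=
      (EuclideanSpace.proj (𝕜 := ℝ) a).contDiff.contDiffAt.comp _
        (((hf.nat_of_infty 2).fderiv_right (m := 1) (by norm_num)).clm_apply contDiffAt_const)
    exact (h1.comp (t, y) contDiffAt_snd).contDiffWithinAt
  have hsum : ContDiffWithinAt ℝ 1 (fun q : ℝ × EuclideanSpace ℝ (Fin 2) => ∑ a, ∑ b,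
      fderiv ℝ (coordMap e c F) q.2 (EuclideanSpace.single i 1) a *
      fderiv ℝ (coordMap e c F) q.2 (EuclideanSpace.single j 1) b *
      coordMatrix (h q.1).form c (coordMap e c F q.2) a b) (J ×ˢ univ) (t, y) :=
    ContDiffWithinAt.sum fun a _ => ContDiffWithinAt.sum fun b _ =>
      ((hcol i a).mul (hcol j b)).mul (hentry a b)
  have heq (q : ℝ × EuclideanSpace ℝ (Fin 2)) (hq : q.2 ∈ e.target ∧ F (e.symm q.2) ∈ c.source) :
      coordMatrix (inducedMetric (h q.1) F) e q.2 i j = ∑ a, ∑ b,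
      fderiv ℝ (coordMap e c F) q.2 (EuclideanSpace.single i 1) a *
      fderiv ℝ (coordMap e c F) q.2 (EuclideanSpace.single j 1) b *
      coordMatrix (h q.1).form c (coordMap e c F q.2) a b := by
    rw [coordMatrix_inducedMetric (h q.1) he hc hF hq.1 hq.2, formMatrix_apply, pullbackForm_apply,
      form_apply_eq_sum]
    simp only [formMatrix_chartForm]
  refine hsum.congr_of_eventuallyEq ?_ (heq (t, y) ⟨hy, hyc⟩)
  rw [nhdsWithin_prod_eq, nhdsWithin_univ]
  filter_upwards [prod_mem_prod self_mem_nhdsWithin hnear] with q hq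
  exact heq q hq.2

variable [CompactSpace S] [T2Space S]

/-- The set `I` depends only on the partition of unity, so the areas at all times and the
compactness become sums over the same charts and can be compared term by term. -/
theorem surfaceIntegral_eq_sum (γ : ∀ p : S, TangentSpace (𝓡 2) p → TangentSpace (𝓡 2) p → ℝ)
    (f : S → ℝ) {I : Finset S} (hI : ∀ p, p ∉ I → ∀ x, chartPartition S p x = 0) :
    surfaceIntegral γ f = ∑ p ∈ I, ∫ y in (chartAt (EuclideanSpace ℝ (Fin 2)) p).target,
      chartPartition S p ((chartAt (EuclideanSpace ℝ (Fin 2)) p).symm y) *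
        (f ((chartAt (EuclideanSpace ℝ (Fin 2)) p).symm y)
        * √(coordMatrix γ (chartAt (EuclideanSpace ℝ (Fin 2)) p) y).det) := by
  rw [surfaceIntegral, finsum_eq_sum_of_support_subset (s := I)]
  · simp only [mul_assoc]
  · intro p hp
    by_contra hpI
    refine hp ?_
    simp [hI p (by simpa using hpI)]

variable (S) in
theorem exists_finset_chartPartition :
    ∃ I : Finset S, ∀ p, p ∉ I → ∀ x, chartPartition S p x = 0 := by
  have hfin := (chartPartition S).locallyFinite.finite_nonempty_of_compact
  refine ⟨hfin.toFinset, fun p hp x => ?_⟩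
  by_contra hx
  exact hp (hfin.mem_toFinset.2 ⟨x, hx⟩)

end Area

/-! ### The area estimate -/

theorem mainTheorem2
    {M : Type*} [TopologicalSpace M] [ChartedSpace (EuclideanSpace ℝ (Fin 3)) M]
    [IsManifold (𝓡 3) ∞ M] [T2Space M] [SigmaCompactSpace M]
    {S : Type*} [TopologicalSpace S] [ChartedSpace (EuclideanSpace ℝ (Fin 2)) S]
    [IsManifold (𝓡 2) ∞ S] [CompactSpace S] [T2Space S]
    (F : S → M) (hF : Manifold.IsSmoothEmbedding (𝓡 2) (𝓡 3) ∞ F)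
    (α : ℝ) (hα : 0 ≤ α)
    (J : Set ℝ) (hJ : J.OrdConnected) (hJ' : J.Nontrivial)
    (h : ℝ → SmoothMetric 3 M) (hflow : IsRG2Flow α J h)
    (t : ℝ) (ht : t ∈ J)
    (hR : ∀ p : S, 0 ≤ scalarCurvature (h t).form (F p))
    (ν : ∀ p : S, TangentSpace (𝓡 3) (F p)) (hν : ∀ p : S, IsUnitNormal (h t) F p (ν p)) :
    ∃ A' : ℝ, HasDerivWithinAt (fun s => area (h s) F) A' J t ∧
      A' ≤ -(1 / 4) * compactness (h t) F ν := by
  have hFs : ContMDiff (𝓡 2) (𝓡 3) ∞ F := hF.contMDiff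
  have hFi (p : S) : Function.Injective (mfderiv (𝓡 2) (𝓡 3) F p) :=
    (hF.isImmersion.isImmersionAt p).mfderiv_injective hFs
  obtain ⟨I, hI⟩ := exists_finset_chartPartition S
  have hloc (p : S) : ∃ A', HasDerivWithinAt (fun s =>
      ∫ y in (chartAt (EuclideanSpace ℝ (Fin 2)) p).target,
        chartPartition S p ((chartAt (EuclideanSpace ℝ (Fin 2)) p).symm y) *
        √(coordMatrix (inducedMetric (h s) F) (chartAt (EuclideanSpace ℝ (Fin 2)) p) y).det) A' J t ∧
      A' ≤ ∫ y in (chartAt (EuclideanSpace ℝ (Fin 2)) p).target,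
        chartPartition S p ((chartAt (EuclideanSpace ℝ (Fin 2)) p).symm y) *
        (-(1 / 4) * ((2 * scalarCurvature (inducedMetric (h t) F)
            ((chartAt (EuclideanSpace ℝ (Fin 2)) p).symm y)
          - meanCurvature (h t) F ((chartAt (EuclideanSpace ℝ (Fin 2)) p).symm y)
            (ν ((chartAt (EuclideanSpace ℝ (Fin 2)) p).symm y)) ^ 2)
        * √(coordMatrix (inducedMetric (h t) F) (chartAt (EuclideanSpace ℝ (Fin 2)) p) y).det)) := by
    set e := chartAt (EuclideanSpace ℝ (Fin 2)) p with hedef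
    have he : e ∈ IsManifold.maximalAtlas (𝓡 2) ∞ S := IsManifold.chart_mem_maximalAtlas _
    have hsub : tsupport (chartPartition S p) ⊆ e.source := chartPartition_isSubordinate S p
    have hex (y : EuclideanSpace ℝ (Fin 2)) (hy : y ∈ e.target) :=
      hflow.exists_deriv_sqrt_det hα ht hFs hFi hR hν he hy
    choose! D hD hle using hex
    have hcont : ContinuousOn (fun y => √(coordMatrix (inducedMetric (h t) F) e y).det) e.target :=
      fun y hy => (hflow.contDiffWithinAt_sqrt_det ht hFs hFi he hy).continuousWithinAt.comp
        (f := fun z => (t, z)) (by fun_prop) fun z _ => ⟨ht, Set.mem_univ _⟩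
    -- The compact set is the chart image of the closed support of the partition function. It lies
    -- in the chart target by subordination, and `S` is compact.
    refine exists_hasDerivWithinAt_setIntegral_le (K := e '' tsupport (chartPartition S p))
      (D := D) hJ.convex hJ' ht e.open_target.measurableSet
      ((isClosed_tsupport _).isCompact.image_of_continuousOn (e.continuousOn.mono hsub))
      ((Set.image_mono hsub).trans e.mapsTo.image_subset)
      ((chartPartition S p).contMDiff.continuous.comp_continuousOn e.continuousOn_symm) ?_
      (fun y => (chartPartition S).nonneg p _) (fun y => (chartPartition S).le_one p _)
      (fun s hs y hy => hflow.contDiffWithinAt_sqrt_det hs hFs hFi he hy) hD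
      (continuousOn_const.mul
        ((hflow.continuousOn_compactness_integrand ht hFs hFi hν he).mul hcont)) hle
    rintro y ⟨hy, hyK⟩
    by_contra hne
    exact hyK ⟨e.symm y, subset_tsupport _ hne, e.right_inv hy⟩
  choose A' hA' hle using hloc
  refine ⟨∑ p ∈ I, A' p, ?_, ?_⟩
  · have harea (s : ℝ) := surfaceIntegral_eq_sum (inducedMetric (h s) F) (fun _ => 1) hI
    simp only [one_mul] at harea
    simp only [area, harea]
    exact HasDerivWithinAt.fun_sum fun p _ => hA' p
  · rw [compactness, surfaceIntegral_eq_sum _ _ hI, Finset.mul_sum]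
    -- The local bounds carry the factor -¼ inside the integral; moving it outside identifies their
    -- sum with -¼ times the compactness.
    refine Finset.sum_le_sum fun p _ => (hle p).trans_eq ?_
    rw [← MeasureTheory.integral_const_mul]
    refine MeasureTheory.integral_congr_ae (Filter.Eventually.of_forall fun y => ?_)
    ring
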